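/- There are a randomized algorithm $\mathcal A$, constants $C, c > 0$ and integers $N = N(d)$ with $1 \le N \le C d^3 \log d$ such that the following holds for every $d \ge 2$ and every set $P$ of $n \ge N$ points in $\mathbb{R}^d$. Let $k = \lfloor n/N \rfloor$; then $k \ge c\, n/(d^3 \log d)$. Color every point of $P$ independently and uniformly at random by one of $k$ colors, and let $P_1, \dots, P_k$ be the resulting color classes. Given $P$ (and not the coloring), $\mathcal A$ always stops after at most $C d^7 \log^6 d$ steps and outputs a point $q \in \mathbb{R}^d$, and $$\Pr\Bigl[\, q \in \bigcap_{i=1}^k \mathrm{conv}(P_i) \Bigr] \;\ge\; 1 - \frac{k}{d^{\,c d}},$$ where the probability is over the coloring and the independent random choices of $\mathcal A$. Here $\mathcal A$ is a single program, the same for all $d$, $n$ and $P$, on a real RAM with random access to the coordinates of the input points; each of the following takes one step, up to a constant factor: an arithmetic operation or comparison of exact real numbers, an addition, subtraction or comparison of integers, a memory access, and drawing a uniformly random integer from $\{0, \dots, m\}$ for a given integer $m$. -/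

import Mathlib

/-!
The randomized real RAM.  A program is a finite piece of syntax; it does not depend on the
dimension, on the number of points, or on the points.  It works on natural numbers and on exact
real numbers, which are kept in finitely many named arrays of either kind.

On integers there are only addition, truncated subtraction and comparison (no multiplication,
division or bit operations); on reals there are the four arithmetic operations and comparison
(no floor or any other conversion from reals to integers).
-/

namespace RealRAM

/-- Integer expressions. `arr a e` is the entry with index `e` of the integer array named `a`. -/
inductive IExp where
  | lit (m : ℕ) : IExp
  | arr (a : ℕ) (e : IExp) : IExp
  | add (e f : IExp) : IExp
  | sub (e f : IExp) : IExp

/-- Real expressions. `arr a e` is the entry with index `e` of the real array named `a`, and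
`input e f` is the coordinate number `f` of the input point number `e`. -/
inductive RExp where
  | ofInt (e : IExp) : RExp
  | arr (a : ℕ) (e : IExp) : RExp
  | input (e f : IExp) : RExp
  | add (r s : RExp) : RExp
  | sub (r s : RExp) : RExp
  | mul (r s : RExp) : RExp
  | div (r s : RExp) : RExp

/-- Tests. -/
inductive BExp where
  | ile (e f : IExp) : BExp
  | rle (r s : RExp) : BExp
  | not (b : BExp) : BExp
  | and (b c : BExp) : BExp

/-- Programs. `iset a e v` and `rset a e v` store the value of `v` in the entry `e` of the
integer (real) array `a`; `rand a e m` stores there an integer drawn uniformly at random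
from `{0, 1, …, m}`, independently of everything drawn before. -/
inductive Program where
  | skip : Program
  | iset (a : ℕ) (e v : IExp) : Program
  | rset (a : ℕ) (e : IExp) (v : RExp) : Program
  | rand (a : ℕ) (e m : IExp) : Program
  | seq (p q : Program) : Program
  | ite (b : BExp) (p q : Program) : Program
  | loop (b : BExp) (p : Program) : Program

/-- The writable memory: integer arrays and real arrays. -/
structure Memory where
  ints : ℕ → ℕ → ℕ
  reals : ℕ → ℕ → ℝ

/-- Write one entry of an integer array. -/
def Memory.setInt (σ : Memory) (a i v : ℕ) : Memory where
  ints := Function.update σ.ints a (Function.update (σ.ints a) i v)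
  reals := σ.reals

/-- Write one entry of a real array. -/
noncomputable def Memory.setReal (σ : Memory) (a i : ℕ) (v : ℝ) : Memory where
  ints := σ.ints
  reals := Function.update σ.reals a (Function.update (σ.reals a) i v)

def IExp.eval (σ : Memory) : IExp → ℕ
  | .lit m => m
  | .arr a e => σ.ints a (e.eval σ)
  | .add e f => e.eval σ + f.eval σ
  | .sub e f => e.eval σ - f.eval σ

/-- The read-only input: entry `(i, j)` is the coordinate `j` of the point `i`
(and `0` outside the range of the indices). -/
noncomputable def inputEntry {n d : ℕ} (P : Fin n → Fin d → ℝ) (i j : ℕ) : ℝ :=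
  if h : i < n ∧ j < d then P ⟨i, h.1⟩ ⟨j, h.2⟩ else 0

noncomputable def RExp.eval {n d : ℕ} (P : Fin n → Fin d → ℝ) (σ : Memory) : RExp → ℝ
  | .ofInt e => (e.eval σ : ℝ)
  | .arr a e => σ.reals a (e.eval σ)
  | .input e f => inputEntry P (e.eval σ) (f.eval σ)
  | .add r s => r.eval P σ + s.eval P σ
  | .sub r s => r.eval P σ - s.eval P σ
  | .mul r s => r.eval P σ * s.eval P σ
  | .div r s => r.eval P σ / s.eval P σ

def BExp.Holds {n d : ℕ} (P : Fin n → Fin d → ℝ) (σ : Memory) : BExp → Prop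
  | .ile e f => e.eval σ ≤ f.eval σ
  | .rle r s => r.eval P σ ≤ s.eval P σ
  | .not b => ¬ b.Holds P σ
  | .and b c => b.Holds P σ ∧ c.Holds P σ

/-- A configuration: the stack of program pieces that remain to be executed, and the memory. -/
structure Config where
  stack : List Program
  memory : Memory

open Classical in
/-- One step, which takes one unit of time: it executes the assignment or the random draw on top
of the stack, or evaluates one test, or unfolds a composition.  (Expressions occurring in a fixed
program have constant size, so that evaluating one takes constant time.)  The result is a
distribution over configurations.  A configuration with an empty stack is halted. -/
noncomputable def step {n d : ℕ} (P : Fin n → Fin d → ℝ) : Config → PMF Config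
  | ⟨[], σ⟩ => PMF.pure ⟨[], σ⟩
  | ⟨.skip :: K, σ⟩ => PMF.pure ⟨K, σ⟩
  | ⟨.iset a e v :: K, σ⟩ => PMF.pure ⟨K, σ.setInt a (e.eval σ) (v.eval σ)⟩
  | ⟨.rset a e v :: K, σ⟩ => PMF.pure ⟨K, σ.setReal a (e.eval σ) (v.eval P σ)⟩
  | ⟨.rand a e m :: K, σ⟩ =>
      (PMF.uniformOfFintype (Fin (m.eval σ + 1))).map
        fun r : Fin (m.eval σ + 1) => ⟨K, σ.setInt a (e.eval σ) r.val⟩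
  | ⟨.seq p q :: K, σ⟩ => PMF.pure ⟨p :: q :: K, σ⟩
  | ⟨.ite b p q :: K, σ⟩ => PMF.pure ⟨(if b.Holds P σ then p else q) :: K, σ⟩
  | ⟨.loop b p :: K, σ⟩ =>
      PMF.pure ⟨if b.Holds P σ then p :: .loop b p :: K else K, σ⟩

/-- The distribution of the configuration after `t` steps. -/
noncomputable def steps {n d : ℕ} (P : Fin n → Fin d → ℝ) : ℕ → Config → PMF Config
  | 0, c => PMF.pure c
  | t + 1, c => (step P c).bind (steps P t)

/-- Initially the entries `0` and `1` of the integer array `0` hold the dimension `d` and the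
number of points `n`; all other memory is zero. -/
def initMemory (n d : ℕ) : Memory where
  ints a i := if a = 0 ∧ i = 0 then d else if a = 0 ∧ i = 1 then n else 0
  reals _ _ := 0

/-- The distribution of the configuration of the program `A` after `t` steps on input `P`. -/
noncomputable def Program.run (A : Program) {n d : ℕ} (P : Fin n → Fin d → ℝ) (t : ℕ) :
    PMF Config :=
  steps P t ⟨[A], initMemory n d⟩

/-- On input `P`, the program halts within `t` steps, whatever the random draws are. -/
def Program.HaltsWithin (A : Program) {n d : ℕ} (P : Fin n → Fin d → ℝ) (t : ℕ) : Prop :=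
  ∀ c ∈ (A.run P t).support, c.stack = []

/-- The point written in the first `d` entries of the real array `0`. -/
def Config.outputPoint (d : ℕ) (c : Config) : Fin d → ℝ :=
  fun j => c.memory.reals 0 j

/-- The distribution of the output point after `t` steps. -/
noncomputable def Program.output (A : Program) {n d : ℕ} (P : Fin n → Fin d → ℝ) (t : ℕ) :
    PMF (Fin d → ℝ) :=
  (A.run P t).map (Config.outputPoint d)

end RealRAM

/-- A random coloring of `n` points by `k ≥ 1` colors: every point gets a color uniformly at
random, independently of the other points. -/
noncomputable def randomColoring (n k : ℕ) [NeZero k] : PMF (Fin n → Fin k) :=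
  PMF.uniformOfFintype (Fin n → Fin k)

/-- The class of color `i`. -/
def colorClass {n d k : ℕ} (P : Fin n → Fin d → ℝ) (χ : Fin n → Fin k) (i : Fin k) :
    Set (Fin d → ℝ) :=
  P '' {j | χ j = i}

/-- `q` lies in the convex hulls of all the color classes. -/
def IsTverbergPoint {n d k : ℕ} (P : Fin n → Fin d → ℝ) (χ : Fin n → Fin k)
    (q : Fin d → ℝ) : Prop :=
  q ∈ ⋂ i : Fin k, convexHull ℝ (colorClass P χ i)

/-- The probability, over a random coloring by `k` colors and, independently, over the random
draws of the program `A`, that the output of `A` on input `P` after `t` steps is a Tverberg point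
for the color classes.  The program does not see the coloring. -/
noncomputable def successProbability (A : RealRAM.Program) {n d : ℕ} (P : Fin n → Fin d → ℝ)
    (k : ℕ) [NeZero k] (t : ℕ) : ENNReal :=
  ((randomColoring n k).bind fun χ => (A.output P t).map fun q => (χ, q)).toOuterMeasure
    {x | IsTverbergPoint P x.1 x.2}

/-!
The algorithm computes an approximate center point by iterated Radon points. It draws
`m = levelSize d` of the `n` points at random, with repetition; this is level `0`. In each of
`J = roundCount d` rounds, each of the `m` points of the next level is the Radon point of `d + 2`
points that are drawn at random, with repetition, from the present level. The output is a point of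
the last level. Here `m` is of order `d ^ 3 * log d` and `J` of order `d * log d`, a Radon point
costs `O (d ^ 3)` steps of Gaussian elimination, and the random indices are all drawn in advance,
so that the computation proper is deterministic.

If a convex set `G` contains all but at most one of `d + 2` points, counted with repetition, it
contains their Radon point (`IsRadonPoint.mem`). So if `B` is the set of the bad indices of a level,
those of points outside `G`, then a point of the next level can be bad only if two of its `d + 2`
draws fall in `B`, which has probability at most `(d + 2) ^ 2 * (#B / m) ^ 2`, about. As long as
`B` has at most `X` elements with `8 * X * (d + 2) ^ 2 ≤ m`, the potential `2 ^ #B`, counted as `0`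
for empty `B`, is therefore halved on average in a round, so bad points survive all rounds with
probability at most `((1 / 2) ^ J + (1 / 2) ^ X) * 2 ^ #B` (`card_badAfter_nonempty_le`).

Suppose that the output `q` is not in the convex hull of color `i`. Then some halfspace `h` contains
`q` and no point of color `i`. Let `x` be of order `d * log d`, smaller than `J` and `X`.

* If `h` contains at most `x` sample points, take for `G` the complement of `h`: the bad points
  that start from a set of at most `x` points have survived all rounds.
* If `h` contains more than `x` sample points, there is a halfspace that contains at least `x`
  sample points but no point of color `i`. A halfspace with at least `n / (512 * d ^ 2)` of the
  points is unlikely to miss a color (a color class has about `m` points), and one with fewer of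
  them is unlikely to contain `x` sample points (`large_or_small`).

There are too many halfspaces for a union bound over all of them, even over all that cut off
different sets of input points, as the number of points is not bounded in terms of `d`. But it is
enough to consider halfspaces that depend on few points only: two disjoint convex hulls are
separated by the hyperplane that belongs to a closest pair, and by Carathéodory's theorem such a
pair is determined by at most `d + 1` points on either side (`exists_sepHalfspace`). In the first
case all these points are sample points. In the second, those on one side are sample points and
those on the other have color `i`; each of the latter has color `i` with probability `k⁻¹` only,
which makes up for the factor `n` in the number of choices, since `n / k < 2 * m`
(`sum_event_le`). Hence each union bound costs a factor `m ^ O (d) = 2 ^ O (d * log d)`, and in the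
second case a factor `k` for the choice of the color; the probabilities above outweigh the former
(`sum_bad_le`, `failure_le`).

For the running time, `Big` is a big-step semantics of the programs without random draws that counts
steps, and `Terminates` the corresponding notion of total correctness, with rules for each program
construct. `centerPoint_run` identifies the distribution of the final memory as the image of
independent uniform draws under a function that is characterized by `IsRadonSequence`; all
probabilities then become counts over finite types.
-/

namespace RealRAM

/-! ### Running deterministic programs -/

variable {n d : ℕ} {P : Fin n → Fin d → ℝ}

/-- `Big P p σ t σ'`: the program `p`, started in the memory `σ`, makes no random draw and ends
after exactly `t` steps in the memory `σ'`. -/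
inductive Big (P : Fin n → Fin d → ℝ) : Program → Memory → ℕ → Memory → Prop
  | skip (σ) : Big P .skip σ 1 σ
  | iset (a e v σ) : Big P (.iset a e v) σ 1 (σ.setInt a (e.eval σ) (v.eval σ))
  | rset (a e v σ) : Big P (.rset a e v) σ 1 (σ.setReal a (e.eval σ) (v.eval P σ))
  | seq {p q σ t σ' t' σ''} : Big P p σ t σ' → Big P q σ' t' σ'' →
      Big P (.seq p q) σ (t + t' + 1) σ''
  | iteTrue {b p q σ t σ'} : b.Holds P σ → Big P p σ t σ' → Big P (.ite b p q) σ (t + 1) σ'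
  | iteFalse {b p q σ t σ'} : ¬ b.Holds P σ → Big P q σ t σ' → Big P (.ite b p q) σ (t + 1) σ'
  | loopFalse {b p σ} : ¬ b.Holds P σ → Big P (.loop b p) σ 1 σ
  | loopTrue {b p σ t σ' t' σ''} : b.Holds P σ → Big P p σ t σ' →
      Big P (.loop b p) σ' t' σ'' → Big P (.loop b p) σ (t + t' + 1) σ''

theorem steps_add_one (s : ℕ) (c : Config) :
    steps P (s + 1) c = (step P c).bind (steps P s) := rfl

theorem Big.steps_eq {p : Program} {σ σ' : Memory} {t : ℕ} (h : Big P p σ t σ') :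
    ∀ (K : List Program) (s : ℕ), steps P (t + s) ⟨p :: K, σ⟩ = steps P s ⟨K, σ'⟩ := by
  induction h with
  | skip σ => intro K s; rw [add_comm, steps_add_one]; simp [step]
  | iset a e v σ => intro K s; rw [add_comm, steps_add_one]; simp [step]
  | rset a e v σ => intro K s; rw [add_comm, steps_add_one]; simp [step]
  | @seq p q σ t σ' t' σ'' _ _ ih ih' =>
    intro K s
    rw [show t + t' + 1 + s = (t + (t' + s)) + 1 by ring, steps_add_one]
    simp only [step, PMF.pure_bind]
    rw [ih, ih']
  | @iteTrue b p q σ t σ' hb _ ih =>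
    intro K s
    rw [show t + 1 + s = (t + s) + 1 by ring, steps_add_one]
    simp only [step, PMF.pure_bind, if_pos hb]
    rw [ih]
  | @iteFalse b p q σ t σ' hb _ ih =>
    intro K s
    rw [show t + 1 + s = (t + s) + 1 by ring, steps_add_one]
    simp only [step, PMF.pure_bind, if_neg hb]
    rw [ih]
  | @loopFalse b p σ hb =>
    intro K s
    rw [add_comm, steps_add_one]
    simp only [step, PMF.pure_bind, if_neg hb]
  | @loopTrue b p σ t σ' t' σ'' hb _ _ ih ih' =>
    intro K s
    rw [show t + t' + 1 + s = (t + (t' + s)) + 1 by ring, steps_add_one]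
    simp only [step, PMF.pure_bind, if_pos hb]
    rw [ih, ih']

theorem steps_halted (t : ℕ) (σ : Memory) : steps P t ⟨[], σ⟩ = PMF.pure ⟨[], σ⟩ := by
  induction t with
  | zero => rfl
  | succ t ih => rw [steps_add_one]; simp [step, ih]

/-- Whether the program contains an assignment to the integer array `a`. -/
def Program.writesInt (a : ℕ) : Program → Bool
  | .skip => false
  | .iset b _ _ => a == b
  | .rset _ _ _ => false
  | .rand b _ _ => a == b
  | .seq p q => p.writesInt a || q.writesInt a
  | .ite _ p q => p.writesInt a || q.writesInt a
  | .loop _ p => p.writesInt a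

/-- Whether the program contains an assignment to the real array `a`. -/
def Program.writesReal (a : ℕ) : Program → Bool
  | .skip => false
  | .iset _ _ _ => false
  | .rset b _ _ => a == b
  | .rand _ _ _ => false
  | .seq p q => p.writesReal a || q.writesReal a
  | .ite _ p q => p.writesReal a || q.writesReal a
  | .loop _ p => p.writesReal a

/-- `σ` and `σ'` agree on all arrays to which `p` makes no assignment. -/
structure Frame (p : Program) (σ σ' : Memory) : Prop where
  ints : ∀ a, p.writesInt a = false → σ'.ints a = σ.ints a
  reals : ∀ a, p.writesReal a = false → σ'.reals a = σ.reals a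

theorem Frame.refl (p : Program) (σ : Memory) : Frame p σ σ := ⟨fun _ _ => rfl, fun _ _ => rfl⟩

theorem Frame.trans {p : Program} {σ σ' σ'' : Memory} (h : Frame p σ σ') (h' : Frame p σ' σ'') :
    Frame p σ σ'' :=
  ⟨fun a ha => (h'.ints a ha).trans (h.ints a ha), fun a ha => (h'.reals a ha).trans (h.reals a ha)⟩

theorem Frame.mono {p q : Program} {σ σ' : Memory} (h : Frame p σ σ')
    (hi : ∀ a, q.writesInt a = false → p.writesInt a = false)
    (hr : ∀ a, q.writesReal a = false → p.writesReal a = false) : Frame q σ σ' :=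
  ⟨fun a ha => h.ints a (hi a ha), fun a ha => h.reals a (hr a ha)⟩

@[simp] theorem setInt_ints (σ : Memory) (a i v b j : ℕ) :
    (σ.setInt a i v).ints b j = if b = a ∧ j = i then v else σ.ints b j := by
  unfold Memory.setInt
  by_cases h : b = a
  · subst h; by_cases h' : j = i <;> simp [Function.update, h']
  · simp [Function.update, h]

@[simp] theorem setInt_reals (σ : Memory) (a i v : ℕ) : (σ.setInt a i v).reals = σ.reals := rfl

@[simp] theorem setReal_ints (σ : Memory) (a i : ℕ) (v : ℝ) :
    (σ.setReal a i v).ints = σ.ints := rfl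

@[simp] theorem setReal_reals (σ : Memory) (a i : ℕ) (v : ℝ) (b j : ℕ) :
    (σ.setReal a i v).reals b j = if b = a ∧ j = i then v else σ.reals b j := by
  unfold Memory.setReal
  by_cases h : b = a
  · subst h; by_cases h' : j = i <;> simp [Function.update, h']
  · simp [Function.update, h]

theorem setInt_ints_ne (σ : Memory) {a b : ℕ} (h : b ≠ a) (i v : ℕ) :
    (σ.setInt a i v).ints b = σ.ints b := by
  funext j; simp [h]

theorem setReal_reals_ne (σ : Memory) {a b : ℕ} (h : b ≠ a) (i : ℕ) (v : ℝ) :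
    (σ.setReal a i v).reals b = σ.reals b := by
  funext j; simp [h]

theorem Big.frame {p : Program} {σ σ' : Memory} {t : ℕ} (h : Big P p σ t σ') : Frame p σ σ' := by
  induction h with
  | skip σ => exact Frame.refl _ _
  | iset a e v σ =>
    refine ⟨fun b hb => ?_, fun b _ => rfl⟩
    exact setInt_ints_ne _ (by simpa [Program.writesInt] using hb) _ _
  | rset a e v σ =>
    refine ⟨fun b _ => rfl, fun b hb => ?_⟩
    exact setReal_reals_ne _ (by simpa [Program.writesReal] using hb) _ _
  | seq _ _ ih ih' =>
    exact (ih.mono (by simp +contextual [Program.writesInt])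
      (by simp +contextual [Program.writesReal])).trans
      (ih'.mono (by simp +contextual [Program.writesInt])
      (by simp +contextual [Program.writesReal]))
  | iteTrue _ _ ih =>
    exact ih.mono (by simp +contextual [Program.writesInt])
      (by simp +contextual [Program.writesReal])
  | iteFalse _ _ ih =>
    exact ih.mono (by simp +contextual [Program.writesInt])
      (by simp +contextual [Program.writesReal])
  | loopFalse _ => exact Frame.refl _ _
  | loopTrue _ _ _ ih ih' =>
    exact (ih.mono (by simp [Program.writesInt]) (by simp [Program.writesReal])).trans ih'

/-- Total correctness with a time bound: started in `σ`, the program `p` makes no random draw and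
ends after at most `T` steps in a memory that satisfies `Q`. -/
def Terminates (P : Fin n → Fin d → ℝ) (p : Program) (σ : Memory) (T : ℕ) (Q : Memory → Prop) :
    Prop :=
  ∃ t ≤ T, ∃ σ', Big P p σ t σ' ∧ Q σ'

namespace Terminates

variable {p q : Program} {σ : Memory} {T T' : ℕ} {Q Q' : Memory → Prop}

theorem frame (h : Terminates P p σ T Q) : Terminates P p σ T fun σ' => Q σ' ∧ Frame p σ σ' := by
  obtain ⟨t, ht, σ', hb, hq⟩ := h
  exact ⟨t, ht, σ', hb, hq, hb.frame⟩

theorem mono (h : Terminates P p σ T Q) (hT : T ≤ T') (hQ : ∀ σ', Q σ' → Q' σ') :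
    Terminates P p σ T' Q' := by
  obtain ⟨t, ht, σ', hb, hq⟩ := h
  exact ⟨t, ht.trans hT, σ', hb, hQ _ hq⟩

theorem weaken (h : Terminates P p σ T Q) (hQ : ∀ σ', Q σ' → Frame p σ σ' → Q' σ') :
    Terminates P p σ T Q' :=
  h.frame.mono le_rfl fun _ hs => hQ _ hs.1 hs.2

theorem skip (h : Q σ) : Terminates P .skip σ 1 Q := ⟨1, le_rfl, σ, .skip σ, h⟩

theorem iset {a : ℕ} {e v : IExp} (h : Q (σ.setInt a (e.eval σ) (v.eval σ))) :
    Terminates P (.iset a e v) σ 1 Q := ⟨1, le_rfl, _, .iset a e v σ, h⟩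

theorem iset_self (a : ℕ) (e v : IExp) :
    Terminates P (.iset a e v) σ 1 fun σ' => σ' = σ.setInt a (e.eval σ) (v.eval σ) := iset rfl

theorem rset {a : ℕ} {e : IExp} {v : RExp} (h : Q (σ.setReal a (e.eval σ) (v.eval P σ))) :
    Terminates P (.rset a e v) σ 1 Q := ⟨1, le_rfl, _, .rset a e v σ, h⟩

theorem seq (h : Terminates P p σ T fun σ' => Terminates P q σ' T' Q) :
    Terminates P (.seq p q) σ (T + T' + 1) Q := by
  obtain ⟨t, ht, σ', hb, t', ht', σ'', hb', hq⟩ := h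
  exact ⟨t + t' + 1, by omega, σ'', .seq hb hb', hq⟩

theorem ite {b : BExp} (h : b.Holds P σ → Terminates P p σ T Q)
    (h' : ¬ b.Holds P σ → Terminates P q σ T Q) : Terminates P (.ite b p q) σ (T + 1) Q := by
  by_cases hb : b.Holds P σ
  · obtain ⟨t, ht, σ', h1, hq⟩ := h hb
    exact ⟨t + 1, by omega, σ', .iteTrue hb h1, hq⟩
  · obtain ⟨t, ht, σ', h1, hq⟩ := h' hb
    exact ⟨t + 1, by omega, σ', .iteFalse hb h1, hq⟩

/-- A loop whose invariant carries the number of iterations that remain. -/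
theorem loop {b : BExp} {Inv : ℕ → Memory → Prop} (hfin : ∀ σ, Inv 0 σ → ¬ b.Holds P σ)
    (hstep : ∀ k σ, Inv (k + 1) σ → b.Holds P σ ∧ Terminates P p σ T (Inv k)) :
    ∀ (r : ℕ) (σ : Memory), Inv r σ →
      Terminates P (.loop b p) σ (1 + r * (T + 1)) (Inv 0) := by
  intro r
  induction r with
  | zero => exact fun σ h => ⟨1, by omega, σ, .loopFalse (hfin σ h), h⟩
  | succ r ih =>
    intro σ h
    obtain ⟨hb, t, ht, σ', hbig, hq⟩ := hstep r σ h
    obtain ⟨t', ht', σ'', hbig', hq'⟩ := ih σ' hq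
    refine ⟨t + t' + 1, ?_, σ'', .loopTrue hb hbig hbig', hq'⟩
    have : (r + 1) * (T + 1) = r * (T + 1) + (T + 1) := by ring
    omega

end Terminates

/-- The integer variable kept in entry `0` of the integer array `a`. -/
abbrev ivar (a : ℕ) : IExp := .arr a (.lit 0)

/-- The real variable kept in entry `0` of the real array `a`. -/
abbrev rvar (a : ℕ) : RExp := .arr a (.lit 0)

/-- `for i = lo, …, hi - 1 do body`, with the counter `i` in entry `0` of the array `i`. -/
def Program.forLoop (i : ℕ) (lo hi : IExp) (body : Program) : Program :=
  .seq (.iset i (.lit 0) lo)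
    (.loop (.not (.ile hi (ivar i)))
      (.seq body (.iset i (.lit 0) (.add (ivar i) (.lit 1)))))

/-- Rule for `forLoop`. The invariant need not mention the counter, nor the arrays that the loop
leaves alone: both are provided to the proof that the body preserves it. -/
theorem Terminates.forLoop {i : ℕ} {lo hi : IExp} {body : Program} {σ₀ : Memory} {T a b : ℕ}
    (Inv : ℕ → Memory → Prop) (hlo : lo.eval σ₀ = a) (hab : a ≤ b)
    (hhi : ∀ σ, Frame (Program.forLoop i lo hi body) σ₀ σ → hi.eval σ = b)
    (hbody : body.writesInt i = false)
    (hinit : Inv a (σ₀.setInt i 0 a))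
    (hstep : ∀ k σ, a ≤ k → k < b → Frame (Program.forLoop i lo hi body) σ₀ σ → σ.ints i 0 = k →
      Inv k σ → Terminates P body σ T fun σ' => Inv (k + 1) (σ'.setInt i 0 (k + 1))) :
    Terminates P (Program.forLoop i lo hi body) σ₀ (3 + (b - a) * (T + 3)) (Inv b) := by
  have hF : ∀ σ σ', Frame (.seq body (.iset i (.lit 0) (.add (ivar i) (.lit 1)))) σ σ' →
      Frame (Program.forLoop i lo hi body) σ σ' := fun σ σ' h =>
    h.mono (by simp +contextual [Program.writesInt, Program.forLoop])
      (by simp +contextual [Program.writesReal, Program.forLoop])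
  have key := Terminates.loop (P := P) (b := .not (.ile hi (ivar i)))
    (p := .seq body (.iset i (.lit 0) (.add (ivar i) (.lit 1)))) (T := T + 2)
    (Inv := fun r σ => r ≤ b - a ∧ σ.ints i 0 = b - r ∧
      Frame (Program.forLoop i lo hi body) σ₀ σ ∧ Inv (b - r) σ) ?_ ?_ (b - a)
    (σ₀.setInt i 0 a) ?_
  · have := Terminates.seq (P := P) (p := .iset i (.lit 0) lo) (σ := σ₀) (T := 1)
      (Terminates.iset (by simpa [IExp.eval, hlo] using key))
    refine this.mono (by ring_nf; omega) ?_
    exact fun σ h => h.2.2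
  · rintro σ ⟨-, h1, h2, -⟩
    simp [BExp.Holds, IExp.eval, h1, hhi σ h2]
  · rintro k σ ⟨hk, h1, h2, h3⟩
    refine ⟨by simp only [BExp.Holds, IExp.eval, h1, hhi σ h2]; omega, ?_⟩
    have h4 := hstep (b - (k + 1)) σ (by omega) (by omega) h2 h1 h3
    have h5 : Terminates P (.seq body (.iset i (.lit 0) (.add (ivar i) (.lit 1)))) σ (T + 1 + 1)
        (fun σ' => Inv (b - k) σ' ∧ σ'.ints i 0 = b - k) := by
      refine Terminates.seq (h4.weaken fun σ' hσ' hf => Terminates.iset ?_)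
      have : σ'.ints i 0 = b - (k + 1) := by rw [hf.ints i hbody, h1]
      simp only [IExp.eval, this, setInt_ints, and_self, if_true]
      rw [show b - (k + 1) + 1 = b - k by omega] at hσ' ⊢
      exact ⟨hσ', rfl⟩
    refine h5.weaken fun σ' hσ' hf => ⟨by omega, hσ'.2, h2.trans (hF _ _ hf), hσ'.1⟩
  · refine ⟨le_rfl, ?_, ⟨fun c hc => setInt_ints_ne _ ?_ _ _, fun _ _ => rfl⟩, ?_⟩
    · simp; omega
    · rintro rfl; simp [Program.writesInt, Program.forLoop] at hc
    · rw [show b - (b - a) = a by omega]; exact hinit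

/-! ### Random draws -/

/-- Draw the entries `0, …, hi - 1` of the integer array `a` from `{0, …, m}`. -/
def Program.drawLoop (a i : ℕ) (hi m : IExp) : Program :=
  .loop (.not (.ile hi (ivar i)))
    (.seq (.rand a (ivar i) m) (.iset i (.lit 0) (.add (ivar i) (.lit 1))))

/-- Store `f 0, …, f (r - 1)` in the entries of the integer array `a` from `k` on, and leave the
counter `i` just behind them. -/
def Memory.fill (a i : ℕ) : (r : ℕ) → (k : ℕ) → (Fin r → ℕ) → Memory → Memory
  | 0, _, _, σ => σ
  | r + 1, k, f, σ =>
    Memory.fill a i r (k + 1) (Fin.tail f) ((σ.setInt a k (f 0)).setInt i 0 (k + 1))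

theorem fill_ints_ne {a i b : ℕ} (hb : b ≠ a) (hb' : b ≠ i) (r k : ℕ) (f : Fin r → ℕ)
    (σ : Memory) : (σ.fill a i r k f).ints b = σ.ints b := by
  induction r generalizing k σ with
  | zero => rfl
  | succ r ih => simp only [Memory.fill, ih]; rw [setInt_ints_ne _ hb', setInt_ints_ne _ hb]

theorem fill_ints_lt {a i : ℕ} (h : a ≠ i) (r k : ℕ) (f : Fin r → ℕ) (σ : Memory) (j : ℕ)
    (hj : j < k) : (σ.fill a i r k f).ints a j = σ.ints a j := by
  induction r generalizing k σ with
  | zero => rfl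
  | succ r ih =>
    simp only [Memory.fill]
    rw [ih _ _ _ (by omega)]
    simp [h, hj.ne]

theorem fill_ints {a i : ℕ} (h : a ≠ i) (r k : ℕ) (f : Fin r → ℕ) (σ : Memory) (j : Fin r) :
    (σ.fill a i r k f).ints a (k + j) = f j := by
  induction r generalizing k σ with
  | zero => exact j.elim0
  | succ r ih =>
    simp only [Memory.fill]
    refine Fin.cases ?_ (fun j => ?_) j
    · simp only [Fin.val_zero, add_zero]
      rw [fill_ints_lt h _ _ _ _ _ (Nat.lt_succ_self k)]
      simp [h]
    · have := ih (k + 1) (Fin.tail f) ((σ.setInt a k (f 0)).setInt i 0 (k + 1)) j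
      rw [Fin.val_succ, show k + (↑j + 1) = k + 1 + ↑j by ring, this]
      rfl

theorem uniformOfFintype_bind_map {α β γ : Type*} [Fintype α] [Nonempty α] [Fintype β]
    [Nonempty β] (g : α → β → γ) :
    ((PMF.uniformOfFintype α).bind fun a => (PMF.uniformOfFintype β).map (g a)) =
      (PMF.uniformOfFintype (α × β)).map fun x => g x.1 x.2 := by
  have : PMF.uniformOfFintype (α × β) =
      (PMF.uniformOfFintype α).bind fun a => (PMF.uniformOfFintype β).map (Prod.mk a) := by
    classical
    ext ⟨a, b⟩
    simp only [PMF.uniformOfFintype_apply, PMF.bind_apply, PMF.map_apply, tsum_fintype,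
      Prod.mk.injEq, Fintype.card_prod, Nat.cast_mul]
    rw [Finset.sum_eq_single a, Finset.sum_eq_single b]
    · simp only [and_self, if_true]
      rw [ENNReal.mul_inv] <;> simp
    · intro c _ hc; simp [hc.symm]
    · simp
    · intro c _ hc; simp [hc.symm]
    · simp
  rw [this, PMF.map_bind]
  simp [PMF.map_comp, Function.comp_def]

theorem uniformOfFintype_map_equiv {α β : Type*} [Fintype α] [Nonempty α] [Fintype β]
    [Nonempty β] (e : α ≃ β) : (PMF.uniformOfFintype α).map e = PMF.uniformOfFintype β := by
  classical
  ext b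
  simp only [PMF.uniformOfFintype_apply, PMF.map_apply, tsum_fintype]
  rw [Finset.sum_eq_single (e.symm b)]
  · simp [Fintype.card_congr e]
  · intro c _ hc; rw [if_neg]; rintro rfl; simp at hc
  · simp

theorem steps_rand {a : ℕ} {e m : IExp} {σ : Memory} {v : ℕ} (hv : m.eval σ = v)
    (K : List Program) (s : ℕ) :
    steps P (s + 1) ⟨.rand a e m :: K, σ⟩ = (PMF.uniformOfFintype (Fin (v + 1))).bind
      fun x => steps P s ⟨K, σ.setInt a (e.eval σ) x⟩ := by
  subst hv
  rw [steps_add_one]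
  simp only [step]
  rw [PMF.bind_map]
  rfl

/-- The entries stored by a drawing loop are jointly uniform. -/
theorem steps_drawLoop {a i : ℕ} {hi m : IExp} {M v : ℕ} (K : List Program) (s r : ℕ)
    (σ : Memory) (G : Memory → Prop) (hG : ∀ σ, G σ → hi.eval σ = M ∧ m.eval σ = v)
    (hset : ∀ σ j x, G σ → G (σ.setInt a j x)) (hset' : ∀ σ j x, G σ → G (σ.setInt i j x))
    (hai : a ≠ i) (hσ : G σ) (hr : r ≤ M) (hk : σ.ints i 0 = M - r) :
    steps P (4 * r + 1 + s) ⟨.drawLoop a i hi m :: K, σ⟩ =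
      (PMF.uniformOfFintype (Fin r → Fin (v + 1))).bind
        fun f => steps P s ⟨K, σ.fill a i r (M - r) (fun j => f j)⟩ := by
  induction r generalizing σ with
  | zero =>
    rw [show 4 * 0 + 1 + s = s + 1 by ring, steps_add_one]
    have : ¬ (BExp.not (.ile hi (ivar i))).Holds P σ := by
      simp [BExp.Holds, IExp.eval, hk, (hG σ hσ).1]
    simp only [Program.drawLoop, step, if_neg this, PMF.pure_bind, Memory.fill]
    exact (PMF.bind_const _ _).symm
  | succ r ih =>
    have hb : (BExp.not (.ile hi (ivar i))).Holds P σ := by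
      simp only [BExp.Holds, IExp.eval, hk, (hG σ hσ).1]; omega
    rw [show 4 * (r + 1) + 1 + s = (((4 * r + 1 + s) + 1) + 1 + 1) + 1 by ring, steps_add_one]
    simp only [Program.drawLoop, step, if_pos hb, PMF.pure_bind]
    rw [steps_add_one]
    simp only [step, PMF.pure_bind]
    rw [steps_rand (hG σ hσ).2]
    have h1 : ∀ x : Fin (v + 1), steps P (4 * r + 1 + s + 1)
        ⟨.iset i (.lit 0) (.add (ivar i) (.lit 1)) :: .drawLoop a i hi m :: K,
          σ.setInt a ((ivar i).eval σ) x⟩ =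
        (PMF.uniformOfFintype (Fin r → Fin (v + 1))).bind fun f => steps P s
          ⟨K, σ.fill a i (r + 1) (M - (r + 1))
            (fun j => (Fin.cons x f : Fin (r + 1) → Fin (v + 1)) j)⟩ := by
      intro x
      rw [steps_add_one]
      simp only [step, PMF.pure_bind, IExp.eval, setInt_ints, hk, hai.symm, false_and, if_false]
      rw [ih _ (hset' _ _ _ (hset _ _ _ hσ)) (by omega) (by simp; omega)]
      simp only [Memory.fill, Fin.cons_zero]
      rw [show M - (r + 1) + 1 = M - r by omega]
      rfl
    simp only [Program.drawLoop] at h1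
    simp only [h1]
    have h2 := congrArg (fun q => PMF.bind q fun f : Fin (r + 1) → Fin (v + 1) =>
        steps P s ⟨K, σ.fill a i (r + 1) (M - (r + 1)) (fun j => f j)⟩)
      (uniformOfFintype_bind_map fun (x : Fin (v + 1)) (f : Fin r → Fin (v + 1)) =>
        (Fin.cons x f : Fin (r + 1) → Fin (v + 1)))
    have h3 := uniformOfFintype_map_equiv (Fin.consEquiv fun _ : Fin (r + 1) => Fin (v + 1))
    simp only [PMF.bind_bind, PMF.bind_map, Function.comp_def] at h2
    rw [h2]
    rw [← h3, PMF.bind_map]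
    rfl

end RealRAM

open Finset

/-! ### Kernel vectors by elimination -/

/-- The rows `u l`, `l ∈ S`, restricted to their first `e` entries, are linearly independent. -/
def IndepRows (e : ℕ) (S : Finset ℕ) (u : ℕ → ℕ → ℝ) : Prop :=
  ∀ a : ℕ → ℝ, (∀ s < e, ∑ l ∈ S, a l * u l s = 0) → ∀ l ∈ S, a l = 0

/-- The state of the elimination after the first `r` equations `∑ s, x s r' * λ s = 0`, `r' < r`,
and, for equation number `r` with pivot row `r`, after the rows before `l`: the rows
`r, …, e - 1` of `u` are independent, they solve the first `r` equations, and those of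
`r + 1, …, l - 1` solve equation `r` as well. -/
structure ElimInv (e : ℕ) (x : ℕ → ℕ → ℝ) (r l : ℕ) (u : ℕ → ℕ → ℝ) : Prop where
  solved : ∀ r' < r, ∀ l' ∈ Ico r e, ∑ s ∈ range e, x s r' * u l' s = 0
  current : ∀ l' ∈ Ico (r + 1) l, ∑ s ∈ range e, x s r * u l' s = 0
  indep : IndepRows e (Ico r e) u

theorem ElimInv.congr {e : ℕ} {x u u' : ℕ → ℕ → ℝ} {r l : ℕ} (h : ElimInv e x r l u) (hl : l ≤ e)
    (hu : ∀ l' < e, ∀ s < e, u' l' s = u l' s) : ElimInv e x r l u' where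
  solved r' hr' l' hl' := by
    rw [← h.solved r' hr' l' hl']
    exact sum_congr rfl fun s hs => by rw [hu l' (mem_Ico.1 hl').2 s (mem_range.1 hs)]
  current l' hl' := by
    rw [← h.current l' hl']
    exact sum_congr rfl fun s hs => by
      rw [hu l' ((mem_Ico.1 hl').2.trans_le hl) s (mem_range.1 hs)]
  indep a ha := by
    refine h.indep a fun s hs => ?_
    rw [← ha s hs]
    exact sum_congr rfl fun l' hl' => by rw [hu l' (mem_Ico.1 hl').2 s hs]

theorem ElimInv.next {e : ℕ} {x u : ℕ → ℕ → ℝ} {r : ℕ} (h : ElimInv e x r e u) :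
    ElimInv e x (r + 1) (r + 2) u where
  solved r' hr' l' hl' := by
    rcases Nat.lt_succ_iff_lt_or_eq.1 hr' with h1 | rfl
    · exact h.solved r' h1 l' (by simp only [mem_Ico] at hl' ⊢; omega)
    · exact h.current l' hl'
  current l' hl' := by simp at hl'
  indep a ha l hl := by
    have hr : r < e := by simp at hl; omega
    have := h.indep (fun l => if l = r then 0 else a l) ?_ l (by simp at hl ⊢; omega)
    · simpa [show l ≠ r by simp at hl; omega] using this
    · intro s hs
      rw [← Finset.insert_Ico_add_one_left_eq_Ico hr, sum_insert (by simp)]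
      simp only [if_true, zero_mul, zero_add]
      rw [← ha s hs]
      exact sum_congr rfl fun l' hl' => by rw [if_neg (by simp at hl'; omega)]

/-- If the pivot row solves the current equation already, it is exchanged with row `l`. -/
theorem ElimInv.swap {e : ℕ} {x u : ℕ → ℕ → ℝ} {r l : ℕ} (h : ElimInv e x r l u) (hrl : r < l)
    (hl : l < e) (h0 : ∑ s ∈ range e, x s r * u r s = 0) :
    ElimInv e x r (l + 1) fun l' => u (Equiv.swap r l l') := by
  have hmem : ∀ l', Equiv.swap r l l' ∈ Ico r e ↔ l' ∈ Ico r e := by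
    intro l'
    rcases eq_or_ne l' r with rfl | h1
    · simp; omega
    rcases eq_or_ne l' l with rfl | h2
    · simp; omega
    rw [Equiv.swap_apply_of_ne_of_ne h1 h2]
  refine ⟨fun r' hr' l' hl' => h.solved r' hr' _ ((hmem l').2 hl'), fun l' hl' => ?_,
    fun a ha => ?_⟩
  · rcases eq_or_ne l' l with rfl | h2
    · simpa using h0
    · simp only [mem_Ico] at hl'
      rw [Equiv.swap_apply_of_ne_of_ne (by omega) h2]
      exact h.current l' (by simp; omega)
  · have := h.indep (fun l' => a (Equiv.swap r l l')) ?_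
    · intro l' hl'
      simpa using this (Equiv.swap r l l') ((hmem l').2 hl')
    · intro s hs
      rw [← ha s hs]
      refine sum_equiv (Equiv.swap r l) (fun l' => (hmem l').symm) fun l' _ => ?_
      simp

/-- Otherwise a multiple of the pivot row is subtracted from row `l`. -/
theorem ElimInv.sub {e : ℕ} {x u : ℕ → ℕ → ℝ} {r l : ℕ} (h : ElimInv e x r l u) (hrl : r < l)
    (hl : l < e) (h0 : ∑ s ∈ range e, x s r * u r s ≠ 0) {κ : ℝ}
    (hκ : κ = (∑ s ∈ range e, x s r * u l s) / ∑ s ∈ range e, x s r * u r s) :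
    ElimInv e x r (l + 1) fun l' s => if l' = l then u l s - κ * u r s else u l' s := by
  have hsum : ∀ r', ∑ s ∈ range e, x s r' * (u l s - κ * u r s) =
      ∑ s ∈ range e, x s r' * u l s - κ * ∑ s ∈ range e, x s r' * u r s := by
    intro r'
    rw [mul_sum, ← sum_sub_distrib]
    exact sum_congr rfl fun s _ => by ring
  refine ⟨fun r' hr' l' hl' => ?_, fun l' hl' => ?_, fun a ha => ?_⟩
  · split_ifs with h1
    · rw [hsum, h.solved r' hr' l (by simp; omega), h.solved r' hr' r (by simp; omega)]; simp
    · exact h.solved r' hr' l' hl'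
  · split_ifs with h1
    · rw [hsum, hκ, div_mul_cancel₀ _ h0, sub_self]
    · exact h.current l' (by simp only [mem_Ico] at hl' ⊢; omega)
  · have key := h.indep (fun l' => if l' = r then a r - κ * a l else a l') ?_
    · have hal : a l = 0 := by
        have := key l (by simp; omega)
        simpa [show l ≠ r by omega] using this
      intro l' hl'
      have := key l' hl'
      by_cases h1 : l' = r
      · subst h1; simpa [hal] using this
      · simpa [h1] using this
    · intro s hs
      rw [← ha s hs]
      have hr : r ∈ Ico r e := by simp; omega
      have hl' : l ∈ (Ico r e).erase r := by simp; omega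
      rw [← add_sum_erase _ _ hr, ← add_sum_erase _ _ hr, ← add_sum_erase _ _ hl',
        ← add_sum_erase _ _ hl']
      simp only [if_true, show l ≠ r by omega, show r ≠ l by omega, if_false]
      have : ∑ l' ∈ ((Ico r e).erase r).erase l, (if l' = r then a r - κ * a l else a l') * u l' s =
          ∑ l' ∈ ((Ico r e).erase r).erase l,
            a l' * (if l' = l then u l s - κ * u r s else u l' s) :=
        sum_congr rfl fun l' hl' => by
          simp only [mem_erase] at hl'
          rw [if_neg hl'.2.1, if_neg hl'.1]
      rw [this]; ring

theorem ElimInv.init (e : ℕ) (x : ℕ → ℕ → ℝ) :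
    ElimInv e x 0 1 fun l s => if s = l then 1 else 0 := by
  refine ⟨by simp, by simp, fun a ha l hl => ?_⟩
  have := ha l (by simpa using hl)
  simpa [show l < e by simpa using hl] using this

theorem ElimInv.exists_ne_zero {e : ℕ} {x u : ℕ → ℕ → ℝ} {l : ℕ}
    (h : ElimInv (e + 1) x e l u) : ∃ s < e + 1, u e s ≠ 0 := by
  by_contra! hc
  have := h.indep (fun _ => 1) (by simpa using hc) e (by simp)
  exact one_ne_zero this

/-- `y` is the Radon point of the vectors `x 0, …, x (e - 1)` with `e - 1` homogeneous coordinates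
that belongs to some nontrivial linear relation between them. -/
def IsRadonPoint (e : ℕ) (x : ℕ → ℕ → ℝ) (y : ℕ → ℝ) : Prop :=
  ∃ a : ℕ → ℝ, (∃ s < e, a s ≠ 0) ∧ (∀ c < e - 1, ∑ s ∈ range e, a s * x s c = 0) ∧
    ∀ c < e - 1, y c = (∑ s ∈ range e, max (a s) 0 * x s c) /
      ∑ s ∈ range e, max (a s) 0 * x s (e - 2)

theorem IsRadonPoint.congr {e : ℕ} {x x' : ℕ → ℕ → ℝ} {y y' : ℕ → ℝ} (h : IsRadonPoint e x y)
    (he : 2 ≤ e) (hx : ∀ s < e, ∀ c < e - 1, x' s c = x s c) (hy : ∀ c < e - 1, y' c = y c) :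
    IsRadonPoint e x' y' := by
  obtain ⟨a, h1, h2, h3⟩ := h
  have key : ∀ w : ℕ → ℝ, ∀ c < e - 1,
      ∑ s ∈ range e, w s * x' s c = ∑ s ∈ range e, w s * x s c := fun w c hc =>
    sum_congr rfl fun s hs => by rw [hx s (mem_range.1 hs) c hc]
  refine ⟨a, h1, fun c hc => by rw [key _ c hc, h2 c hc], fun c hc => ?_⟩
  rw [hy c hc, h3 c hc, key _ c hc, key _ (e - 2) (by omega)]

/-- A Radon point stays in a convex set that at most one of the points misses: one of the two sides
of the relation avoids that point. Here points of `ℝ^d` carry a last coordinate `1`. -/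
theorem IsRadonPoint.mem {d : ℕ} {x : ℕ → ℕ → ℝ} {y : ℕ → ℝ} (h : IsRadonPoint (d + 2) x y)
    (hx : ∀ s < d + 2, x s d = 1) {G : Set (Fin d → ℝ)} (hG : Convex ℝ G)
    (hbad : ∀ s < d + 2, ∀ s' < d + 2, (fun j : Fin d => x s j) ∉ G →
      (fun j : Fin d => x s' j) ∉ G → s = s') :
    (fun j : Fin d => y j) ∈ G ∧ y d = 1 := by
  obtain ⟨a, ⟨s₀, hs₀, ha₀⟩, hrel, hy⟩ := h
  simp only [Nat.add_sub_cancel, show d + 2 - 1 = d + 1 from rfl] at hrel hy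
  have hone : ∀ w : ℕ → ℝ, ∑ s ∈ range (d + 2), w s * x s d = ∑ s ∈ range (d + 2), w s :=
    fun w => sum_congr rfl fun s hs => by rw [hx s (mem_range.1 hs), mul_one]
  have hpm : ∀ t : ℝ, max t 0 = t + max (-t) 0 := fun t => by
    rcases le_total t 0 with h | h
    · rw [max_eq_right h, max_eq_left (by linarith)]; ring
    · rw [max_eq_left h, max_eq_right (by linarith)]; ring
  have hside : ∀ c < d + 1, ∑ s ∈ range (d + 2), max (a s) 0 * x s c =
      ∑ s ∈ range (d + 2), max (-a s) 0 * x s c := fun c hc => by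
    simp only [hpm (a _), add_mul, sum_add_distrib, hrel c hc, zero_add]
  set W := ∑ s ∈ range (d + 2), max (a s) 0 with hW
  have hW' : W = ∑ s ∈ range (d + 2), max (-a s) 0 := by
    have := hside d (by omega)
    rwa [hone, hone] at this
  have hWpos : 0 < W := by
    rcases lt_or_gt_of_ne ha₀ with h | h
    · rw [hW']
      exact sum_pos' (fun _ _ => le_max_right _ _)
        ⟨s₀, mem_range.2 hs₀, lt_max_of_lt_left (by linarith)⟩
    · exact sum_pos' (fun _ _ => le_max_right _ _) ⟨s₀, mem_range.2 hs₀, lt_max_of_lt_left h⟩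
  -- either side of the relation writes `y` as a convex combination
  have hconv : ∀ w : ℕ → ℝ, (∀ s, 0 ≤ w s) → ∑ s ∈ range (d + 2), w s = W →
      (∀ c < d + 1, ∑ s ∈ range (d + 2), max (a s) 0 * x s c = ∑ s ∈ range (d + 2), w s * x s c) →
      (∀ s < d + 2, w s ≠ 0 → (fun j : Fin d => x s j) ∈ G) → (fun j : Fin d => y j) ∈ G := by
    intro w hw hwW hwx hwG
    have hmem := hG.sum_mem (t := (range (d + 2)).filter fun s => w s ≠ 0) (w := fun s => w s / W)
      (z := fun s (j : Fin d) => x s j) (fun s _ => div_nonneg (hw s) hWpos.le) ?_ ?_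
    · convert hmem using 1
      funext j
      rw [hy j (by omega), hone, ← hW, hwx j (by omega), Finset.sum_apply, sum_filter_of_ne]
      · rw [sum_div]
        exact sum_congr rfl fun s _ => by simp; ring
      · intro s _ hs h0
        simp [h0] at hs
    · rw [sum_filter_of_ne, ← sum_div, hwW, div_self hWpos.ne']
      intro s _ hs h0
      simp [h0] at hs
    · intro s hs
      simp only [mem_filter, mem_range] at hs
      exact hwG s hs.1 hs.2
  refine ⟨?_, by rw [hy d (by omega), hone, ← hW, div_self hWpos.ne']⟩
  by_cases hb : ∃ s < d + 2, 0 < a s ∧ (fun j : Fin d => x s j) ∉ G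
  · obtain ⟨s, hs, has, hsG⟩ := hb
    refine hconv _ (fun _ => le_max_right _ _) hW'.symm hside fun s' hs' hw => ?_
    by_contra hc
    obtain rfl := hbad s hs s' hs' hsG hc
    exact hw (max_eq_right (by linarith))
  · push Not at hb
    refine hconv _ (fun _ => le_max_right _ _) rfl (fun _ _ => rfl) fun s' hs' hw => ?_
    refine hb s' hs' ?_
    by_contra hc
    exact hw (max_eq_right (not_lt.1 hc))

namespace RealRAM

variable {n d : ℕ} {P : Fin n → Fin d → ℝ}

/-! ### The program for a Radon point -/

-- The names of the arrays.
namespace Reg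
/-- Number of vectors in a Radon partition; also the stride of all two-dimensional arrays. -/
@[simp] abbrev e : ℕ := 7
/-- Table of the multiples of `e`. -/
@[simp] abbrev off : ℕ := 11
/-- Counters. -/
@[simp] abbrev cl : ℕ := 20
@[simp] abbrev cs : ℕ := 21
@[simp] abbrev cr : ℕ := 22
@[simp] abbrev cc : ℕ := 23
/-- The vectors whose Radon point is wanted. -/
@[simp] abbrev X : ℕ := 2
/-- Rows of the elimination. -/
@[simp] abbrev U : ℕ := 3
/-- The Radon point before its normalization. -/
@[simp] abbrev Y : ℕ := 4
/-- Scalars. -/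
@[simp] abbrev pr : ℕ := 5
@[simp] abbrev pl : ℕ := 6
@[simp] abbrev tmp : ℕ := 7
end Reg

/-- Position of the entry `(r, s)` of a two-dimensional array. -/
abbrev pos (r s : IExp) : IExp := .add (.arr Reg.off r) s

/-- The entry `(r, s)` of the two-dimensional real array `a`. -/
abbrev ent (a : ℕ) (r s : IExp) : RExp := .arr a (pos r s)

/-- The two-dimensional array stored with stride `e` in the real array `a`. -/
def Memory.mat (σ : Memory) (a e : ℕ) (r s : ℕ) : ℝ := σ.reals a (r * e + s)

/-- The stride is `e`, and the table of multiples is correct at least up to `g`. -/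
def Strided (e g : ℕ) (σ : Memory) : Prop :=
  σ.ints Reg.e 0 = e ∧ ∀ x < g, σ.ints Reg.off x = x * e

theorem Strided.of_frame {e g : ℕ} {p : Program} {σ σ' : Memory} (h : Strided e g σ)
    (hf : Frame p σ σ') (h1 : p.writesInt Reg.e = false) (h2 : p.writesInt Reg.off = false) :
    Strided e g σ' := by
  unfold Strided
  rw [hf.ints _ h1, hf.ints _ h2]
  exact h

theorem mul_add_eq_iff {e l s l' s' : ℕ} (hs : s < e) (hs' : s' < e) :
    l' * e + s' = l * e + s ↔ l' = l ∧ s' = s := by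
  constructor
  · intro h
    have h1 : l' = l := by
      have := congrArg (· / e) h
      simpa [Nat.add_div_of_dvd_right, Nat.mul_div_cancel _ (show 0 < e by omega),
        Nat.div_eq_of_lt hs, Nat.div_eq_of_lt hs'] using this
    subst h1
    exact ⟨rfl, by omega⟩
  · rintro ⟨rfl, rfl⟩; rfl

theorem mat_setReal {σ : Memory} {a e l s l' s' : ℕ} {v : ℝ} (hs : s < e) (hs' : s' < e) :
    (σ.setReal a (l * e + s) v).mat a e l' s' = if l' = l ∧ s' = s then v else σ.mat a e l' s' := by
  simp only [Memory.mat, setReal_reals, true_and, mul_add_eq_iff hs hs']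

theorem mat_setInt (σ : Memory) (b i v a e : ℕ) : (σ.setInt b i v).mat a e = σ.mat a e := rfl

theorem mat_setReal_ne (σ : Memory) {b a : ℕ} (h : a ≠ b) (i : ℕ) (v : ℝ) (e : ℕ) :
    (σ.setReal b i v).mat a e = σ.mat a e := by
  funext l s; simp [Memory.mat, h]

theorem mat_of_frame {p : Program} {σ σ' : Memory} (hf : Frame p σ σ') {a : ℕ}
    (h : p.writesReal a = false) (e : ℕ) : σ'.mat a e = σ.mat a e := by
  funext l s; simp [Memory.mat, hf.reals _ h]

/-- `acc := ∑ i < hi, f i`. -/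
def Program.sumLoop (i acc : ℕ) (hi : IExp) (f : RExp) : Program :=
  .seq (.rset acc (.lit 0) (.ofInt (.lit 0)))
    (.forLoop i (.lit 0) hi (.rset acc (.lit 0) (.add (rvar acc) f)))

theorem Terminates.sumLoop {i acc : ℕ} {hi : IExp} {f : RExp} {σ₀ : Memory} {b : ℕ} {F : ℕ → ℝ}
    (hhi : ∀ σ, Frame (Program.sumLoop i acc hi f) σ₀ σ → hi.eval σ = b)
    (hf : ∀ σ s, s < b → Frame (Program.sumLoop i acc hi f) σ₀ σ → σ.ints i 0 = s →
      f.eval P σ = F s) :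
    Terminates P (Program.sumLoop i acc hi f) σ₀ (5 + 4 * b)
      fun σ' => σ'.reals acc 0 = ∑ s ∈ range b, F s := by
  have hF : ∀ σ, Frame (.forLoop i (.lit 0) hi (.rset acc (.lit 0) (.add (rvar acc) f)))
      (σ₀.setReal acc 0 0) σ → Frame (Program.sumLoop i acc hi f) σ₀ σ := by
    intro σ h
    refine Frame.trans (σ' := σ₀.setReal acc 0 0) ⟨fun a _ => rfl, fun a ha => ?_⟩
      (h.mono (fun a ha => by simpa [Program.writesInt, Program.sumLoop] using ha)
        (fun a ha => by simp [Program.writesReal, Program.sumLoop] at ha ⊢; exact ha.2))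
    simp only [Program.writesReal, Program.sumLoop, Bool.or_eq_false_iff, beq_eq_false_iff_ne] at ha
    exact setReal_reals_ne _ ha.1 _ _
  refine (Terminates.seq (T := 1) (Terminates.rset ?_)).mono
    (show 1 + (3 + (b - 0) * (1 + 3)) + 1 ≤ _ by omega) fun _ h => h
  simp only [IExp.eval, RExp.eval, Nat.cast_zero]
  refine Terminates.forLoop (a := 0) (b := b)
    (fun k σ => σ.reals acc 0 = ∑ s ∈ range k, F s) rfl (Nat.zero_le _)
    (fun σ h => hhi σ (hF σ h)) rfl (by simp) ?_
  intro k σ _ hk hfr hik hI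
  refine Terminates.rset ?_
  simp only [setInt_reals, setReal_reals, RExp.eval, IExp.eval, and_self, if_true]
  rw [hI, hf σ k hk (hF σ hfr) hik, sum_range_succ]

/-- `U` becomes the identity matrix. -/
def Program.identity : Program :=
  .forLoop Reg.cl (.lit 0) (ivar Reg.e)
    (.seq
      (.forLoop Reg.cs (.lit 0) (ivar Reg.e)
        (.rset Reg.U (pos (ivar Reg.cl) (ivar Reg.cs)) (.ofInt (.lit 0))))
      (.rset Reg.U (pos (ivar Reg.cl) (ivar Reg.cl)) (.ofInt (.lit 1))))

theorem Terminates.identity {e : ℕ} {σ₀ : Memory} (h : Strided e e σ₀) :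
    Terminates P Program.identity σ₀ (3 + e * (4 * e + 8))
      fun σ => ∀ l < e, ∀ s < e, σ.mat Reg.U e l s = if s = l then 1 else 0 := by
  refine (Terminates.forLoop (a := 0) (b := e) (T := 3 + (e - 0) * (1 + 3) + 1 + 1)
    (fun k σ => ∀ l < k, ∀ s < e, σ.mat Reg.U e l s = if s = l then 1 else 0) rfl
    (Nat.zero_le _) (fun σ hf => ?_) rfl (by simp) ?_).mono
    (le_of_eq (by rw [Nat.sub_zero]; ring)) fun _ h => h
  · simp only [IExp.eval]; exact (h.of_frame hf rfl rfl).1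
  intro k σ _ hk hf hik hI
  have hS := h.of_frame hf rfl rfl
  refine Terminates.seq ((Terminates.forLoop (a := 0) (b := e)
    (fun j σ' => (∀ s < j, σ'.mat Reg.U e k s = 0) ∧
      ∀ l < k, ∀ s < e, σ'.mat Reg.U e l s = if s = l then 1 else 0) rfl
    (Nat.zero_le _) (fun σ' hf' => ?_) rfl ⟨by simp, hI⟩ ?_).weaken fun σ' hI' hf' => ?_)
  · simp only [IExp.eval]; exact (hS.of_frame hf' rfl rfl).1
  · intro j σ' _ hj hf' hij hI'
    have hS' := hS.of_frame hf' rfl rfl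
    refine Terminates.rset ?_
    have hc : σ'.ints Reg.cl 0 = k := by rw [hf'.ints _ rfl, hik]
    simp only [IExp.eval, RExp.eval, hij, hc, hS'.2 k hk, mat_setInt, Nat.cast_zero]
    refine ⟨fun s hs => ?_, fun l hl s hs => ?_⟩
    · rw [mat_setReal hj (by omega)]
      split_ifs with h1
      · rfl
      · exact hI'.1 s (by omega)
    · rw [mat_setReal hj hs, if_neg (by omega)]
      exact hI'.2 l hl s hs
  · have hS' := hS.of_frame hf' rfl rfl
    refine Terminates.rset ?_
    have hc : σ'.ints Reg.cl 0 = k := by rw [hf'.ints _ rfl, hik]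
    simp only [IExp.eval, RExp.eval, hc, hS'.2 k hk, mat_setInt, Nat.cast_one]
    intro l hl s hs
    rw [mat_setReal hk hs]
    rcases Nat.lt_succ_iff_lt_or_eq.1 hl with h1 | rfl
    · rw [if_neg (by omega)]; exact hI'.2 l h1 s hs
    · by_cases h2 : s = l
      · simp [h2]
      · simp [h2, hI'.1 s hs]

/-- Exchange the rows `r` and `l` of `U`. -/
def Program.swapRows : Program :=
  .forLoop Reg.cs (.lit 0) (ivar Reg.e)
    (.seq (.rset Reg.tmp (.lit 0) (ent Reg.U (ivar Reg.cl) (ivar Reg.cs)))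
      (.seq (.rset Reg.U (pos (ivar Reg.cl) (ivar Reg.cs)) (ent Reg.U (ivar Reg.cr) (ivar Reg.cs)))
        (.rset Reg.U (pos (ivar Reg.cr) (ivar Reg.cs)) (rvar Reg.tmp))))

theorem Terminates.swapRows {e r l : ℕ} {σ₀ : Memory} (h : Strided e e σ₀)
    (hr : σ₀.ints Reg.cr 0 = r) (hl : σ₀.ints Reg.cl 0 = l) (hre : r < e) (hle : l < e) :
    Terminates P Program.swapRows σ₀ (3 + 8 * e) fun σ => ∀ l' < e, ∀ s < e,
      σ.mat Reg.U e l' s = σ₀.mat Reg.U e (Equiv.swap r l l') s := by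
  have := Terminates.forLoop (P := P) (σ₀ := σ₀) (i := Reg.cs) (a := 0) (b := e) (lo := .lit 0)
    (hi := ivar Reg.e)
    (body := .seq (.rset Reg.tmp (.lit 0) (ent Reg.U (ivar Reg.cl) (ivar Reg.cs)))
      (.seq (.rset Reg.U (pos (ivar Reg.cl) (ivar Reg.cs)) (ent Reg.U (ivar Reg.cr) (ivar Reg.cs)))
        (.rset Reg.U (pos (ivar Reg.cr) (ivar Reg.cs)) (rvar Reg.tmp))))
    (T := 1 + (1 + 1 + 1) + 1)
    (fun k σ => ∀ l' < e, ∀ s < e, σ.mat Reg.U e l' s =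
      if s < k then σ₀.mat Reg.U e (Equiv.swap r l l') s else σ₀.mat Reg.U e l' s) rfl
    (Nat.zero_le _) (fun σ hf => by simp only [IExp.eval]; exact (h.of_frame hf rfl rfl).1) rfl
    (by simp [mat_setInt]) ?_
  · refine this.mono (by omega) fun σ hI l' hl' s hs => ?_
    rw [hI l' hl' s hs, if_pos hs]
  intro k σ _ hk hf hik hI
  have hS := h.of_frame hf rfl rfl
  have h1 : σ.ints Reg.cl 0 = l := by rw [hf.ints _ rfl, hl]
  have h2 : σ.ints Reg.cr 0 = r := by rw [hf.ints _ rfl, hr]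
  refine Terminates.seq (Terminates.rset (Terminates.seq (Terminates.rset (Terminates.rset ?_))))
  simp only [IExp.eval, RExp.eval, setReal_ints, hik, h1, h2, hS.2 l hle, hS.2 r hre, mat_setInt]
  intro l' hl' s hs
  rw [mat_setReal hk hs, mat_setReal hk hs, mat_setReal_ne _ (by decide)]
  have e1 := hI l hle k hk
  have e2 := hI r hre k hk
  simp only [lt_irrefl, if_false] at e1 e2
  by_cases h3 : s = k
  · subst h3
    simp only [Memory.mat] at e1 e2 ⊢
    rcases eq_or_ne l' r with rfl | h4
    · simp [e1]
    · rcases eq_or_ne l' l with rfl | h5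
      · simp [h4, e2]
      · have e3 := hI l' hl' s hs
        simp only [lt_irrefl, if_false, Memory.mat] at e3
        simp [h4, h5, Equiv.swap_apply_of_ne_of_ne, e3]
  · have e3 := hI l' hl' s hs
    simp only [h3, and_false, if_false, e3]
    simp only [show s < k + 1 ↔ s < k by omega]

/-- Subtract `pl / pr` times row `r` of `U` from row `l`. -/
def Program.subRow : Program :=
  .forLoop Reg.cs (.lit 0) (ivar Reg.e)
    (.rset Reg.U (pos (ivar Reg.cl) (ivar Reg.cs))
      (.sub (ent Reg.U (ivar Reg.cl) (ivar Reg.cs))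
        (.mul (.div (rvar Reg.pl) (rvar Reg.pr)) (ent Reg.U (ivar Reg.cr) (ivar Reg.cs)))))

theorem Terminates.subRow {e r l : ℕ} {σ₀ : Memory} (h : Strided e e σ₀)
    (hr : σ₀.ints Reg.cr 0 = r) (hl : σ₀.ints Reg.cl 0 = l) (hre : r < e) (hle : l < e) :
    Terminates P Program.subRow σ₀ (3 + 4 * e) fun σ => ∀ l' < e, ∀ s < e,
      σ.mat Reg.U e l' s = if l' = l then σ₀.mat Reg.U e l s -
        σ₀.reals Reg.pl 0 / σ₀.reals Reg.pr 0 * σ₀.mat Reg.U e r s else σ₀.mat Reg.U e l' s := by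
  refine (Terminates.forLoop (a := 0) (b := e) (T := 1)
    (fun k σ => ∀ l' < e, ∀ s < e, σ.mat Reg.U e l' s =
      if l' = l ∧ s < k then σ₀.mat Reg.U e l s -
        σ₀.reals Reg.pl 0 / σ₀.reals Reg.pr 0 * σ₀.mat Reg.U e r s else σ₀.mat Reg.U e l' s) rfl
    (Nat.zero_le _) (fun σ hf => by simp only [IExp.eval]; exact (h.of_frame hf rfl rfl).1) rfl
    (by simp [mat_setInt]) ?_).mono (by omega) fun σ hI l' hl' s hs => ?_
  · intro k σ _ hk hf hik hI
    have hS := h.of_frame hf rfl rfl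
    have h1 : σ.ints Reg.cl 0 = l := by rw [hf.ints _ rfl, hl]
    have h2 : σ.ints Reg.cr 0 = r := by rw [hf.ints _ rfl, hr]
    refine Terminates.rset ?_
    simp only [IExp.eval, RExp.eval, hik, h1, h2, hS.2 l hle, hS.2 r hre, mat_setInt,
      hf.reals Reg.pl rfl, hf.reals Reg.pr rfl]
    intro l' hl' s hs
    rw [mat_setReal hk hs]
    have e1 := hI l hle k hk
    have e2 := hI r hre k hk
    have e3 := hI l' hl' s hs
    simp only [lt_irrefl, and_false, if_false] at e1 e2
    simp only [Memory.mat] at e1 e2 e3 ⊢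
    rw [e1, e2, e3]
    by_cases h3 : s = k
    · subst h3
      by_cases h4 : l' = l <;> simp [h4]
    · simp only [h3, and_false, if_false]
      simp only [show s < k + 1 ↔ s < k by omega]
  · rw [hI l' hl' s hs]; simp [hs]

/-- The product of equation `r` with row `l` of `U`. -/
abbrev rowProd (acc l : ℕ) : Program :=
  .sumLoop Reg.cs acc (ivar Reg.e)
    (.mul (ent Reg.X (ivar Reg.cs) (ivar Reg.cr)) (ent Reg.U (ivar l) (ivar Reg.cs)))

/-- One elimination step: row `l` of `U` is made to solve equation `r`. -/
def Program.elimStep : Program :=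
  .seq (rowProd Reg.pr Reg.cr) (.seq (rowProd Reg.pl Reg.cl)
    (.ite (.and (.rle (rvar Reg.pr) (.ofInt (.lit 0))) (.rle (.ofInt (.lit 0)) (rvar Reg.pr)))
      .swapRows .subRow))

theorem Terminates.elimStep {e r l : ℕ} {σ₀ : Memory} {x : ℕ → ℕ → ℝ} (h : Strided e e σ₀)
    (hr : σ₀.ints Reg.cr 0 = r) (hl : σ₀.ints Reg.cl 0 = l) (hrl : r < l) (hle : l < e)
    (hx : σ₀.mat Reg.X e = x) (hI : ElimInv e x r l (σ₀.mat Reg.U e)) :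
    Terminates P Program.elimStep σ₀ (16 + 16 * e)
      fun σ => ElimInv e x r (l + 1) (σ.mat Reg.U e) := by
  subst hx
  refine (Terminates.seq (T' := 5 + 4 * e + (3 + 8 * e + 1) + 1)
    ((Terminates.sumLoop (b := e)
      (F := fun s => σ₀.mat Reg.X e s r * σ₀.mat Reg.U e r s) ?_ ?_).weaken fun σ h1 hf => ?_)).mono
    (by omega) fun _ h => h
  · intro σ hf; simp only [IExp.eval]; exact (h.of_frame hf rfl rfl).1
  · intro σ s hs hf hcs
    have hS := h.of_frame hf rfl rfl
    simp only [RExp.eval, IExp.eval, hcs, hf.ints Reg.cr rfl, hr, hS.2 s hs, hS.2 r (hrl.trans hle),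
      hf.reals Reg.X rfl, hf.reals Reg.U rfl, Memory.mat]
  have hS := h.of_frame hf rfl rfl
  have hU := mat_of_frame hf (a := Reg.U) rfl e
  have hX := mat_of_frame hf (a := Reg.X) rfl e
  have hr1 : σ.ints Reg.cr 0 = r := by rw [hf.ints _ rfl, hr]
  have hl1 : σ.ints Reg.cl 0 = l := by rw [hf.ints _ rfl, hl]
  refine Terminates.seq ((Terminates.sumLoop (b := e)
    (F := fun s => σ₀.mat Reg.X e s r * σ₀.mat Reg.U e l s) ?_ ?_).weaken fun σ' h2 hf' => ?_)
  · intro σ' hf'; simp only [IExp.eval]; exact (hS.of_frame hf' rfl rfl).1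
  · intro σ' s hs hf' hcs
    have hS' := hS.of_frame hf' rfl rfl
    rw [← hU, ← hX]
    simp only [RExp.eval, IExp.eval, hcs, hf'.ints Reg.cr rfl, hf'.ints Reg.cl rfl, hr1, hl1,
      hS'.2 s hs, hS'.2 l hle, hf'.reals Reg.X rfl, hf'.reals Reg.U rfl, Memory.mat]
  have hS' := hS.of_frame hf' rfl rfl
  have hU' := (mat_of_frame hf' (a := Reg.U) rfl e).trans hU
  have hr2 : σ'.ints Reg.cr 0 = r := by rw [hf'.ints _ rfl, hr1]
  have hl2 : σ'.ints Reg.cl 0 = l := by rw [hf'.ints _ rfl, hl1]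
  have h1' : σ'.reals Reg.pr 0 = ∑ s ∈ range e, σ₀.mat Reg.X e s r * σ₀.mat Reg.U e r s := by
    rw [hf'.reals _ rfl, h1]
  refine Terminates.ite (fun hb => ?_) fun hb => ?_
  · simp only [BExp.Holds, RExp.eval, IExp.eval, Nat.cast_zero, ← le_antisymm_iff, h1'] at hb
    refine (Terminates.swapRows hS' hr2 hl2 (hrl.trans hle) hle).mono le_rfl fun σ'' h3 => ?_
    refine (hI.swap hrl hle hb).congr (by omega) ?_
    rwa [hU'] at h3
  · simp only [BExp.Holds, RExp.eval, IExp.eval, Nat.cast_zero, ← le_antisymm_iff, h1'] at hb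
    refine (Terminates.subRow hS' hr2 hl2 (hrl.trans hle) hle).mono (by omega)
      fun σ'' h3 => ?_
    refine (hI.sub hrl hle hb (by rw [← h1', ← h2])).congr (by omega) ?_
    rwa [hU'] at h3

/-- The whole elimination: the last row of `U` becomes a nontrivial relation. -/
def Program.eliminate : Program :=
  .forLoop Reg.cr (.lit 0) (.sub (ivar Reg.e) (.lit 1))
    (.forLoop Reg.cl (.add (ivar Reg.cr) (.lit 1)) (ivar Reg.e) .elimStep)

theorem Terminates.eliminate {e : ℕ} {σ₀ : Memory} {x : ℕ → ℕ → ℝ} (h : Strided e e σ₀)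
    (hx : σ₀.mat Reg.X e = x)
    (hU : ∀ l < e, ∀ s < e, σ₀.mat Reg.U e l s = if s = l then 1 else 0) (he : 0 < e) :
    Terminates P Program.eliminate σ₀ (3 + e * (3 + e * (16 + 16 * e + 3) + 3))
      fun σ => ElimInv e x (e - 1) e (σ.mat Reg.U e) := by
  refine (Terminates.forLoop (a := 0) (b := e - 1) (T := 3 + e * (16 + 16 * e + 3))
    (fun r σ => ElimInv e x r (r + 1) (σ.mat Reg.U e)) rfl
    (Nat.zero_le _) (fun σ hf => ?_) rfl ?_ ?_).mono ?_ fun σ hσ => ?_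
  · simp only [IExp.eval]; rw [(h.of_frame hf rfl rfl).1]
  · exact (ElimInv.init e x).congr he hU
  · intro r σ _ hr hf hcr hI
    have hS := h.of_frame hf rfl rfl
    have hX : σ.mat Reg.X e = x := by rw [mat_of_frame hf rfl, hx]
    refine (Terminates.forLoop (a := r + 1) (b := e) (T := 16 + 16 * e)
      (fun l σ' => ElimInv e x r l (σ'.mat Reg.U e)) (by simp [IExp.eval, ← hcr]) (by omega)
      (fun σ' hf' => ?_) rfl hI ?_).mono ?_ fun σ' hσ' => hσ'.next
    · simp only [IExp.eval]; rw [(hS.of_frame hf' rfl rfl).1]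
    · intro l σ' hl hle hf' hcl hI'
      exact (Terminates.elimStep (hS.of_frame hf' rfl rfl) (by rw [hf'.ints _ rfl, hcr]) hcl
        (by omega) hle (by rw [mat_of_frame hf' rfl, hX]) hI').mono le_rfl fun σ'' h' => h'
    · gcongr; omega
  · gcongr; omega
  · rwa [Nat.sub_add_cancel he] at hσ

/-- Replace the negative entries of the last row of `U` by `0`. -/
def Program.positivePart : Program :=
  .forLoop Reg.cs (.lit 0) (ivar Reg.e)
    (.ite (.rle (ent Reg.U (.sub (ivar Reg.e) (.lit 1)) (ivar Reg.cs)) (.ofInt (.lit 0)))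
      (.rset Reg.U (pos (.sub (ivar Reg.e) (.lit 1)) (ivar Reg.cs)) (.ofInt (.lit 0))) .skip)

theorem Terminates.positivePart {e : ℕ} {σ₀ : Memory} (h : Strided e e σ₀) :
    Terminates P Program.positivePart σ₀ (3 + 5 * e) fun σ => ∀ s < e,
      σ.mat Reg.U e (e - 1) s = max (σ₀.mat Reg.U e (e - 1) s) 0 := by
  refine (Terminates.forLoop (a := 0) (b := e) (T := 1 + 1)
    (fun k σ => ∀ s < e, σ.mat Reg.U e (e - 1) s =
      if s < k then max (σ₀.mat Reg.U e (e - 1) s) 0 else σ₀.mat Reg.U e (e - 1) s) rfl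
    (Nat.zero_le _) (fun σ hf => by simp only [IExp.eval]; exact (h.of_frame hf rfl rfl).1) rfl
    (by simp [mat_setInt]) ?_).mono (by omega) fun σ hI s hs => ?_
  · intro k σ _ hk hf hik hI
    have hS := h.of_frame hf rfl rfl
    have e0 := hI k hk
    simp only [lt_irrefl, if_false] at e0
    have e1 : (pos (.sub (ivar Reg.e) (.lit 1)) (ivar Reg.cs)).eval σ = (e - 1) * e + k := by
      simp only [IExp.eval, hik, hS.1, hS.2 (e - 1) (by omega)]
    refine Terminates.ite (fun hb => Terminates.rset ?_) fun hb => Terminates.skip ?_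
    · simp only [BExp.Holds, RExp.eval, IExp.eval, hik, hS.1,
        hS.2 (e - 1) (show e - 1 < e by omega), Nat.cast_zero] at hb
      rw [e1]
      simp only [RExp.eval, IExp.eval, Nat.cast_zero, mat_setInt]
      intro s hs
      rw [mat_setReal hk hs, hI s hs]
      simp only [Memory.mat] at e0 ⊢
      rw [e0] at hb
      by_cases h3 : s = k
      · subst h3; simp [max_eq_right hb]
      · simp only [h3, and_false, if_false]
        simp only [show s < k + 1 ↔ s < k by omega]
    · simp only [BExp.Holds, RExp.eval, IExp.eval, hik, hS.1,
        hS.2 (e - 1) (show e - 1 < e by omega), Nat.cast_zero, not_le] at hb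
      intro s hs
      rw [mat_setInt, hI s hs]
      simp only [Memory.mat] at e0 ⊢
      rw [e0] at hb
      by_cases h3 : s = k
      · subst h3; simp [max_eq_left hb.le]
      · simp only [show s < k + 1 ↔ s < k by omega]
  · rw [hI s hs, if_pos hs]

/-- `Y` becomes the combination of the vectors in `X` with the coefficients in the last row
of `U`. -/
def Program.combine : Program :=
  .forLoop Reg.cc (.lit 0) (.sub (ivar Reg.e) (.lit 1))
    (.seq (.sumLoop Reg.cs Reg.pr (ivar Reg.e)
      (.mul (ent Reg.U (.sub (ivar Reg.e) (.lit 1)) (ivar Reg.cs))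
        (ent Reg.X (ivar Reg.cs) (ivar Reg.cc))))
      (.rset Reg.Y (ivar Reg.cc) (rvar Reg.pr)))

theorem Terminates.combine {e : ℕ} {σ₀ : Memory} (h : Strided e e σ₀) :
    Terminates P Program.combine σ₀ (3 + e * (4 * e + 10)) fun σ => ∀ c < e - 1,
      σ.reals Reg.Y c =
        ∑ s ∈ range e, σ₀.mat Reg.U e (e - 1) s * σ₀.mat Reg.X e s c := by
  refine (Terminates.forLoop (a := 0) (b := e - 1) (T := 5 + 4 * e + 1 + 1)
    (fun k σ => ∀ c < k, σ.reals Reg.Y c =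
      ∑ s ∈ range e, σ₀.mat Reg.U e (e - 1) s * σ₀.mat Reg.X e s c) rfl
    (Nat.zero_le _) (fun σ hf => ?_) rfl (by simp) ?_).mono
      (Nat.add_le_add_left (Nat.mul_le_mul (by omega) (by omega)) 3)
    fun _ h => h
  · simp only [IExp.eval]; rw [(h.of_frame hf rfl rfl).1]
  intro k σ _ hk hf hck hI
  have hS := h.of_frame hf rfl rfl
  refine Terminates.seq ((Terminates.sumLoop (b := e)
    (F := fun s => σ₀.mat Reg.U e (e - 1) s * σ₀.mat Reg.X e s k) ?_ ?_).weaken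
    fun σ' h1 hf' => Terminates.rset ?_)
  · intro σ' hf'; simp only [IExp.eval]; exact (hS.of_frame hf' rfl rfl).1
  · intro σ' s hs hf' hcs
    have hS' := hS.of_frame hf' rfl rfl
    simp only [RExp.eval, IExp.eval, hcs, hf'.ints Reg.cc rfl, hck, hS'.1, hS'.2 s hs,
      hS'.2 (e - 1) (by omega), hf'.reals Reg.X rfl, hf'.reals Reg.U rfl, hf.reals Reg.X rfl,
      hf.reals Reg.U rfl, Memory.mat]
  · intro c hc
    simp only [setInt_reals, setReal_reals, IExp.eval, RExp.eval, hf'.ints Reg.cc rfl, hck,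
      true_and]
    rcases Nat.lt_succ_iff_lt_or_eq.1 hc with h2 | rfl
    · rw [if_neg (by omega), hf'.reals Reg.Y rfl]; exact hI c h2
    · rw [if_pos rfl, h1]

/-- `Y` becomes the Radon point of the vectors in `X`, up to normalization. -/
def Program.radon : Program :=
  .seq .identity (.seq .eliminate (.seq .positivePart .combine))

theorem Terminates.radon {e : ℕ} {σ₀ : Memory} (h : Strided e e σ₀) (he : 0 < e) :
    Terminates P Program.radon σ₀ (88 * e ^ 3)
      fun σ => IsRadonPoint e (σ₀.mat Reg.X e) fun c =>
        σ.reals Reg.Y c / σ.reals Reg.Y (e - 2) := by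
  refine (Terminates.seq ((Terminates.identity h).weaken fun σ1 h1 hf1 =>
    Terminates.seq ((Terminates.eliminate (h.of_frame hf1 rfl rfl) rfl h1 he).weaken
      fun σ2 h2 hf2 => Terminates.seq ((Terminates.positivePart
        ((h.of_frame hf1 rfl rfl).of_frame hf2 rfl rfl)).weaken fun σ3 h3 hf3 =>
          (Terminates.combine (((h.of_frame hf1 rfl rfl).of_frame hf2 rfl rfl).of_frame hf3
            rfl rfl)).mono le_rfl fun σ4 h4 => ?_)))).mono ?_ fun _ h => h
  · have hX1 := mat_of_frame hf1 (a := Reg.X) rfl e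
    have hX2 := mat_of_frame hf2 (a := Reg.X) rfl e
    have hX3 := mat_of_frame hf3 (a := Reg.X) rfl e
    rw [hX1] at h2
    obtain ⟨e, rfl⟩ : ∃ e', e = e' + 1 := ⟨e - 1, by omega⟩
    simp only [Nat.add_sub_cancel] at *
    have hsum : ∀ c, ∑ s ∈ range (e + 1), σ3.mat Reg.U (e + 1) e s * σ3.mat Reg.X (e + 1) s c =
        ∑ s ∈ range (e + 1), max (σ2.mat Reg.U (e + 1) e s) 0 * σ₀.mat Reg.X (e + 1) s c :=
      fun c => sum_congr rfl fun s hs => by rw [h3 s (mem_range.1 hs), hX3, hX2, hX1]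
    refine ⟨σ2.mat Reg.U (e + 1) e, h2.exists_ne_zero, fun c hc => ?_, fun c hc => ?_⟩
    · rw [← h2.solved c hc e (by simp)]
      exact sum_congr rfl fun s _ => mul_comm _ _
    · simp only [Nat.add_sub_cancel] at hc
      have h0 : 0 < e := by omega
      simp only [h4 c hc, h4 (e + 1 - 2) (by omega), hsum]
  · have h1 : 1 ≤ e := he
    have h2 : e ≤ e ^ 2 := by nlinarith
    have h3 : e ^ 2 ≤ e ^ 3 := by nlinarith [sq_nonneg e]
    nlinarith

end RealRAM

namespace RealRAM

variable {n d : ℕ} {P : Fin n → Fin d → ℝ}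

/-! ### The deterministic part of the algorithm -/

namespace Reg
/-- Number of points per level. -/
@[simp] abbrev m : ℕ := 5
/-- Number of rounds. -/
@[simp] abbrev J : ℕ := 6
/-- Indices of the sampled input points. -/
@[simp] abbrev R : ℕ := 9
/-- Drawn indices that select the points entering each Radon point. -/
@[simp] abbrev idx : ℕ := 10
/-- Total number of points of all levels. -/
@[simp] abbrev G : ℕ := 13
/-- Number of the first point of the current level. -/
@[simp] abbrev lo : ℕ := 15
/-- Counters. -/
@[simp] abbrev ct : ℕ := 24
@[simp] abbrev cj : ℕ := 25
@[simp] abbrev cg : ℕ := 26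
/-- The points of all levels, one after the other, in homogeneous coordinates. -/
@[simp] abbrev pt : ℕ := 1
end Reg

/-- The dimension. -/
abbrev dimE : IExp := .arr 0 (.lit 0)

/-- Number of the point that is being computed, not counting the sample. -/
abbrev newE : IExp := .add (ivar Reg.lo) (ivar Reg.cj)

/-- The first level: the sampled input points. -/
def Program.firstLevel : Program :=
  .forLoop Reg.cg (.lit 0) (ivar Reg.m)
    (.seq
      (.forLoop Reg.cc (.lit 0) dimE
        (.rset Reg.pt (pos (ivar Reg.cg) (ivar Reg.cc))
          (.input (.arr Reg.R (ivar Reg.cg)) (ivar Reg.cc))))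
      (.rset Reg.pt (pos (ivar Reg.cg) dimE) (.ofInt (.lit 1))))

/-- Collect in `X` the points whose Radon point is wanted. -/
def Program.gather : Program :=
  .forLoop Reg.cs (.lit 0) (ivar Reg.e)
    (.forLoop Reg.cc (.lit 0) (.sub (ivar Reg.e) (.lit 1))
      (.rset Reg.X (pos (ivar Reg.cs) (ivar Reg.cc))
        (ent Reg.pt (.add (ivar Reg.lo) (.arr Reg.idx (pos newE (ivar Reg.cs)))) (ivar Reg.cc))))

/-- Normalize the Radon point and store it as a point of the next level. -/
def Program.store : Program :=
  .forLoop Reg.cc (.lit 0) (.sub (ivar Reg.e) (.lit 1))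
    (.rset Reg.pt (pos (.add (ivar Reg.m) newE) (ivar Reg.cc))
      (.div (.arr Reg.Y (ivar Reg.cc)) (.arr Reg.Y (.sub (ivar Reg.e) (.lit 2)))))

/-- Compute one point of the next level. -/
def Program.newPoint : Program := .seq .gather (.seq .radon .store)

/-- Compute all levels from the first one. -/
def Program.rounds : Program :=
  .seq (.iset Reg.lo (.lit 0) (.lit 0))
    (.forLoop Reg.ct (.lit 0) (ivar Reg.J)
      (.seq (.forLoop Reg.cj (.lit 0) (ivar Reg.m) .newPoint)
        (.iset Reg.lo (.lit 0) (.add (ivar Reg.lo) (ivar Reg.m)))))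

/-- Output the last point of the last level. -/
def Program.writeOutput : Program :=
  .forLoop Reg.cc (.lit 0) dimE
    (.rset 0 (ivar Reg.cc) (ent Reg.pt (.sub (ivar Reg.G) (.lit 1)) (ivar Reg.cc)))

/-- The part of the algorithm that follows the random draws. -/
def Program.mainPart : Program := .seq .firstLevel (.seq .rounds .writeOutput)

/-- The memory when all parameters are computed and all random draws are done. -/
structure Ready (d m J : ℕ) (σ : Memory) : Prop where
  dim : σ.ints 0 0 = d
  level : σ.ints Reg.m 0 = m
  rounds : σ.ints Reg.J 0 = J
  total : σ.ints Reg.G 0 = J * m + m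
  strided : Strided (d + 2) (J * m + m) σ
  idx : ∀ i < J * m * (d + 2), σ.ints Reg.idx i < m
  size : d + 2 ≤ J * m + m

theorem Ready.of_frame {m J : ℕ} {p : Program} {σ σ' : Memory} (h : Ready d m J σ)
    (hf : Frame p σ σ') (h0 : p.writesInt 0 = false) (h1 : p.writesInt Reg.m = false)
    (h2 : p.writesInt Reg.J = false) (h3 : p.writesInt Reg.G = false)
    (h4 : p.writesInt Reg.e = false) (h5 : p.writesInt Reg.off = false)
    (h6 : p.writesInt Reg.idx = false) : Ready d m J σ' where
  dim := by rw [hf.ints _ h0]; exact h.dim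
  level := by rw [hf.ints _ h1]; exact h.level
  rounds := by rw [hf.ints _ h2]; exact h.rounds
  total := by rw [hf.ints _ h3]; exact h.total
  strided := h.strided.of_frame hf h4 h5
  idx := by rw [hf.ints _ h6]; exact h.idx
  size := h.size

theorem Strided.mono {e g g' : ℕ} {σ : Memory} (h : Strided e g σ) (hg : g' ≤ g) :
    Strided e g' σ := ⟨h.1, fun x hx => h.2 x (hx.trans_le hg)⟩

theorem Terminates.firstLevel {m J : ℕ} {σ₀ : Memory} (h : Ready d m J σ₀) :
    Terminates P Program.firstLevel σ₀ (3 + m * (4 * d + 8)) fun σ => ∀ g < m,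
      (∀ c < d, σ.mat Reg.pt (d + 2) g c = inputEntry P (σ₀.ints Reg.R g) c) ∧
        σ.mat Reg.pt (d + 2) g d = 1 := by
  refine (Terminates.forLoop (a := 0) (b := m) (T := 3 + (d - 0) * (1 + 3) + 1 + 1)
    (fun k σ => ∀ g < k,
      (∀ c < d, σ.mat Reg.pt (d + 2) g c = inputEntry P (σ₀.ints Reg.R g) c) ∧
        σ.mat Reg.pt (d + 2) g d = 1) rfl
    (Nat.zero_le _) (fun σ hf => ?_) rfl (by simp) ?_).mono
    (Nat.add_le_add_left (Nat.mul_le_mul (by omega) (by omega)) 3) fun _ h => h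
  · simp only [IExp.eval]; exact (h.of_frame hf rfl rfl rfl rfl rfl rfl rfl).level
  intro k σ _ hk hf hik hI
  have hS := h.of_frame hf rfl rfl rfl rfl rfl rfl rfl
  refine Terminates.seq ((Terminates.forLoop (a := 0) (b := d)
    (fun j σ' => (∀ c < j, σ'.mat Reg.pt (d + 2) k c = inputEntry P (σ₀.ints Reg.R k) c) ∧
      ∀ g < k, (∀ c < d, σ'.mat Reg.pt (d + 2) g c = inputEntry P (σ₀.ints Reg.R g) c) ∧
        σ'.mat Reg.pt (d + 2) g d = 1) rfl
    (Nat.zero_le _) (fun σ' hf' => ?_) rfl ⟨by simp, hI⟩ ?_).weaken fun σ' hI' hf' => ?_)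
  · simp only [IExp.eval]; exact (hS.of_frame hf' rfl rfl rfl rfl rfl rfl rfl).dim
  · intro j σ' _ hj hf' hij hI'
    have hS' := hS.of_frame hf' rfl rfl rfl rfl rfl rfl rfl
    refine Terminates.rset ?_
    have hc : σ'.ints Reg.cg 0 = k := by rw [hf'.ints _ rfl, hik]
    have hR : σ'.ints Reg.R = σ₀.ints Reg.R := by rw [hf'.ints _ rfl, hf.ints _ rfl]
    simp only [IExp.eval, RExp.eval, hij, hc, hR, hS'.strided.2 k (by omega), mat_setInt]
    refine ⟨fun s hs => ?_, fun l hl => ⟨fun s hs => ?_, ?_⟩⟩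
    · rw [mat_setReal (by omega) (by omega)]
      split_ifs with h1
      · rw [h1.2]
      · exact hI'.1 s (by omega)
    · rw [mat_setReal (by omega) (by omega), if_neg (by omega)]
      exact (hI'.2 l hl).1 s hs
    · rw [mat_setReal (by omega) (by omega), if_neg (by omega)]
      exact (hI'.2 l hl).2
  · have hS' := hS.of_frame hf' rfl rfl rfl rfl rfl rfl rfl
    refine Terminates.rset ?_
    have hc : σ'.ints Reg.cg 0 = k := by rw [hf'.ints _ rfl, hik]
    simp only [IExp.eval, RExp.eval, hc, hS'.dim, hS'.strided.2 k (by omega), mat_setInt,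
      Nat.cast_one]
    intro g hg
    rcases Nat.lt_succ_iff_lt_or_eq.1 hg with h1 | rfl
    · refine ⟨fun c hc => ?_, ?_⟩
      · rw [mat_setReal (by omega) (by omega), if_neg (by omega)]; exact (hI'.2 g h1).1 c hc
      · rw [mat_setReal (by omega) (by omega), if_neg (by omega)]; exact (hI'.2 g h1).2
    · refine ⟨fun c hc => ?_, ?_⟩
      · rw [mat_setReal (by omega) (by omega), if_neg (by omega)]; exact hI'.1 c hc
      · rw [mat_setReal (by omega) (by omega), if_pos ⟨rfl, rfl⟩]

theorem Terminates.gather {m J b lo j : ℕ} {σ₀ : Memory} (h : Ready d m J σ₀)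
    (hlo : σ₀.ints Reg.lo 0 = lo) (hj : σ₀.ints Reg.cj 0 = j) (hb : lo + j = b)
    (hbJ : b < J * m) :
    Terminates P Program.gather σ₀ (3 + (d + 2) * (4 * (d + 2) + 6)) fun σ =>
      ∀ s < d + 2, ∀ c < d + 1, σ.mat Reg.X (d + 2) s c =
        σ₀.mat Reg.pt (d + 2) (lo + σ₀.ints Reg.idx (b * (d + 2) + s)) c := by
  refine (Terminates.forLoop (a := 0) (b := d + 2) (T := 3 + (d + 1 - 0) * (1 + 3))
    (fun k σ => ∀ s < k, ∀ c < d + 1, σ.mat Reg.X (d + 2) s c =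
        σ₀.mat Reg.pt (d + 2) (lo + σ₀.ints Reg.idx (b * (d + 2) + s)) c) rfl
    (Nat.zero_le _) (fun σ hf => ?_) rfl (by simp) ?_).mono
    (Nat.add_le_add_left (Nat.mul_le_mul (by omega) (by omega)) 3) fun _ h => h
  · simp only [IExp.eval]; exact (h.of_frame hf rfl rfl rfl rfl rfl rfl rfl).strided.1
  intro k σ _ hk hf hik hI
  have hS := h.of_frame hf rfl rfl rfl rfl rfl rfl rfl
  refine (Terminates.forLoop (a := 0) (b := d + 1)
    (fun i σ' => (∀ c < i, σ'.mat Reg.X (d + 2) k c =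
        σ₀.mat Reg.pt (d + 2) (lo + σ₀.ints Reg.idx (b * (d + 2) + k)) c) ∧
      ∀ s < k, ∀ c < d + 1, σ'.mat Reg.X (d + 2) s c =
        σ₀.mat Reg.pt (d + 2) (lo + σ₀.ints Reg.idx (b * (d + 2) + s)) c) rfl
    (Nat.zero_le _) (fun σ' hf' => ?_) rfl ⟨by simp, hI⟩ ?_).mono le_rfl fun σ' hI' => ?_
  · simp only [IExp.eval]; rw [(hS.of_frame hf' rfl rfl rfl rfl rfl rfl rfl).strided.1]; rfl
  · intro i σ' _ hi hf' hci hI'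
    have hS' := hS.of_frame hf' rfl rfl rfl rfl rfl rfl rfl
    refine Terminates.rset ?_
    have h1 : σ'.ints Reg.cs 0 = k := by rw [hf'.ints _ rfl, hik]
    have h2 : σ'.ints Reg.lo 0 = lo := by rw [hf'.ints _ rfl, hf.ints _ rfl, hlo]
    have h3 : σ'.ints Reg.cj 0 = j := by rw [hf'.ints _ rfl, hf.ints _ rfl, hj]
    have h4 : σ'.ints Reg.idx = σ₀.ints Reg.idx := by rw [hf'.ints _ rfl, hf.ints _ rfl]
    have h5 : σ'.reals Reg.pt = σ₀.reals Reg.pt := by rw [hf'.reals _ rfl, hf.reals _ rfl]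
    have h6 : b * (d + 2) + k < J * m * (d + 2) := by nlinarith
    have h7 := h.idx _ h6
    have h8 := h.size
    simp only [IExp.eval, RExp.eval, hci, h1, h2, h3, hb, hS'.strided.2 k (by omega),
      hS'.strided.2 b (by omega), h4, h5, mat_setInt,
      hS'.strided.2 (lo + σ₀.ints Reg.idx (b * (d + 2) + k)) (by omega)]
    refine ⟨fun s hs => ?_, fun l hl s hs => ?_⟩
    · rw [mat_setReal (by omega) (by omega)]
      split_ifs with h1
      · rw [h1.2]; rfl
      · exact hI'.1 s (by omega)
    · rw [mat_setReal (by omega) (by omega), if_neg (by omega)]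
      exact hI'.2 l hl s hs
  · intro s hs
    rcases Nat.lt_succ_iff_lt_or_eq.1 hs with h1 | rfl
    · exact hI'.2 s h1
    · exact hI'.1

theorem Terminates.store {m J b lo j : ℕ} {σ₀ : Memory} (h : Ready d m J σ₀)
    (hlo : σ₀.ints Reg.lo 0 = lo) (hj : σ₀.ints Reg.cj 0 = j) (hb : lo + j = b)
    (hbJ : b < J * m) :
    Terminates P Program.store σ₀ (3 + 4 * (d + 2)) fun σ =>
      (∀ c < d + 1, σ.mat Reg.pt (d + 2) (m + b) c =
        σ₀.reals Reg.Y c / σ₀.reals Reg.Y (d + 2 - 2)) ∧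
      ∀ g, g ≠ m + b → ∀ c < d + 1, σ.mat Reg.pt (d + 2) g c = σ₀.mat Reg.pt (d + 2) g c := by
  refine (Terminates.forLoop (a := 0) (b := d + 1) (T := 1)
    (fun k σ => (∀ c < k, σ.mat Reg.pt (d + 2) (m + b) c =
        σ₀.reals Reg.Y c / σ₀.reals Reg.Y (d + 2 - 2)) ∧
      ∀ g, g ≠ m + b → ∀ c < d + 1, σ.mat Reg.pt (d + 2) g c = σ₀.mat Reg.pt (d + 2) g c) rfl
    (Nat.zero_le _) (fun σ hf => ?_) rfl (by simp [mat_setInt]) ?_).mono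
    (by omega) fun _ h => h
  · simp only [IExp.eval]; rw [(h.of_frame hf rfl rfl rfl rfl rfl rfl rfl).strided.1]; rfl
  intro k σ _ hk hf hik hI
  have hS := h.of_frame hf rfl rfl rfl rfl rfl rfl rfl
  refine Terminates.rset ?_
  have h2 : σ.ints Reg.lo 0 = lo := by rw [hf.ints _ rfl, hlo]
  have h3 : σ.ints Reg.cj 0 = j := by rw [hf.ints _ rfl, hj]
  have h5 : σ.reals Reg.Y = σ₀.reals Reg.Y := hf.reals _ rfl
  simp only [IExp.eval, RExp.eval, hik, h2, h3, hb, hS.level, hS.strided.1, h5, mat_setInt,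
    hS.strided.2 (m + b) (by omega)]
  refine ⟨fun s hs => ?_, fun g hg s hs => ?_⟩
  · rw [mat_setReal (by omega) (by omega)]
    split_ifs with h1
    · rw [h1.2]
    · exact hI.1 s (by omega)
  · rw [mat_setReal (by omega) (by omega), if_neg (by tauto)]
    exact hI.2 g hg s hs

theorem Terminates.newPoint {m J b lo j : ℕ} {σ₀ : Memory} (h : Ready d m J σ₀)
    (hlo : σ₀.ints Reg.lo 0 = lo) (hj : σ₀.ints Reg.cj 0 = j) (hb : lo + j = b)
    (hbJ : b < J * m) :
    Terminates P Program.newPoint σ₀ (110 * (d + 2) ^ 3) fun σ =>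
      IsRadonPoint (d + 2)
        (fun s => σ₀.mat Reg.pt (d + 2) (lo + σ₀.ints Reg.idx (b * (d + 2) + s)))
        (σ.mat Reg.pt (d + 2) (m + b)) ∧
      ∀ g, g ≠ m + b → ∀ c < d + 1, σ.mat Reg.pt (d + 2) g c = σ₀.mat Reg.pt (d + 2) g c := by
  refine (Terminates.seq ((Terminates.gather h hlo hj hb hbJ).weaken fun σ1 h1 hf1 => ?_)).mono
    (T := (3 + (d + 2) * (4 * (d + 2) + 6)) + (88 * (d + 2) ^ 3 + (3 + 4 * (d + 2)) + 1) + 1)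
    ?_ fun _ h => h
  · have hS1 := h.of_frame hf1 rfl rfl rfl rfl rfl rfl rfl
    refine Terminates.seq ((Terminates.radon (hS1.strided.mono hS1.size)
      (Nat.succ_pos _)).weaken fun σ2 h2 hf2 => ?_)
    have hS2 := hS1.of_frame hf2 rfl rfl rfl rfl rfl rfl rfl
    refine (Terminates.store hS2 (by rw [hf2.ints _ rfl, hf1.ints _ rfl, hlo])
      (by rw [hf2.ints _ rfl, hf1.ints _ rfl, hj]) hb hbJ).mono le_rfl fun σ3 h3 => ⟨?_, ?_⟩
    · exact h2.congr (by omega) (fun s hs c hc => (h1 s hs c hc).symm) h3.1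
    · intro g hg c hc
      rw [h3.2 g hg c hc, mat_of_frame hf2 rfl, mat_of_frame hf1 rfl]
  · have h1 : 2 ≤ d + 2 := by omega
    generalize d + 2 = e at *
    have h2 : 2 * e ≤ e ^ 2 := by nlinarith
    have h3 : 2 * e ^ 2 ≤ e ^ 3 := by nlinarith [sq_nonneg e]
    nlinarith

/-- The points `pts`, level by level, in homogeneous coordinates: the first `m` are those of the
input that have the numbers `R`, and point number `b` of the following levels, counted from `0`
on, is the Radon point of the points of the level before that `idx` selects. -/
structure IsRadonSequence (P : Fin n → Fin d → ℝ) (m B : ℕ) (R idx : ℕ → ℕ)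
    (pts : ℕ → ℕ → ℝ) : Prop where
  first : ∀ g < m, (∀ c < d, pts g c = inputEntry P (R g) c) ∧ pts g d = 1
  radon : ∀ b < B, IsRadonPoint (d + 2) (fun s => pts (b / m * m + idx (b * (d + 2) + s)))
    (pts (m + b))

theorem IsRadonSequence.succ {m b : ℕ} {R idx : ℕ → ℕ} {pts pts' : ℕ → ℕ → ℝ}
    (h : IsRadonSequence P m b R idx pts)
    (hidx : ∀ i < (b + 1) * (d + 2), idx i < m)
    (hpts : ∀ g, g ≠ m + b → ∀ c < d + 1, pts' g c = pts g c)
    (hnew : IsRadonPoint (d + 2) (fun s => pts (b / m * m + idx (b * (d + 2) + s)))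
      (pts' (m + b))) : IsRadonSequence P m (b + 1) R idx pts' where
  first g hg := by
    have := h.first g hg
    refine ⟨fun c hc => by rw [hpts g (by omega) c (by omega)]; exact this.1 c hc, ?_⟩
    rw [hpts g (by omega) d (by omega)]; exact this.2
  radon b' hb' := by
    have hlt : ∀ s < d + 2, b' / m * m + idx (b' * (d + 2) + s) < m + b := fun s hs => by
      have h1 := Nat.div_mul_le_self b' m
      have h2 := hidx (b' * (d + 2) + s) (by nlinarith)
      omega
    rcases Nat.lt_succ_iff_lt_or_eq.1 hb' with h1 | rfl
    · exact (h.radon b' h1).congr (by omega) (fun s hs c hc => hpts _ (hlt s hs).ne _ hc)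
        (fun c hc => hpts _ (by omega) _ hc)
    · exact hnew.congr (by omega) (fun s hs c hc => hpts _ (hlt s hs).ne _ hc) fun _ _ => rfl

theorem Terminates.rounds {m J : ℕ} {R : ℕ → ℕ} {σ₀ : Memory} (h : Ready d m J σ₀) (hm : 0 < m)
    (hfirst : IsRadonSequence P m 0 R (σ₀.ints Reg.idx) (σ₀.mat Reg.pt (d + 2))) :
    Terminates P Program.rounds σ₀ (5 + J * (8 + m * (110 * (d + 2) ^ 3 + 3))) fun σ =>
      IsRadonSequence P m (J * m) R (σ₀.ints Reg.idx) (σ.mat Reg.pt (d + 2)) := by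
  refine (Terminates.seq (T := 1) (T' := 3 + J * (8 + m * (110 * (d + 2) ^ 3 + 3)))
    (Terminates.frame (Terminates.iset rfl) |>.mono le_rfl fun σ1 h1 => ?_)).mono
    (by omega) fun _ h => h
  obtain ⟨rfl, hf1⟩ := h1
  have hS1 := h.of_frame hf1 rfl rfl rfl rfl rfl rfl rfl
  have hlo1 : (σ₀.setInt Reg.lo ((IExp.lit 0).eval σ₀) ((IExp.lit 0).eval σ₀)).ints Reg.lo 0 =
      0 := by
    simp [IExp.eval]
  have hid1 := hf1.ints Reg.idx rfl
  have hpt1 := mat_of_frame hf1 (a := Reg.pt) rfl (d + 2)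
  set σ1 := σ₀.setInt Reg.lo ((IExp.lit 0).eval σ₀) ((IExp.lit 0).eval σ₀)
  refine (Terminates.forLoop (a := 0) (b := J) (T := 3 + (m - 0) * (110 * (d + 2) ^ 3 + 3) + 1 + 1)
    (fun t σ => σ.ints Reg.lo 0 = t * m ∧
      IsRadonSequence P m (t * m) R (σ₀.ints Reg.idx) (σ.mat Reg.pt (d + 2))) rfl
    (Nat.zero_le _) (fun σ hf => ?_) rfl ⟨by simp [hlo1], ?_⟩ ?_).mono
    (Nat.add_le_add_left (Nat.mul_le_mul (by omega) (by rw [Nat.sub_zero]; omega)) 3)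
    fun _ h => h.2
  · simp only [IExp.eval]; exact (hS1.of_frame hf rfl rfl rfl rfl rfl rfl rfl).rounds
  · rw [mat_setInt, hpt1, zero_mul]; exact hfirst
  intro t σ _ ht hf _ hI
  have hS := hS1.of_frame hf rfl rfl rfl rfl rfl rfl rfl
  refine Terminates.seq ((Terminates.forLoop (a := 0) (b := m)
    (fun j σ' => IsRadonSequence P m (t * m + j) R (σ₀.ints Reg.idx) (σ'.mat Reg.pt (d + 2))) rfl
    (Nat.zero_le _) (fun σ' hf' => ?_) rfl (by rw [mat_setInt]; exact hI.2) ?_).weaken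
    fun σ' hI' hf' => ?_)
  · simp only [IExp.eval]; exact (hS.of_frame hf' rfl rfl rfl rfl rfl rfl rfl).level
  · intro j σ' _ hj hf' hcj hI'
    have hS' := hS.of_frame hf' rfl rfl rfl rfl rfl rfl rfl
    have hlt : t * m + j < J * m := by nlinarith
    have hid : σ'.ints Reg.idx = σ₀.ints Reg.idx := by
      rw [hf'.ints _ rfl, hf.ints _ rfl, hid1]
    refine (Terminates.newPoint hS' (lo := t * m) (by rw [hf'.ints _ rfl, hI.1]) hcj rfl
      hlt).mono le_rfl fun σ'' h' => ?_
    refine hI'.succ (fun i hi => h.idx i ?_) h'.2 ?_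
    · exact hi.trans_le (Nat.mul_le_mul_right _ hlt)
    · rw [hid] at h'
      rw [show (t * m + j) / m = t by
        rw [Nat.add_div_of_dvd_right (Dvd.intro_left t rfl), Nat.mul_div_cancel _ hm,
          Nat.div_eq_of_lt hj, add_zero]]
      exact h'.1
  · have hS' := hS.of_frame hf' rfl rfl rfl rfl rfl rfl rfl
    refine Terminates.iset ⟨?_, ?_⟩
    · simp [IExp.eval, hS'.level, hf'.ints Reg.lo rfl, hI.1]; ring
    · rw [mat_setInt, mat_setInt, add_mul, one_mul]; exact hI'

theorem Terminates.writeOutput {m J : ℕ} {σ₀ : Memory} (h : Ready d m J σ₀) :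
    Terminates P Program.writeOutput σ₀ (3 + d * 4) fun σ => ∀ c < d,
      σ.reals 0 c = σ₀.mat Reg.pt (d + 2) (J * m + m - 1) c := by
  refine (Terminates.forLoop (a := 0) (b := d) (T := 1)
    (fun k σ => ∀ c < k, σ.reals 0 c = σ₀.mat Reg.pt (d + 2) (J * m + m - 1) c) rfl
    (Nat.zero_le _) (fun σ hf => ?_) rfl (by simp) ?_).mono
    (by omega) fun _ h => h
  · simp only [IExp.eval]; exact (h.of_frame hf rfl rfl rfl rfl rfl rfl rfl).dim
  intro k σ _ hk hf hik hI
  have hS := h.of_frame hf rfl rfl rfl rfl rfl rfl rfl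
  have hsz := h.size
  refine Terminates.rset ?_
  simp only [IExp.eval, RExp.eval, hik, hS.total, hf.reals Reg.pt rfl,
    hS.strided.2 (J * m + m - 1) (by omega), setInt_reals]
  intro c hc
  rw [setReal_reals]
  split_ifs with h1
  · rw [h1.2]; rfl
  · exact hI c (by omega)

theorem Terminates.mainPart {m J : ℕ} {σ₀ : Memory} (h : Ready d m J σ₀) (hm : 0 < m)
    (hJ : 0 < J) :
    Terminates P Program.mainPart σ₀ (200 * (J * m * (d + 2) ^ 3)) fun σ =>
      ∃ pts, IsRadonSequence P m (J * m) (σ₀.ints Reg.R) (σ₀.ints Reg.idx) pts ∧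
        ∀ c < d, σ.reals 0 c = pts (J * m + m - 1) c := by
  refine (Terminates.seq ((Terminates.firstLevel h).weaken fun σ1 h1 hf1 => ?_)).mono
    (T := (3 + m * (4 * d + 8)) +
      ((5 + J * (8 + m * (110 * (d + 2) ^ 3 + 3))) + (3 + d * 4) + 1) + 1) ?_ fun _ h => h
  · have hS1 := h.of_frame hf1 rfl rfl rfl rfl rfl rfl rfl
    have hid := hf1.ints Reg.idx rfl
    refine Terminates.seq ((Terminates.rounds hS1 hm (R := σ₀.ints Reg.R)
      ⟨h1, by simp⟩).weaken fun σ2 h2 hf2 => ?_)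
    rw [hid] at h2
    exact (Terminates.writeOutput (hS1.of_frame hf2 rfl rfl rfl rfl rfl rfl rfl)).mono le_rfl
      fun σ3 h3 => ⟨_, h2, h3⟩
  · have h1 : 2 ≤ d + 2 := by omega
    have h2 : 4 * d + 8 ≤ 4 * (d + 2) := by omega
    have h3 : d * 4 ≤ 4 * (d + 2) := by omega
    generalize d + 2 = e at *
    have h4 : 4 * e ≤ e ^ 3 := by nlinarith [sq_nonneg e, mul_self_nonneg e, Nat.mul_le_mul h1 h1]
    have h5 : 8 ≤ e ^ 3 := by nlinarith
    have h6 : m * (4 * d + 8) ≤ m * e ^ 3 := Nat.mul_le_mul_left _ (h2.trans h4)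
    have h7 : m * e ^ 3 ≤ J * m * e ^ 3 := Nat.mul_le_mul_right _ (by nlinarith)
    have h8 : e ^ 3 ≤ m * e ^ 3 := by nlinarith
    have h9 : J * 8 ≤ J * (m * e ^ 3) := Nat.mul_le_mul_left _ (by omega)
    have h10 : J * m * 8 ≤ J * m * e ^ 3 := Nat.mul_le_mul_left _ h5
    have h11 : J * (8 + m * (110 * e ^ 3 + 3)) = J * 8 + 110 * (J * m * e ^ 3) + 3 * (J * m) := by
      ring
    have h12 : J * (m * e ^ 3) = J * m * e ^ 3 := by ring
    omega

end RealRAM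

namespace RealRAM

variable {n d : ℕ} {P : Fin n → Fin d → ℝ}

/-! ### The whole program and the distribution of its output -/

/-- `dst := a * b`, by repeated addition; array `12` holds the counter. -/
def Program.mulProg (dst : ℕ) (a b : IExp) : Program :=
  .seq (.iset dst (.lit 0) (.lit 0))
    (.forLoop 12 (.lit 0) b (.iset dst (.lit 0) (.add (ivar dst) a)))

theorem Terminates.mulProg {dst x y : ℕ} {a b : IExp} {σ₀ : Memory} (hdst : dst ≠ 12)
    (ha : ∀ σ, Frame (Program.mulProg dst a b) σ₀ σ → a.eval σ = x)
    (hb : ∀ σ, Frame (Program.mulProg dst a b) σ₀ σ → b.eval σ = y) :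
    Terminates P (Program.mulProg dst a b) σ₀ (5 + 4 * y) fun σ => σ.ints dst 0 = x * y := by
  have hF : ∀ σ, Frame (.forLoop 12 (.lit 0) b (.iset dst (.lit 0) (.add (ivar dst) a)))
      (σ₀.setInt dst 0 0) σ → Frame (Program.mulProg dst a b) σ₀ σ := by
    intro σ h
    refine Frame.trans (σ' := σ₀.setInt dst 0 0) ⟨fun a ha => ?_, fun a _ => rfl⟩
      (h.mono (fun a ha => by simp [Program.writesInt, Program.mulProg] at ha ⊢; exact ha.2)
        (fun a ha => by simpa [Program.writesReal, Program.mulProg] using ha))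
    simp only [Program.writesInt, Program.mulProg, Bool.or_eq_false_iff, beq_eq_false_iff_ne] at ha
    exact setInt_ints_ne _ ha.1 _ _
  refine (Terminates.seq (T := 1) (Terminates.iset ?_)).mono
    (show 1 + (3 + (y - 0) * (1 + 3)) + 1 ≤ _ by omega) fun _ h => h
  simp only [IExp.eval]
  refine Terminates.forLoop (a := 0) (b := y) (fun k σ => σ.ints dst 0 = x * k) rfl
    (Nat.zero_le _) (fun σ h => hb σ (hF σ h)) (by simp [Program.writesInt, hdst.symm])
    (by simp [hdst]) ?_
  intro k σ _ hk hfr hik hI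
  refine Terminates.iset ?_
  simp [IExp.eval, hdst, hI, ha σ (hF σ hfr)]
  ring

/-- Number of the integer array that holds the smallest exponent `ℓ` with `d ≤ 2 ^ ℓ`. -/
abbrev Reg.ell : ℕ := 2
/-- The product `d * ℓ`. -/
abbrev Reg.L : ℕ := 3
/-- Total number of drawn indices. -/
abbrev Reg.M : ℕ := 8
/-- Number of computed Radon points. -/
abbrev Reg.B : ℕ := 18

/-- Find the smallest exponent `ℓ` with `d ≤ 2 ^ ℓ`. -/
def Program.logLoop : Program :=
  .loop (.not (.ile dimE (ivar 1)))
    (.seq (.iset 1 (.lit 0) (.add (ivar 1) (ivar 1)))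
      (.iset Reg.ell (.lit 0) (.add (ivar Reg.ell) (.lit 1))))

theorem Terminates.logLoop {σ₀ : Memory} (hd : σ₀.ints 0 0 = d) (h1 : σ₀.ints 1 0 = 1)
    (h2 : σ₀.ints Reg.ell 0 = 0) :
    Terminates P Program.logLoop σ₀ (1 + Nat.clog 2 d * 4)
      fun σ => σ.ints Reg.ell 0 = Nat.clog 2 d := by
  have := Terminates.loop (P := P) (b := .not (.ile dimE (ivar 1))) (T := 3)
    (p := .seq (.iset 1 (.lit 0) (.add (ivar 1) (ivar 1)))
      (.iset Reg.ell (.lit 0) (.add (ivar Reg.ell) (.lit 1))))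
    (Inv := fun r σ => σ.ints 0 0 = d ∧ σ.ints Reg.ell 0 + r = Nat.clog 2 d ∧
      σ.ints 1 0 = 2 ^ σ.ints Reg.ell 0) ?_ ?_ (Nat.clog 2 d) σ₀
    ⟨hd, by simp [h2], by simp [h1, h2]⟩
  · exact this.mono le_rfl fun σ h => h.2.1
  · rintro σ ⟨h0, h3, h4⟩
    simp only [BExp.Holds, IExp.eval, h0, h4, not_not]
    rw [add_zero] at h3
    rw [h3]
    exact Nat.le_pow_clog (by norm_num) d
  · rintro k σ ⟨h0, h3, h4⟩
    refine ⟨?_, (Terminates.seq (T := 1) (T' := 1) (Terminates.iset (Terminates.iset ?_))).mono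
      le_rfl fun _ h => h⟩
    · simp only [BExp.Holds, IExp.eval, h0, h4, not_le]
      exact (Nat.lt_clog_iff_pow_lt (by norm_num)).1 (by omega)
    · simp only [IExp.eval, setInt_ints]
      refine ⟨by simpa using h0, by simp; omega, ?_⟩
      simp [h4, pow_succ]
      ring

/-- Fill the table of the multiples of `e`. -/
def Program.table : Program :=
  .forLoop 19 (.lit 0) (ivar Reg.G)
    (.seq (.iset Reg.off (ivar 19) (ivar 27))
      (.iset 27 (.lit 0) (.add (ivar 27) (ivar Reg.e))))

theorem Terminates.table {σ₀ : Memory} {e g : ℕ} (he : σ₀.ints Reg.e 0 = e)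
    (hg : σ₀.ints Reg.G 0 = g) (hw : σ₀.ints 27 0 = 0) :
    Terminates P Program.table σ₀ (3 + g * 6) fun σ => Strided e g σ := by
  refine (Terminates.forLoop (a := 0) (b := g) (T := 3)
    (fun k σ => σ.ints 27 0 = k * e ∧ ∀ x < k, σ.ints Reg.off x = x * e) rfl (Nat.zero_le _)
    (fun σ hf => by simp [IExp.eval, hf.ints 13 rfl, hg]) rfl (by simp [hw]) ?_).weaken
    fun σ h hf => ⟨by rw [hf.ints _ rfl, he], h.2⟩
  intro k σ _ hk hf hik hI
  refine Terminates.seq (T := 1) (T' := 1) (Terminates.iset (Terminates.iset ⟨?_, ?_⟩))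
  · simp [IExp.eval, hI.1, hf.ints 7 rfl, he]; ring
  · intro x hx
    have h11 : σ.ints 19 0 = k := hik
    simp [IExp.eval, h11]
    split_ifs with h
    · rw [h, hI.1]
    · exact hI.2 x (by omega)

/-- Compute all parameters; the arrays `1`, `4` and `14` hold the powers of `2` and intermediate
products. -/
def Program.prep : Program :=
  .seq (.iset 1 (.lit 0) (.lit 1)) (.seq .logLoop (.seq (.mulProg Reg.L dimE (ivar Reg.ell))
    (.seq (.mulProg 4 dimE dimE) (.seq (.mulProg 14 (ivar 4) (ivar Reg.L))
      (.seq (.mulProg Reg.m (.lit 131072) (ivar 14)) (.seq (.mulProg Reg.J (.lit 4096) (ivar Reg.L))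
        (.seq (.iset Reg.e (.lit 0) (.add dimE (.lit 2)))
         (.seq (.mulProg Reg.B (ivar Reg.m) (ivar Reg.J))
          (.seq (.mulProg Reg.M (ivar Reg.B) (ivar Reg.e))
            (.seq (.iset Reg.G (.lit 0) (.add (ivar Reg.B) (ivar Reg.m))) .table))))))))))

end RealRAM

/-- The scale `d * ℓ` of the exponents in all failure probabilities, with `d ≤ 2 ^ ℓ < 2 * d`. -/
def expScale (d : ℕ) : ℕ := d * Nat.clog 2 d

/-- The size of the sample, and of each level. -/
def levelSize (d : ℕ) : ℕ := 131072 * (d * d * expScale d)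

/-- The number of rounds. -/
def roundCount (d : ℕ) : ℕ := 4096 * expScale d

theorem expScale_pos {d : ℕ} (hd : 2 ≤ d) : 0 < expScale d :=
  Nat.mul_pos (by omega) (Nat.clog_pos (by norm_num) hd)

theorem levelSize_pos {d : ℕ} (hd : 2 ≤ d) : 0 < levelSize d :=
  Nat.mul_pos (by norm_num) (Nat.mul_pos (Nat.mul_pos (by omega) (by omega)) (expScale_pos hd))

theorem roundCount_pos {d : ℕ} (hd : 2 ≤ d) : 0 < roundCount d :=
  Nat.mul_pos (by norm_num) (expScale_pos hd)

namespace RealRAM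

variable {n d : ℕ} {P : Fin n → Fin d → ℝ}

theorem Terminates.prep (hd : 2 ≤ d) :
    Terminates P Program.prep (initMemory n d)
      (200 * (roundCount d * levelSize d * (d + 2) ^ 3)) fun σ =>
      σ.ints 0 0 = d ∧ σ.ints 0 1 = n ∧ σ.ints Reg.m 0 = levelSize d ∧
      σ.ints Reg.J 0 = roundCount d ∧ σ.ints Reg.M 0 = roundCount d * levelSize d * (d + 2) ∧
      σ.ints Reg.G 0 = roundCount d * levelSize d + levelSize d ∧
      Strided (d + 2) (roundCount d * levelSize d + levelSize d) σ ∧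
      σ.ints 16 0 = 0 ∧ σ.ints 17 0 = 0 := by
  have i0 : (initMemory n d).ints 0 0 = d := rfl
  have i1 : (initMemory n d).ints 0 1 = n := rfl
  have ia : ∀ a, a ≠ 0 → (initMemory n d).ints a 0 = 0 := fun a ha => by simp [initMemory, ha]
  refine (Terminates.seq ((Terminates.iset_self _ _ _).weaken fun σ1 hs1 f1 => ?_)).mono
    (T := 1 + ((1 + Nat.clog 2 d * 4) + ((5 + 4 * Nat.clog 2 d) +
      ((5 + 4 * d) + ((5 + 4 * expScale d) + ((5 + 4 * (d * d * expScale d)) +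
        ((5 + 4 * expScale d) + (1 + ((5 + 4 * roundCount d) + ((5 + 4 * (d + 2)) +
          (1 + (3 + (roundCount d * levelSize d + levelSize d) * 6) + 1) + 1) + 1) + 1)
            + 1) + 1) + 1) + 1) + 1) + 1) + 1) ?_ fun _ h => h
  · have d1 : σ1.ints 0 = (initMemory n d).ints 0 := f1.ints _ rfl
    have p1 : σ1.ints 1 0 = 1 := by rw [hs1]; simp [IExp.eval]
    have e1 : σ1.ints Reg.ell 0 = 0 := by rw [f1.ints _ rfl]; exact ia _ (by decide)
    refine Terminates.seq ((Terminates.logLoop (by rw [d1, i0]) p1 e1).weaken fun σ2 h2 f2 => ?_)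
    have d2 : σ2.ints 0 = (initMemory n d).ints 0 := by rw [f2.ints _ rfl, d1]
    refine Terminates.seq ((Terminates.mulProg (x := d) (y := Nat.clog 2 d) (by decide)
      (fun σ hf => by simp [IExp.eval, hf.ints 0 rfl, d2, i0])
      (fun σ hf => by simp [IExp.eval, hf.ints Reg.ell rfl, h2])).weaken fun σ3 h3 f3 => ?_)
    change _ = expScale d at h3
    have d3 : σ3.ints 0 = (initMemory n d).ints 0 := by rw [f3.ints _ rfl, d2]
    refine Terminates.seq ((Terminates.mulProg (x := d) (y := d) (by decide)
      (fun σ hf => by simp [IExp.eval, hf.ints 0 rfl, d3, i0])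
      (fun σ hf => by simp [IExp.eval, hf.ints 0 rfl, d3, i0])).weaken fun σ4 h4 f4 => ?_)
    have d4 : σ4.ints 0 = (initMemory n d).ints 0 := by rw [f4.ints _ rfl, d3]
    have L4 : σ4.ints Reg.L 0 = expScale d := by rw [f4.ints _ rfl, h3]
    refine Terminates.seq ((Terminates.mulProg (x := d * d) (y := expScale d) (by decide)
      (fun σ hf => by simp [IExp.eval, hf.ints 4 rfl, h4])
      (fun σ hf => by simp [IExp.eval, hf.ints Reg.L rfl, L4])).weaken fun σ5 h5 f5 => ?_)
    have d5 : σ5.ints 0 = (initMemory n d).ints 0 := by rw [f5.ints _ rfl, d4]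
    have L5 : σ5.ints Reg.L 0 = expScale d := by rw [f5.ints _ rfl, L4]
    refine Terminates.seq ((Terminates.mulProg (x := 131072) (y := d * d * expScale d) (by decide)
      (fun σ hf => by simp [IExp.eval])
      (fun σ hf => by simp [IExp.eval, hf.ints 14 rfl, h5])).weaken fun σ6 h6 f6 => ?_)
    change _ = levelSize d at h6
    have d6 : σ6.ints 0 = (initMemory n d).ints 0 := by rw [f6.ints _ rfl, d5]
    have L6 : σ6.ints Reg.L 0 = expScale d := by rw [f6.ints _ rfl, L5]
    refine Terminates.seq ((Terminates.mulProg (x := 4096) (y := expScale d) (by decide)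
      (fun σ hf => by simp [IExp.eval])
      (fun σ hf => by simp [IExp.eval, hf.ints Reg.L rfl, L6])).weaken fun σ7 h7 f7 => ?_)
    change _ = roundCount d at h7
    have d7 : σ7.ints 0 = (initMemory n d).ints 0 := by rw [f7.ints _ rfl, d6]
    have m7 : σ7.ints Reg.m 0 = levelSize d := by rw [f7.ints _ rfl, h6]
    refine Terminates.seq ((Terminates.iset_self _ _ _).weaken fun σ8 hs8 f8 => ?_)
    have e8 : σ8.ints Reg.e 0 = d + 2 := by rw [hs8]; simp [IExp.eval, d7, i0]
    have d8 : σ8.ints 0 = (initMemory n d).ints 0 := by rw [f8.ints _ rfl, d7]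
    have m8 : σ8.ints Reg.m 0 = levelSize d := by rw [f8.ints _ rfl, m7]
    have J8 : σ8.ints Reg.J 0 = roundCount d := by rw [f8.ints _ rfl, h7]
    refine Terminates.seq ((Terminates.mulProg (x := levelSize d) (y := roundCount d) (by decide)
      (fun σ hf => by simp only [IExp.eval, hf.ints Reg.m rfl, m8])
      (fun σ hf => by simp only [IExp.eval, hf.ints Reg.J rfl, J8])).weaken fun σ9 h9 f9 => ?_)
    rw [mul_comm] at h9
    have e9 : σ9.ints Reg.e 0 = d + 2 := by rw [f9.ints _ rfl, e8]
    refine Terminates.seq ((Terminates.mulProg (x := roundCount d * levelSize d) (y := d + 2)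
      (by decide)
      (fun σ hf => by simp only [IExp.eval, hf.ints Reg.B rfl, h9])
      (fun σ hf => by simp only [IExp.eval, hf.ints Reg.e rfl, e9])).weaken fun σ10 h10 f10 => ?_)
    have m10 : σ10.ints Reg.m 0 = levelSize d := by rw [f10.ints _ rfl, f9.ints _ rfl, m8]
    have B10 : σ10.ints Reg.B 0 = roundCount d * levelSize d := by rw [f10.ints _ rfl, h9]
    refine Terminates.seq ((Terminates.iset_self _ _ _).weaken fun σ11 hs11 f11 => ?_)
    have G11 : σ11.ints Reg.G 0 = roundCount d * levelSize d + levelSize d := by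
      rw [hs11]
      simp only [setInt_ints, IExp.eval, B10, m10, and_self, if_true]
    have keep : ∀ a, Program.prep.writesInt a = false → σ11.ints a = (initMemory n d).ints a := by
      intro a ha
      simp only [Program.prep, Program.writesInt, Bool.or_eq_false_iff] at ha
      rw [f11.ints a ha.2.2.2.2.2.2.2.2.2.2.1, f10.ints a ha.2.2.2.2.2.2.2.2.2.1,
        f9.ints a ha.2.2.2.2.2.2.2.2.1, f8.ints a ha.2.2.2.2.2.2.2.1, f7.ints a ha.2.2.2.2.2.2.1,
        f6.ints a ha.2.2.2.2.2.1, f5.ints a ha.2.2.2.2.1, f4.ints a ha.2.2.2.1, f3.ints a ha.2.2.1,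
        f2.ints a ha.2.1, f1.ints a ha.1]
    have w11 : σ11.ints 27 0 = 0 := by
      rw [f11.ints _ rfl, f10.ints _ rfl, f9.ints _ rfl, f8.ints _ rfl, f7.ints _ rfl,
        f6.ints _ rfl, f5.ints _ rfl, f4.ints _ rfl, f3.ints _ rfl, f2.ints _ rfl, f1.ints _ rfl]
      exact ia _ (by decide)
    refine (Terminates.table (e := d + 2) (by rw [f11.ints _ rfl, f10.ints _ rfl, e9]) G11
      w11).weaken fun σ h f => ⟨?_, ?_, ?_, ?_, ?_, ?_, h, ?_, ?_⟩
    · rw [f.ints _ rfl, keep _ rfl, i0]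
    · rw [f.ints _ rfl, keep _ rfl, i1]
    · rw [f.ints _ rfl, f11.ints _ rfl, m10]
    · rw [f.ints _ rfl, f11.ints _ rfl, f10.ints _ rfl, f9.ints _ rfl, J8]
    · rw [f.ints _ rfl, f11.ints _ rfl, h10]
    · rw [f.ints _ rfl, G11]
    · rw [f.ints _ rfl, keep _ rfl, ia _ (by decide)]
    · rw [f.ints _ rfl, keep _ rfl, ia _ (by decide)]
  · have hL := expScale_pos hd
    have hm := levelSize_pos hd
    have h1 : Nat.clog 2 d ≤ expScale d := Nat.le_mul_of_pos_left _ (by omega)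
    have h2 : d ≤ expScale d := Nat.le_mul_of_pos_right _ (Nat.clog_pos (by norm_num) hd)
    have h3 : expScale d ≤ roundCount d := by unfold roundCount; omega
    have h4 : d * d * expScale d ≤ levelSize d := by unfold levelSize; omega
    have h5 : roundCount d ≤ roundCount d * levelSize d := Nat.le_mul_of_pos_right _ hm
    have h6 : levelSize d ≤ roundCount d * levelSize d :=
      Nat.le_mul_of_pos_left _ (roundCount_pos hd)
    have h7 : roundCount d * levelSize d ≤ roundCount d * levelSize d * (d + 2) ^ 3 :=
      Nat.le_mul_of_pos_right _ (by positivity)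
    omega

/-- The algorithm: compute the parameters, draw the sample and the indices (the arrays `16` and `17`
hold the counters), compute all levels of Radon points, and output the last point. -/
def Program.centerPoint : Program :=
  .seq .prep (.seq (.drawLoop Reg.R 16 (ivar Reg.m) (.sub (.arr 0 (.lit 1)) (.lit 1)))
    (.seq (.drawLoop Reg.idx 17 (ivar Reg.M) (.sub (ivar Reg.m) (.lit 1))) .mainPart))

end RealRAM

/-- The number of steps that the algorithm is given. -/
def timeBound (d : ℕ) : ℕ := 450 * (roundCount d * levelSize d * (d + 2) ^ 3)

namespace RealRAM

variable {n d : ℕ}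

/-- The program stops in time, and its output is a function of uniform draws: the last point of
the Radon sequence that they determine. -/
theorem centerPoint_run (P : Fin (n + 1) → Fin d → ℝ) (hd : 2 ≤ d) {k M : ℕ}
    (hk : levelSize d = k + 1) (hM : roundCount d * levelSize d * (d + 2) = M) :
    ∃ out : (Fin (levelSize d) → Fin (n + 1)) → (Fin M → Fin (k + 1)) → Memory,
      Program.run .centerPoint P (timeBound d) =
        ((PMF.uniformOfFintype _).bind fun r => (PMF.uniformOfFintype _).map fun f =>
          ⟨[], out r f⟩) ∧
      ∀ r f, ∃ R idx : ℕ → ℕ, (∀ g : Fin (levelSize d), R g = r g) ∧ (∀ i : Fin M, idx i = f i) ∧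
        ∃ pts, IsRadonSequence P (levelSize d) (roundCount d * levelSize d) R idx pts ∧
          ∀ c < d, (out r f).reals 0 c =
            pts (roundCount d * levelSize d + levelSize d - 1) c := by
  have hm := levelSize_pos hd
  have hJ := roundCount_pos hd
  obtain ⟨t, ht, σ, hbig, h0, h1, hmm, hJJ, hMM, hG, hstr, hc, hc'⟩ := Terminates.prep (P := P) hd
  rw [hM] at hMM
  set m := levelSize d
  set J := roundCount d
  -- the memories after the two drawing loops
  let σ1 : (Fin m → Fin (n + 1)) → Memory := fun r => σ.fill Reg.R 16 m 0 fun j => r j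
  let σ2 : (Fin m → Fin (n + 1)) → (Fin M → Fin (k + 1)) → Memory := fun r f =>
    (σ1 r).fill Reg.idx 17 M 0 fun j => f j
  have hσ1 : ∀ r a, a ≠ Reg.R → a ≠ 16 → (σ1 r).ints a = σ.ints a := fun r a h h' =>
    fill_ints_ne h h' _ _ _ _
  have hσ2 : ∀ r f a, a ≠ Reg.R → a ≠ 16 → a ≠ Reg.idx → a ≠ 17 → (σ2 r f).ints a = σ.ints a :=
    fun r f a ha ha' hb hb' => (fill_ints_ne hb hb' _ _ _ _).trans (hσ1 r a ha ha')
  have hidx : ∀ r f (i : Fin M), (σ2 r f).ints Reg.idx i = f i := fun r f i => by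
    have := fill_ints (a := Reg.idx) (i := 17) (by decide) M 0 (fun j => (f j : ℕ)) (σ1 r) i
    rwa [zero_add] at this
  have hR : ∀ r f (i : Fin m), (σ2 r f).ints Reg.R i = r i := fun r f i => by
    have := fill_ints (a := Reg.R) (i := 16) (by decide) m 0 (fun j => (r j : ℕ)) σ i
    rw [zero_add] at this
    exact (congrFun (fill_ints_ne (by decide) (by decide) _ _ _ _) _).trans this
  have hready : ∀ r f, Ready d m J (σ2 r f) := fun r f =>
    { dim := by rw [hσ2 r f 0 (by decide) (by decide) (by decide) (by decide), h0]
      level := by rw [hσ2 r f _ (by decide) (by decide) (by decide) (by decide), hmm]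
      rounds := by rw [hσ2 r f _ (by decide) (by decide) (by decide) (by decide), hJJ]
      total := by rw [hσ2 r f _ (by decide) (by decide) (by decide) (by decide), hG]
      strided := by
        unfold Strided
        rw [hσ2 r f Reg.e (by decide) (by decide) (by decide) (by decide),
          hσ2 r f Reg.off (by decide) (by decide) (by decide) (by decide)]
        exact hstr
      idx := fun i hi => by
        rw [hM] at hi
        rw [hidx r f ⟨i, hi⟩, hk]
        exact (f _).2
      size := by
        have h2 : d ≤ m := by
          have := Nat.mul_pos (show 0 < d by omega) (expScale_pos hd)
          have h3 : d ≤ d * (d * expScale d) :=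
            Nat.le_mul_of_pos_right _ this
          change d ≤ 131072 * (d * d * expScale d)
          rw [mul_assoc d d]; omega
        have h3 : m ≤ J * m := Nat.le_mul_of_pos_left _ hJ
        omega }
  choose tf htf out hout pts hpts using fun r f =>
    Terminates.mainPart (P := P) (hready r f) hm hJ
  refine ⟨out, ?_, fun r f => ⟨_, _, hR r f, hidx r f, pts r f, hpts r f⟩⟩
  have hT : t + (4 * m + 1) + (4 * M + 1) + 200 * (J * m * (d + 2) ^ 3) + 3 ≤ timeBound d := by
    have e1 : J * m * 8 ≤ J * m * (d + 2) ^ 3 :=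
      Nat.mul_le_mul_left _ (by nlinarith [Nat.pow_le_pow_left (show 2 ≤ d + 2 by omega) 3])
    have e2 : m ≤ J * m := Nat.le_mul_of_pos_left _ hJ
    have e3 : M ≤ J * m * (d + 2) ^ 3 := by
      rw [← hM]; exact Nat.mul_le_mul_left _ (Nat.le_self_pow (by norm_num) _)
    change _ ≤ 450 * (J * m * (d + 2) ^ 3)
    omega
  obtain ⟨s, hs⟩ : ∃ s, timeBound d =
      (t + ((4 * m + 1 + ((4 * M + 1 + (200 * (J * m * (d + 2) ^ 3) + s)) + 1)) + 1)) + 1 :=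
    ⟨timeBound d - (t + (4 * m + 1) + (4 * M + 1) + 200 * (J * m * (d + 2) ^ 3) + 3), by omega⟩
  rw [hs]
  have hseq : ∀ (p q : Program) (K : List Program) (τ : Memory) (u : ℕ),
      steps P (u + 1) ⟨.seq p q :: K, τ⟩ = steps P u ⟨p :: q :: K, τ⟩ := fun p q K τ u => by
    rw [steps_add_one]; simp [step]
  rw [Program.run, Program.centerPoint, hseq, hbig.steps_eq, hseq,
    steps_drawLoop (M := m) (v := n) _ _ m σ
      (fun σ => σ.ints Reg.m 0 = m ∧ σ.ints 0 1 = n + 1)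
      (fun σ h => ⟨by simpa [IExp.eval] using h.1, by simp [IExp.eval, h.2]⟩)
      (fun σ j x h => by simpa using h) (fun σ j x h => by simpa using h) (by decide)
      ⟨hmm, h1⟩ le_rfl (by simpa using hc)]
  congr 1
  funext r
  rw [hseq, steps_drawLoop (M := M) (v := k) _ _ M _
      (fun σ => σ.ints Reg.m 0 = m ∧ σ.ints Reg.M 0 = M)
      (fun σ h => ⟨by simpa [IExp.eval] using h.2, by simp [IExp.eval, h.1, hk]⟩)
      (fun σ j x h => by simpa using h) (fun σ j x h => by simpa using h) (by decide)
      ⟨?_, ?_⟩ le_rfl ?_, ← PMF.bind_pure_comp]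
  · congr 1
    funext f
    simp only [Nat.sub_self]
    obtain ⟨u, hu⟩ : ∃ u, 200 * (J * m * (d + 2) ^ 3) + s = tf r f + u :=
      ⟨200 * (J * m * (d + 2) ^ 3) + s - tf r f, by have := htf r f; omega⟩
    rw [hu]
    exact ((hout r f).steps_eq [] u).trans (steps_halted _ _)
  · rw [fill_ints_ne (by decide) (by decide), hmm]
  · rw [fill_ints_ne (by decide) (by decide), hMM]
  · rw [fill_ints_ne (by decide) (by decide), hc', Nat.sub_self]

end RealRAM

/-! ### Halfspaces determined by few points -/

section Geometry

variable {d : ℕ}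

/-- `p` is a closest pair of points of the convex hulls of `A` and `B`. -/
def IsClosestPair (A B : Set (Fin d → ℝ)) (p : (Fin d → ℝ) × (Fin d → ℝ)) : Prop :=
  p.1 ∈ convexHull ℝ A ∧ p.2 ∈ convexHull ℝ B ∧ ∀ a ∈ convexHull ℝ A, ∀ b ∈ convexHull ℝ B,
    (p.1 - p.2) ⬝ᵥ (p.1 - p.2) ≤ (a - b) ⬝ᵥ (a - b)

open Classical in
/-- An open halfspace that depends on `A` and `B` only, contains `A` and misses `B` if their convex
hulls are disjoint: it is bounded by the hyperplane through the point of `conv B` in some closest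
pair that is orthogonal to the difference of the pair. It is empty if `A` is empty, and the whole
space if only `B` is empty. -/
noncomputable def sepHalfspace (A B : Set (Fin d → ℝ)) : Set (Fin d → ℝ) :=
  if h : ∃ p, IsClosestPair A B p then
    {x | h.choose.2 ⬝ᵥ (h.choose.1 - h.choose.2) < x ⬝ᵥ (h.choose.1 - h.choose.2)}
  else {_x | A.Nonempty}

theorem isLinearMap_dotProduct (w : Fin d → ℝ) : IsLinearMap ℝ fun x : Fin d → ℝ => x ⬝ᵥ w :=
  ⟨fun x y => add_dotProduct x y w, fun c x => smul_dotProduct c x w⟩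

theorem convex_sepHalfspace (A B : Set (Fin d → ℝ)) : Convex ℝ (sepHalfspace A B) := by
  unfold sepHalfspace
  split_ifs with h
  · exact convex_halfSpace_gt (isLinearMap_dotProduct _) _
  · by_cases hA : A.Nonempty
    · simpa [hA] using convex_univ
    · simpa [hA] using convex_empty

theorem convex_compl_sepHalfspace (A B : Set (Fin d → ℝ)) : Convex ℝ (sepHalfspace A B)ᶜ := by
  unfold sepHalfspace
  split_ifs with h
  · simp only [Set.compl_ofPred, not_lt]
    exact convex_halfSpace_le (isLinearMap_dotProduct _) _
  · by_cases hA : A.Nonempty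
    · simpa [hA] using convex_empty
    · simpa [hA] using convex_univ

/-- A closest point `v` of a convex set to the origin: no point of the set lies strictly on the
near side of the hyperplane through `v` orthogonal to `v`. -/
theorem dotProduct_sub_nonneg_of_forall_le {v w : Fin d → ℝ}
    (h : ∀ t : ℝ, 0 < t → t ≤ 1 → v ⬝ᵥ v ≤ (v + t • (w - v)) ⬝ᵥ (v + t • (w - v))) :
    0 ≤ (w - v) ⬝ᵥ v := by
  by_contra! hneg
  set p := (w - v) ⬝ᵥ v with hp
  set r := (w - v) ⬝ᵥ (w - v) with hr
  have hr0 : 0 ≤ r := by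
    rw [hr, dotProduct]
    exact sum_nonneg fun i _ => mul_self_nonneg _
  have key : ∀ t : ℝ, 0 < t → t ≤ 1 → 0 ≤ 2 * p + t * r := by
    intro t ht ht1
    have := h t ht ht1
    simp only [add_dotProduct, dotProduct_add, smul_dotProduct, dotProduct_smul, smul_eq_mul,
      ← hp, ← hr, dotProduct_comm v (w - v)] at this
    nlinarith
  rcases le_or_gt r (-p) with h1 | h1
  · have := key 1 one_pos le_rfl
    linarith
  · have hrpos : 0 < r := by linarith
    have := key (-p / r) (div_pos (by linarith) hrpos) ((div_le_one hrpos).2 h1.le)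
    rw [div_mul_cancel₀ _ hrpos.ne'] at this
    linarith

theorem IsClosestPair.le_dotProduct {A B : Set (Fin d → ℝ)} {p : (Fin d → ℝ) × (Fin d → ℝ)}
    (h : IsClosestPair A B p) {x : Fin d → ℝ} (hx : x ∈ convexHull ℝ A) :
    p.1 ⬝ᵥ (p.1 - p.2) ≤ x ⬝ᵥ (p.1 - p.2) := by
  have := dotProduct_sub_nonneg_of_forall_le (v := p.1 - p.2) (w := x - p.2) fun t ht ht1 => by
    convert h.2.2 (p.1 + t • (x - p.1)) ((convex_convexHull ℝ A).add_smul_sub_mem h.1 hx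
      ⟨ht.le, ht1⟩) p.2 h.2.1 using 2 <;> (ext i; simp; ring)
  rw [sub_sub_sub_cancel_right, sub_dotProduct] at this
  linarith

theorem IsClosestPair.dotProduct_le {A B : Set (Fin d → ℝ)} {p : (Fin d → ℝ) × (Fin d → ℝ)}
    (h : IsClosestPair A B p) {y : Fin d → ℝ} (hy : y ∈ convexHull ℝ B) :
    y ⬝ᵥ (p.1 - p.2) ≤ p.2 ⬝ᵥ (p.1 - p.2) := by
  have := dotProduct_sub_nonneg_of_forall_le (v := p.1 - p.2) (w := p.1 - y) fun t ht ht1 => by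
    convert h.2.2 p.1 h.1 (p.2 + t • (y - p.2)) ((convex_convexHull ℝ B).add_smul_sub_mem h.2.1 hy
      ⟨ht.le, ht1⟩) using 2 <;> (ext i; simp; ring)
  rw [sub_sub_sub_cancel_left, sub_dotProduct] at this
  linarith

theorem exists_isClosestPair {U V : Set (Fin d → ℝ)} (hU : U.Finite) (hV : V.Finite)
    (hU' : U.Nonempty) (hV' : V.Nonempty) : ∃ p, IsClosestPair U V p := by
  have hcont : Continuous fun p : (Fin d → ℝ) × (Fin d → ℝ) => (p.1 - p.2) ⬝ᵥ (p.1 - p.2) := by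
    unfold dotProduct; fun_prop
  obtain ⟨p, hp, hmin⟩ := ((hU.isCompact_convexHull ℝ).prod
    (hV.isCompact_convexHull ℝ)).exists_isMinOn
    ((hU'.convexHull (𝕜 := ℝ)).prod (hV'.convexHull (𝕜 := ℝ))) hcont.continuousOn
  exact ⟨p, hp.1, hp.2, fun a ha b hb => hmin (Set.mk_mem_prod ha hb)⟩

/-- Carathéodory's theorem with a bound on the number of points. -/
theorem exists_finset_card_le_mem_convexHull {U : Set (Fin d → ℝ)} {x : Fin d → ℝ}
    (hx : x ∈ convexHull ℝ U) :
    ∃ A : Finset (Fin d → ℝ), ↑A ⊆ U ∧ A.card ≤ d + 1 ∧ x ∈ convexHull ℝ (A : Set (Fin d → ℝ)) := by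
  rw [convexHull_eq_union] at hx
  simp only [Set.mem_iUnion] at hx
  obtain ⟨A, hA, hind, hxA⟩ := hx
  refine ⟨A, hA, ?_, hxA⟩
  have h1 := hind.card_le_finrank_succ
  have h2 := Submodule.finrank_le (vectorSpan ℝ (Set.range (Subtype.val : A → Fin d → ℝ)))
  simp at h1 h2
  omega

/-- Finite sets with disjoint convex hulls are separated by a halfspace that at most `d + 1` points
of either set determine: the closest pair of the hulls lies in the hulls of that many points. -/
theorem exists_sepHalfspace {U V : Set (Fin d → ℝ)} (hU : U.Finite) (hV : V.Finite)
    (hdisj : Disjoint (convexHull ℝ U) (convexHull ℝ V)) :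
    ∃ A B : Finset (Fin d → ℝ), ↑A ⊆ U ∧ ↑B ⊆ V ∧ A.card ≤ d + 1 ∧ B.card ≤ d + 1 ∧
      (∀ x ∈ U, x ∈ sepHalfspace (A : Set (Fin d → ℝ)) (B : Set (Fin d → ℝ))) ∧
      ∀ y ∈ V, y ∉ sepHalfspace (A : Set (Fin d → ℝ)) (B : Set (Fin d → ℝ)) := by
  rcases U.eq_empty_or_nonempty with rfl | hU'
  · refine ⟨∅, ∅, by simp, by simp, by simp, by simp, by simp, ?_⟩
    simp [sepHalfspace, IsClosestPair]
  rcases V.eq_empty_or_nonempty with rfl | hV'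
  · obtain ⟨u, hu⟩ := hU'
    refine ⟨{u}, ∅, by simpa using hu, by simp, by simp, by simp, ?_, by simp⟩
    simp [sepHalfspace, IsClosestPair]
  obtain ⟨p, hp⟩ := exists_isClosestPair hU hV hU' hV'
  obtain ⟨A, hAU, hAc, hpA⟩ := exists_finset_card_le_mem_convexHull hp.1
  obtain ⟨B, hBV, hBc, hpB⟩ := exists_finset_card_le_mem_convexHull hp.2.1
  have hex : ∃ q, IsClosestPair (A : Set (Fin d → ℝ)) (B : Set (Fin d → ℝ)) q :=
    ⟨p, hpA, hpB, fun a ha b hb => hp.2.2 a (convexHull_mono hAU ha) b (convexHull_mono hBV hb)⟩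
  -- whichever closest pair of the small hulls is chosen, it is one of the large hulls
  have hq : IsClosestPair U V hex.choose := by
    have h := hex.choose_spec
    exact ⟨convexHull_mono hAU h.1, convexHull_mono hBV h.2.1, fun a ha b hb =>
      (h.2.2 p.1 hpA p.2 hpB).trans (hp.2.2 a ha b hb)⟩
  refine ⟨A, B, hAU, hBV, hAc, hBc, fun x hx => ?_, fun y hy => ?_⟩
  · rw [sepHalfspace, dif_pos hex, Set.mem_ofPred_eq]
    have h1 := hq.le_dotProduct (subset_convexHull ℝ U hx)
    have hne : hex.choose.1 - hex.choose.2 ≠ 0 := fun h0 => by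
      rw [sub_eq_zero] at h0
      exact Set.disjoint_left.1 hdisj hq.1 (h0 ▸ hq.2.1)
    have h2 : 0 < (hex.choose.1 - hex.choose.2) ⬝ᵥ (hex.choose.1 - hex.choose.2) :=
      lt_of_le_of_ne (sum_nonneg fun i _ => mul_self_nonneg _)
        (fun h0 => hne (dotProduct_self_eq_zero.1 h0.symm))
    rw [sub_dotProduct] at h2
    linarith
  · rw [sepHalfspace, dif_pos hex, Set.mem_ofPred_eq, not_lt]
    exact hq.dotProduct_le (subset_convexHull ℝ V hy)

theorem exists_finset_image_eq {ι E : Type*} {p : ι → E} {S : Set ι} {A : Finset E}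
    (hA : ↑A ⊆ p '' S) : ∃ I : Finset ι, ↑I ⊆ S ∧ I.card ≤ A.card ∧ p '' I = A := by
  classical
  choose g hg hg' using fun a : A => hA a.2
  refine ⟨univ.image g, ?_, card_image_le.trans (by simp), ?_⟩
  · intro x hx
    simp only [coe_image, coe_univ, Set.image_univ, Set.mem_range] at hx
    obtain ⟨a, rfl⟩ := hx
    exact hg a
  · ext a
    simp only [coe_image, coe_univ, Set.image_univ, Set.mem_image, Set.mem_range,
      exists_exists_eq_and, hg', SetLike.mem_coe]
    exact ⟨fun ⟨b, hb⟩ => hb ▸ b.2, fun h => ⟨⟨a, h⟩, rfl⟩⟩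

theorem exists_sepHalfspace_image {ι κ : Type*} {p : ι → Fin d → ℝ} {p' : κ → Fin d → ℝ}
    {S : Set ι} {S' : Set κ} (hS : S.Finite) (hS' : S'.Finite)
    (hdisj : Disjoint (convexHull ℝ (p '' S)) (convexHull ℝ (p' '' S'))) :
    ∃ (I : Finset ι) (I' : Finset κ), ↑I ⊆ S ∧ ↑I' ⊆ S' ∧ I.card ≤ d + 1 ∧ I'.card ≤ d + 1 ∧
      (∀ j ∈ S, p j ∈ sepHalfspace (p '' I) (p' '' I')) ∧
      ∀ j ∈ S', p' j ∉ sepHalfspace (p '' I) (p' '' I') := by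
  obtain ⟨A, B, hA, hB, hAc, hBc, h1, h2⟩ :=
    exists_sepHalfspace (hS.image p) (hS'.image p') hdisj
  obtain ⟨I, hI, hIc, hIA⟩ := exists_finset_image_eq hA
  obtain ⟨I', hI', hIc', hIB⟩ := exists_finset_image_eq hB
  rw [← hIA, ← hIB] at h1 h2
  exact ⟨I, I', hI, hI', hIc.trans hAc, hIc'.trans hBc,
    fun j hj => h1 _ (Set.mem_image_of_mem p hj), fun j hj => h2 _ (Set.mem_image_of_mem p' hj)⟩

end Geometry

/-! ### Decay of the bad points -/

section Decay

variable {m e : ℕ}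

/-- At least two entries of the tuple `q` lie in `B`. -/
def HitsTwice (B : Finset (Fin m)) (q : Fin e → Fin m) : Prop :=
  ∃ s s', s ≠ s' ∧ q s ∈ B ∧ q s' ∈ B

instance (B : Finset (Fin m)) (q : Fin e → Fin m) : Decidable (HitsTwice B q) :=
  inferInstanceAs (Decidable (∃ s s', s ≠ s' ∧ q s ∈ B ∧ q s' ∈ B))

/-- The points of the next level that may be bad if `B` contains the bad ones of this level and
point `j` of the next one is the Radon point of the points `r j s`. -/
def nextBad (B : Finset (Fin m)) (r : Fin m → Fin e → Fin m) : Finset (Fin m) :=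
  univ.filter fun j => HitsTwice B (r j)

/-- The points that may be bad after `J` rounds. -/
def badAfter : (J : ℕ) → (Fin J → Fin m → Fin e → Fin m) → Finset (Fin m) → Finset (Fin m)
  | 0, _, B => B
  | J + 1, ω, B => badAfter J (Fin.tail ω) (nextBad B (ω 0))

theorem nextBad_empty (r : Fin m → Fin e → Fin m) : nextBad ∅ r = ∅ := by
  simp [nextBad, HitsTwice]

theorem badAfter_empty (J : ℕ) (ω : Fin J → Fin m → Fin e → Fin m) : badAfter J ω ∅ = ∅ := by
  induction J with
  | zero => rfl
  | succ J ih => rw [badAfter, nextBad_empty, ih]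

theorem card_two_hits (B : Finset (Fin m)) {s s' : Fin e} (h : s ≠ s') :
    #{q : Fin e → Fin m | q s ∈ B ∧ q s' ∈ B} * m ^ 2 = #B ^ 2 * m ^ e := by
  have hset : ({q : Fin e → Fin m | q s ∈ B ∧ q s' ∈ B} : Finset _) =
      Fintype.piFinset fun t => if t = s ∨ t = s' then B else univ := by
    ext q
    simp only [mem_filter, mem_univ, true_and, Fintype.mem_piFinset]
    constructor
    · rintro ⟨h1, h2⟩ t
      split_ifs with ht
      · rcases ht with rfl | rfl <;> assumption
      · exact mem_univ _
    · intro hq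
      exact ⟨by simpa using hq s, by simpa using hq s'⟩
  have hs' : s' ∈ univ.erase s := mem_erase.2 ⟨h.symm, mem_univ _⟩
  have hpow : m ^ e = m * (m * ∏ _t ∈ (univ.erase s).erase s', m) := by
    rw [mul_prod_erase _ (fun _ => m) hs', mul_prod_erase _ (fun _ => m) (mem_univ s)]
    simp
  rw [hset, Fintype.card_piFinset, hpow, ← mul_prod_erase _ _ (mem_univ s),
    ← mul_prod_erase _ _ hs']
  have : ∏ t ∈ (univ.erase s).erase s', #(if t = s ∨ t = s' then B else univ) =
      ∏ _t ∈ (univ.erase s).erase s', m := prod_congr rfl fun t ht => by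
    simp only [mem_erase] at ht
    simp [ht.1, ht.2.1]
  rw [this]
  simp
  ring

theorem card_hitsTwice_le (B : Finset (Fin m)) :
    #{q : Fin e → Fin m | HitsTwice B q} * m ^ 2 ≤ e ^ 2 * #B ^ 2 * m ^ e := by
  have hsub : ({q : Fin e → Fin m | HitsTwice B q} : Finset _) ⊆
      ({p : Fin e × Fin e | p.1 ≠ p.2} : Finset _).biUnion fun p =>
        {q : Fin e → Fin m | q p.1 ∈ B ∧ q p.2 ∈ B} := by
    intro q hq
    obtain ⟨s, s', h, h1, h2⟩ := (mem_filter.1 hq).2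
    exact mem_biUnion.2 ⟨(s, s'), by simpa using h, by simpa using ⟨h1, h2⟩⟩
  calc _ ≤ (∑ p ∈ ({p : Fin e × Fin e | p.1 ≠ p.2} : Finset _),
        #{q : Fin e → Fin m | q p.1 ∈ B ∧ q p.2 ∈ B}) * m ^ 2 :=
        Nat.mul_le_mul_right _ ((card_le_card hsub).trans card_biUnion_le)
    _ = ∑ p ∈ ({p : Fin e × Fin e | p.1 ≠ p.2} : Finset _), #B ^ 2 * m ^ e := by
        rw [sum_mul]
        exact sum_congr rfl fun p hp => card_two_hits B (mem_filter.1 hp).2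
    _ ≤ ∑ _p : Fin e × Fin e, #B ^ 2 * m ^ e := sum_le_sum_of_subset (subset_univ _)
    _ = _ := by simp; ring

theorem sum_two_pow_card_nextBad (B : Finset (Fin m)) :
    ∑ r : Fin m → Fin e → Fin m, (2 : ℝ) ^ #(nextBad B r) =
      ((m : ℝ) ^ e + #{q : Fin e → Fin m | HitsTwice B q}) ^ m := by
  have h1 : ∑ q : Fin e → Fin m, (if HitsTwice B q then (2 : ℝ) else 1) =
      (m : ℝ) ^ e + #{q : Fin e → Fin m | HitsTwice B q} := by
    have : ∀ q : Fin e → Fin m, (if HitsTwice B q then (2 : ℝ) else 1) =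
        1 + if HitsTwice B q then (1 : ℝ) else 0 := fun q => by split_ifs <;> norm_num
    simp only [this, sum_add_distrib]
    simp
  rw [← h1, Fintype.sum_pow]
  refine sum_congr rfl fun r _ => ?_
  rw [prod_ite, prod_const, prod_const_one, mul_one]
  rfl

theorem five_quarters_pow_le (x : ℕ) : (5 / 4 : ℝ) ^ x ≤ 1 + 2 ^ x / 4 := by
  induction x with
  | zero => norm_num
  | succ x ih =>
    rcases Nat.eq_zero_or_pos x with rfl | hx
    · norm_num
    have h2 : (2 : ℝ) ≤ 2 ^ x := le_self_pow₀ (by norm_num) hx.ne'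
    rw [pow_succ, pow_succ]
    linarith

theorem exp_div_eight_le (x : ℕ) : Real.exp (x / 8) ≤ (5 / 4 : ℝ) ^ x := by
  have h1 : Real.exp (1 / 8) ≤ 5 / 4 := by
    refine (pow_le_pow_iff_left₀ (Real.exp_pos _).le (by norm_num) (show 8 ≠ 0 by norm_num)).1 ?_
    rw [← Real.exp_nat_mul]
    norm_num
    linarith [Real.exp_one_lt_d9]
  calc Real.exp (x / 8) = Real.exp (1 / 8) ^ x := by rw [← Real.exp_nat_mul]; ring_nf
    _ ≤ _ := pow_le_pow_left₀ (Real.exp_pos _).le h1 _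

/-- As long as the bad set is small, the potential `2 ^ #B`, counted as `0` if `B` is empty, is
halved on average in a round. -/
theorem sum_potential_le {X : ℕ} (hm : 0 < m) (hX : e ^ 2 * (8 * X) ≤ m) {B : Finset (Fin m)}
    (hB : #B ≤ X) :
    ∑ r : Fin m → Fin e → Fin m, (if (nextBad B r).Nonempty then (2 : ℝ) ^ #(nextBad B r) else 0) ≤
      ((m : ℝ) ^ e) ^ m * (2 ^ #B / 2) := by
  set x := #B
  set b := #{q : Fin e → Fin m | HitsTwice B q} with hb
  have hm' : (0 : ℝ) < m := by exact_mod_cast hm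
  have hN : (0 : ℝ) < ((m : ℝ) ^ e) ^ m := by positivity
  have h1 : ∑ r : Fin m → Fin e → Fin m, (2 : ℝ) ^ #(nextBad B r) ≤
      ((m : ℝ) ^ e) ^ m * (5 / 4) ^ x := by
    rw [sum_two_pow_card_nextBad, ← hb]
    have h2 : (m : ℝ) * (b / (m : ℝ) ^ e) ≤ x / 8 := by
      have h3 : (b : ℝ) * m ^ 2 ≤ e ^ 2 * x ^ 2 * m ^ e := by exact_mod_cast card_hitsTwice_le B
      have h4 : (e : ℝ) ^ 2 * (8 * X) ≤ m := by exact_mod_cast hX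
      have h5 : (x : ℝ) ≤ X := by exact_mod_cast hB
      have h6 : (e : ℝ) ^ 2 * x ^ 2 ≤ x / 8 * m := by
        have : (e : ℝ) ^ 2 * (8 * x) ≤ m := le_trans (by gcongr) h4
        nlinarith [Nat.cast_nonneg (α := ℝ) x]
      have h7 : (b : ℝ) * m * m ≤ x / 8 * m ^ e * m := by nlinarith [pow_pos hm' e]
      rw [mul_div_assoc', div_le_iff₀ (by positivity)]
      linarith [le_of_mul_le_mul_right h7 hm']
    calc ((m : ℝ) ^ e + b) ^ m = ((m : ℝ) ^ e) ^ m * (1 + b / (m : ℝ) ^ e) ^ m := by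
          rw [← mul_pow, mul_add, mul_one, mul_div_cancel₀ _ (by positivity)]
      _ ≤ ((m : ℝ) ^ e) ^ m * Real.exp (b / (m : ℝ) ^ e) ^ m := by
          gcongr
          linarith [Real.add_one_le_exp ((b : ℝ) / (m : ℝ) ^ e)]
      _ ≤ ((m : ℝ) ^ e) ^ m * Real.exp (x / 8) := by
          rw [← Real.exp_nat_mul]
          gcongr
      _ ≤ _ := by gcongr; exact exp_div_eight_le x
  calc _ ≤ ∑ r : Fin m → Fin e → Fin m, 2 * ((2 : ℝ) ^ #(nextBad B r) - 1) := by
        refine sum_le_sum fun r _ => ?_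
        split_ifs with h
        · have : (2 : ℝ) ≤ 2 ^ #(nextBad B r) := le_self_pow₀ (by norm_num) (card_pos.2 h).ne'
          linarith
        · rw [not_nonempty_iff_eq_empty.1 h]; simp
    _ = 2 * (∑ r : Fin m → Fin e → Fin m, (2 : ℝ) ^ #(nextBad B r) - ((m : ℝ) ^ e) ^ m) := by
        rw [← mul_sum, sum_sub_distrib]; simp
    _ ≤ 2 * (((m : ℝ) ^ e) ^ m * (5 / 4) ^ x - ((m : ℝ) ^ e) ^ m) := by linarith
    _ ≤ _ := by
        have := five_quarters_pow_le x
        nlinarith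

theorem sum_fin_succ_arrow {α : Type*} [Fintype α] {J : ℕ} (g : (Fin (J + 1) → α) → ℝ) :
    ∑ ω, g ω = ∑ a, ∑ ω : Fin J → α, g (Fin.cons a ω) := by
  rw [← Equiv.sum_comp (Fin.consEquiv fun _ : Fin (J + 1) => α) g, Fintype.sum_prod_type]
  rfl

/-- The number of choices for which bad points survive `J` rounds: the potential `2 ^ #B` is halved
`J` times, unless it exceeds `2 ^ X` at some time. -/
theorem card_badAfter_nonempty_le {X : ℕ} (hm : 0 < m) (hX : e ^ 2 * (8 * X) ≤ m) (J : ℕ)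
    (B : Finset (Fin m)) :
    ∑ ω : Fin J → Fin m → Fin e → Fin m, (if (badAfter J ω B).Nonempty then (1 : ℝ) else 0) ≤
      ((1 / 2) ^ J + (1 / 2) ^ X) * 2 ^ #B * (((m : ℝ) ^ e) ^ m) ^ J := by
  have hN : (0 : ℝ) < ((m : ℝ) ^ e) ^ m := by positivity
  induction J generalizing B with
  | zero =>
    have h1 : (1 : ℝ) ≤ 2 ^ #B := one_le_pow₀ (by norm_num)
    have h2 : (0 : ℝ) ≤ (1 / 2) ^ X := by positivity
    calc _ ≤ ∑ ω : Fin 0 → Fin m → Fin e → Fin m, (1 : ℝ) :=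
          sum_le_sum fun _ _ => by split_ifs <;> norm_num
      _ = 1 := by simp
      _ ≤ _ := by rw [pow_zero, pow_zero]; nlinarith
  | succ J ih =>
    rcases lt_or_ge X #B with hB | hB
    · calc _ ≤ ∑ ω : Fin (J + 1) → Fin m → Fin e → Fin m, (1 : ℝ) :=
            sum_le_sum fun _ _ => by split_ifs <;> norm_num
        _ = (((m : ℝ) ^ e) ^ m) ^ (J + 1) := by simp
        _ ≤ _ := by
            refine le_mul_of_one_le_left (by positivity) ?_
            have h1 : (1 : ℝ) ≤ (1 / 2) ^ X * 2 ^ #B := by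
              rw [one_div, inv_pow, ← div_eq_inv_mul, one_le_div (by positivity)]
              exact pow_le_pow_right₀ (by norm_num) hB.le
            have h2 : (0 : ℝ) ≤ (1 / 2) ^ (J + 1) * 2 ^ #B := by positivity
            linarith
    · rw [sum_fin_succ_arrow]
      have hstep : ∀ r : Fin m → Fin e → Fin m, ∑ ω : Fin J → Fin m → Fin e → Fin m,
          (if (badAfter (J + 1) (Fin.cons r ω : Fin (J + 1) → Fin m → Fin e → Fin m) B).Nonempty
            then (1 : ℝ) else 0) ≤
          ((1 / 2) ^ J + (1 / 2) ^ X) * (((m : ℝ) ^ e) ^ m) ^ J *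
            (if (nextBad B r).Nonempty then (2 : ℝ) ^ #(nextBad B r) else 0) := by
        intro r
        simp only [badAfter, Fin.tail_cons, Fin.cons_zero]
        split_ifs with h
        · refine (ih _).trans (le_of_eq (by ring))
        · rw [not_nonempty_iff_eq_empty.1 h]
          simp [badAfter_empty]
      refine (sum_le_sum fun r _ => hstep r).trans ?_
      rw [← mul_sum]
      refine (mul_le_mul_of_nonneg_left (sum_potential_le hm hX hB) (by positivity)).trans ?_
      have h2 : (0 : ℝ) ≤ (1 / 2) ^ X := by positivity
      have h3 : (0 : ℝ) ≤ (((m : ℝ) ^ e) ^ m) ^ J * ((m : ℝ) ^ e) ^ m * 2 ^ #B := by positivity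
      rw [pow_succ (1 / 2 : ℝ) J, pow_succ (((m : ℝ) ^ e) ^ m) J]
      nlinarith [mul_nonneg h2 h3]

end Decay

/-! ### Samples and colorings -/

section Sampling

/-- Points of color `i` and points of other colors, prescribed in disjoint places. -/
theorem card_coloring_le {n k : ℕ} (hk : 0 < k) (i : Fin k) (I H : Finset (Fin n)) :
    (#{χ : Fin n → Fin k | (∀ a ∈ I, χ a = i) ∧ ∀ a ∈ H, χ a ≠ i} : ℝ) ≤
      (k : ℝ) ^ n * ((1 / k : ℝ) ^ #I * (1 - 1 / k) ^ #H) := by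
  have hk' : (1 : ℝ) ≤ k := by exact_mod_cast hk
  have h0 : (0 : ℝ) ≤ 1 - 1 / k := by
    rw [sub_nonneg, div_le_one (by linarith)]; exact hk'
  by_cases hIH : Disjoint I H
  · have hset : ({χ : Fin n → Fin k | (∀ a ∈ I, χ a = i) ∧ ∀ a ∈ H, χ a ≠ i} : Finset _) ⊆
        Fintype.piFinset fun a => if a ∈ I then {i} else if a ∈ H then univ.erase i else univ := by
      intro χ hχ
      obtain ⟨h1, h2⟩ := (mem_filter.1 hχ).2
      refine Fintype.mem_piFinset.2 fun a => ?_
      split_ifs with ha ha'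
      · simpa using h1 a ha
      · simpa using h2 a ha'
      · exact mem_univ _
    calc _ ≤ ((#(Fintype.piFinset fun a => if a ∈ I then {i} else
          if a ∈ H then univ.erase i else univ) : ℕ) : ℝ) := by exact_mod_cast card_le_card hset
      _ = ∏ a : Fin n, ((k : ℝ) * ((if a ∈ I then (1 / k : ℝ) else 1) *
            if a ∈ H then (1 - 1 / k : ℝ) else 1)) := by
          rw [Fintype.card_piFinset, Nat.cast_prod]
          refine prod_congr rfl fun a _ => ?_
          by_cases ha : a ∈ I
          · have ha' : a ∉ H := disjoint_left.1 hIH ha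
            simp [ha, ha']
            field_simp
          · by_cases ha' : a ∈ H
            · simp [ha, ha', Nat.cast_sub hk]
              field_simp
            · simp [ha, ha']
      _ = _ := by
          rw [prod_mul_distrib, prod_mul_distrib]
          simp
  · obtain ⟨a, ha, ha'⟩ := not_disjoint_iff.1 hIH
    have : ({χ : Fin n → Fin k | (∀ a ∈ I, χ a = i) ∧ ∀ a ∈ H, χ a ≠ i} : Finset _) = ∅ :=
      filter_eq_empty_iff.2 fun χ _ h => h.2 a ha' (h.1 a ha)
    rw [this]
    simp only [card_empty, Nat.cast_zero]
    positivity

/-- A Chernoff bound, from the mean of `2 ^ N` for the number `N` of sample points in `H`. -/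
theorem card_sample_le {ι : Type*} [Fintype ι] [DecidableEq ι] {n : ℕ} (H : Finset (Fin n))
    (y : ℕ) :
    (#{v : ι → Fin n | y ≤ #{j | v j ∈ H}} : ℝ) * 2 ^ y ≤ ((n : ℝ) + #H) ^ Fintype.card ι := by
  have h1 : ∑ a : Fin n, (if a ∈ H then (2 : ℝ) else 1) = n + #H := by
    have : ∀ a : Fin n, (if a ∈ H then (2 : ℝ) else 1) = 1 + if a ∈ H then (1 : ℝ) else 0 :=
      fun a => by split_ifs <;> norm_num
    simp only [this, sum_add_distrib]
    simp
  have h2 : ∑ v : ι → Fin n, (2 : ℝ) ^ #{j | v j ∈ H} = ((n : ℝ) + #H) ^ Fintype.card ι := by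
    rw [← h1, ← card_univ, ← prod_const, prod_univ_sum, Fintype.piFinset_univ]
    refine sum_congr rfl fun v _ => ?_
    rw [prod_ite]
    simp
  rw [← h2, card_filter, Nat.cast_sum, sum_mul]
  refine sum_le_sum fun v _ => ?_
  split_ifs with h
  · simpa using pow_le_pow_right₀ (by norm_num : (1 : ℝ) ≤ 2) h
  · simp

theorem sum_pow_card_le {n t : ℕ} {z : ℝ} (hz : 0 ≤ z) :
    ∑ T : Finset (Fin n) with #T ≤ t, z ^ #T ≤ (1 + n * z) ^ t := by
  have h1 : ∀ T ∈ ({T : Finset (Fin n) | #T ≤ t} : Finset (Finset (Fin n))),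
      #T ∈ range (t + 1) := by
    intro T hT
    have := (mem_filter.1 hT).2
    exact mem_range.2 (by omega)
  rw [← sum_fiberwise_of_maps_to h1, add_comm (1 : ℝ), add_pow]
  refine sum_le_sum fun s hs => ?_
  have hst : s ≤ t := Nat.lt_succ_iff.1 (mem_range.1 hs)
  have h2 : ({T ∈ ({T : Finset (Fin n) | #T ≤ t} : Finset _) | #T = s} : Finset _) =
      powersetCard s univ := by
    ext T
    simp only [mem_filter, mem_univ, true_and, mem_powersetCard, subset_univ]
    exact ⟨fun h => h.2, fun h => ⟨h ▸ hst, h⟩⟩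
  rw [h2, sum_congr rfl fun T hT => by rw [(mem_powersetCard.1 hT).2], sum_const, card_powersetCard,
    card_univ, Fintype.card_fin, nsmul_eq_mul, one_pow, mul_one, mul_pow]
  have h3 : ((n.choose s : ℕ) : ℝ) ≤ (n : ℝ) ^ s := by exact_mod_cast Nat.choose_le_pow n s
  have h4 : (1 : ℝ) ≤ (t.choose s : ℕ) := by exact_mod_cast Nat.choose_pos hst
  calc (n.choose s : ℝ) * z ^ s ≤ (n : ℝ) ^ s * z ^ s := by gcongr
    _ ≤ _ := le_mul_of_one_le_right (by positivity) h4

/-- For a set `H` of points that is determined by the sample points with indices in `I`: the event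
that the sample hits `H` often and that color `i` occurs on all of `I'` but not on `H`. Since the
sample and the coloring are independent, and either `H` is so large that the coloring is
unlikely or so small that the sample is, the event has probability at most `δ / k ^ #I'`. -/
theorem sum_event_le {m n k x : ℕ} (hk : 0 < k) (i : Fin k) (I : Finset (Fin m))
    (I' : Finset (Fin n)) (H : (Fin m → Fin n) → Finset (Fin n))
    (hH : ∀ r r', (∀ j ∈ I, r j = r' j) → H r = H r') {δ : ℝ} (hδ : 0 ≤ δ)
    (hcase : ∀ K : Finset (Fin n), (1 - 1 / k : ℝ) ^ #K ≤ δ ∨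
      ((n : ℝ) + #K) ^ (m - #I) ≤ δ * n ^ (m - #I) * 2 ^ (x - #I)) :
    ∑ r : Fin m → Fin n, ∑ χ : Fin n → Fin k,
      (if (∀ a ∈ I', χ a = i) ∧ (∀ a ∈ H r, χ a ≠ i) ∧ x ≤ #{j | r j ∈ H r} then (1 : ℝ) else 0) ≤
      (n : ℝ) ^ m * k ^ n * ((1 / k : ℝ) ^ #I' * δ) := by
  classical
  have hk' : (1 : ℝ) ≤ k := by exact_mod_cast hk
  have hq0 : (0 : ℝ) ≤ 1 - 1 / k := by
    rw [sub_nonneg, div_le_one (by linarith)]; exact hk'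
  have hq1 : (1 - 1 / k : ℝ) ≤ 1 := by
    have : (0 : ℝ) ≤ 1 / k := by positivity
    linarith
  have hcI : Fintype.card {j // j ∈ I} = #I := by simp
  have hcI' : Fintype.card {j // ¬ j ∈ I} = m - #I := by
    rw [Fintype.card_subtype_compl]; simp
  have hIm : #I ≤ m := by simpa using card_le_univ I
  rcases isEmpty_or_nonempty (Fin m → Fin n) with he | he
  · simp only [univ_eq_empty, sum_empty]; positivity
  obtain ⟨r₀⟩ := he
  let E := Equiv.piEquivPiSubtypeProd (fun j => j ∈ I) fun _ : Fin m => Fin n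
  rw [← Equiv.sum_comp E.symm, Fintype.sum_prod_type]
  have hE : ∀ u v j, E.symm (u, v) j = if h : j ∈ I then u ⟨j, h⟩ else v ⟨j, h⟩ := fun _ _ _ => rfl
  have hinner : ∀ u : {j // j ∈ I} → Fin n, ∑ v : {j // ¬ j ∈ I} → Fin n, ∑ χ : Fin n → Fin k,
      (if (∀ a ∈ I', χ a = i) ∧ (∀ a ∈ H (E.symm (u, v)), χ a ≠ i) ∧
        x ≤ #{j | E.symm (u, v) j ∈ H (E.symm (u, v))} then (1 : ℝ) else 0) ≤
      (n : ℝ) ^ (m - #I) * k ^ n * ((1 / k : ℝ) ^ #I' * δ) := by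
    intro u
    -- the set `H` is now fixed
    set K := H (E.symm (u, fun j => r₀ j)) with hK
    have hHK : ∀ v, H (E.symm (u, v)) = K := fun v => hH _ _ fun j hj => by
      rw [hE, hE, dif_pos hj, dif_pos hj]
    have hcount : ∀ v, #{j | E.symm (u, v) j ∈ K} ≤ #I + #{j | v j ∈ K} := by
      intro v
      have : ({j | E.symm (u, v) j ∈ K} : Finset (Fin m)) ⊆
          I ∪ ({j | v j ∈ K} : Finset {j // ¬ j ∈ I}).map (Function.Embedding.subtype _) := by
        intro j hj
        by_cases hjI : j ∈ I
        · exact mem_union_left _ hjI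
        · refine mem_union_right _ (mem_map.2 ⟨⟨j, hjI⟩, ?_, rfl⟩)
          simpa [hE, hjI] using hj
      exact (card_le_card this).trans ((card_union_le _ _).trans (by rw [card_map]))
    have hprod : ∑ v : {j // ¬ j ∈ I} → Fin n, ∑ χ : Fin n → Fin k,
        (if (∀ a ∈ I', χ a = i) ∧ (∀ a ∈ H (E.symm (u, v)), χ a ≠ i) ∧
          x ≤ #{j | E.symm (u, v) j ∈ H (E.symm (u, v))} then (1 : ℝ) else 0) ≤
        #{v : {j // ¬ j ∈ I} → Fin n | x - #I ≤ #{j | v j ∈ K}} *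
          #{χ : Fin n → Fin k | (∀ a ∈ I', χ a = i) ∧ ∀ a ∈ K, χ a ≠ i} := by
      rw [natCast_card_filter, natCast_card_filter, sum_mul_sum]
      refine sum_le_sum fun v _ => sum_le_sum fun χ _ => ?_
      rw [hHK v]
      have := hcount v
      by_cases h1 : (∀ a ∈ I', χ a = i) ∧ (∀ a ∈ K, χ a ≠ i) ∧ x ≤ #{j | E.symm (u, v) j ∈ K}
      · rw [if_pos h1, if_pos (by omega), if_pos ⟨h1.1, h1.2.1⟩, one_mul]
      · rw [if_neg h1]
        positivity
    refine hprod.trans ?_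
    have hχ := card_coloring_le hk i I' K
    have hv := card_sample_le (ι := {j // ¬ j ∈ I}) K (x - #I)
    rw [hcI'] at hv
    have hv' : (#{v : {j // ¬ j ∈ I} → Fin n | x - #I ≤ #{j | v j ∈ K}} : ℝ) ≤ n ^ (m - #I) := by
      have := card_filter_le (univ : Finset ({j // ¬ j ∈ I} → Fin n))
        fun v => x - #I ≤ #{j | v j ∈ K}
      rw [card_univ, Fintype.card_fun, hcI', Fintype.card_fin] at this
      exact_mod_cast this
    rcases hcase K with h | h
    · calc _ ≤ (n : ℝ) ^ (m - #I) * (k ^ n * ((1 / k : ℝ) ^ #I' * (1 - 1 / k) ^ #K)) := by gcongr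
        _ ≤ (n : ℝ) ^ (m - #I) * (k ^ n * ((1 / k : ℝ) ^ #I' * δ)) := by gcongr
        _ = _ := by ring
    · have h2 : (#{v : {j // ¬ j ∈ I} → Fin n | x - #I ≤ #{j | v j ∈ K}} : ℝ) ≤
          δ * n ^ (m - #I) := le_of_mul_le_mul_right (hv.trans h) (by positivity)
      calc _ ≤ (δ * n ^ (m - #I)) * (k ^ n * ((1 / k : ℝ) ^ #I' * 1)) := by
            refine mul_le_mul h2 (hχ.trans ?_) (by positivity) (by positivity)
            gcongr
            exact pow_le_one₀ hq0 hq1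
        _ = _ := by ring
  calc _ ≤ ∑ _u : {j // j ∈ I} → Fin n, (n : ℝ) ^ (m - #I) * k ^ n * ((1 / k : ℝ) ^ #I' * δ) :=
        sum_le_sum fun u _ => hinner u
    _ = ((n : ℝ) ^ #I * n ^ (m - #I)) * k ^ n * ((1 / k : ℝ) ^ #I' * δ) := by
        rw [sum_const, card_univ, Fintype.card_fun, hcI, Fintype.card_fin, nsmul_eq_mul]
        push_cast
        ring
    _ = _ := by rw [← pow_add, Nat.add_sub_cancel' hIm]

end Sampling

/-! ### The output is a Tverberg point unless a bad event occurs -/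

namespace RealRAM

variable {n d : ℕ} {P : Fin n → Fin d → ℝ}

theorem IsRadonSequence.last_coord {m B : ℕ} {R idx : ℕ → ℕ} {pts : ℕ → ℕ → ℝ}
    (h : IsRadonSequence P m B R idx pts) (hidx : ∀ i < B * (d + 2), idx i < m) (g : ℕ)
    (hg : g < m + B) : pts g d = 1 := by
  induction g using Nat.strong_induction_on with
  | _ g ih =>
    rcases lt_or_ge g m with h1 | h1
    · exact (h.first g h1).2
    obtain ⟨b, rfl⟩ := Nat.exists_eq_add_of_le h1
    have hb : b < B := by omega
    refine ((h.radon b hb).mem (fun s hs => ?_) convex_univ (by simp)).2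
    have h2 := Nat.div_mul_le_self b m
    have h3 := hidx (b * (d + 2) + s) (by nlinarith)
    exact ih _ (by omega) (by omega)

/-- If `B` contains the points of level `a` outside the convex set `G`, then `badAfter` contains
those of level `a + J'`. -/
theorem IsRadonSequence.mem_badAfter {m J : ℕ} {R idx : ℕ → ℕ} {pts : ℕ → ℕ → ℝ}
    (h : IsRadonSequence P m (J * m) R idx pts) (hidx : ∀ i < J * m * (d + 2), idx i < m)
    {G : Set (Fin d → ℝ)} (hG : Convex ℝ G) (J' a : ℕ) (haJ : a + J' ≤ J)
    (ω : Fin J' → Fin m → Fin (d + 2) → Fin m)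
    (hω : ∀ (t : Fin J') (j : Fin m) (s : Fin (d + 2)),
      idx (((a + t) * m + j) * (d + 2) + s) = ω t j s)
    (B : Finset (Fin m)) (hB : ∀ j : Fin m, (fun c : Fin d => pts (a * m + j) c) ∉ G → j ∈ B)
    (j : Fin m) (hj : (fun c : Fin d => pts ((a + J') * m + j) c) ∉ G) :
    j ∈ badAfter J' ω B := by
  induction J' generalizing a B with
  | zero => exact hB j hj
  | succ J' ih =>
    refine ih (a + 1) (by omega) (Fin.tail ω) (fun t j s => ?_) _ (fun j hj => ?_) ?_
    · have := hω t.succ j s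
      rw [Fin.val_succ, show a + (↑t + 1) = a + 1 + ↑t by ring] at this
      exact this
    · refine mem_filter.2 ⟨mem_univ _, ?_⟩
      by_contra hno
      have hlt : a * m + j < J * m := by
        have := j.2
        nlinarith
      have hdiv : (a * m + j) / m = a := by
        rw [Nat.add_div_of_dvd_right (Dvd.intro_left a rfl), Nat.mul_div_cancel _ j.pos,
          Nat.div_eq_of_lt j.2, add_zero]
      have hrad := h.radon _ hlt
      rw [hdiv, show m + (a * m + j) = (a + 1) * m + j by ring] at hrad
      have hw : ∀ s : Fin (d + 2), idx ((a * m + j) * (d + 2) + s) = ω 0 j s := fun s => by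
        simpa using hω 0 j s
      refine hj (hrad.mem (fun s hs => ?_) hG fun s hs s' hs' h1 h2 => ?_).1
      · refine h.last_coord hidx _ ?_
        rw [hw ⟨s, hs⟩]
        have := (ω 0 j ⟨s, hs⟩).2
        nlinarith
      · by_contra hne
        rw [hw ⟨s, hs⟩] at h1
        rw [hw ⟨s', hs'⟩] at h2
        exact hno ⟨⟨s, hs⟩, ⟨s', hs'⟩, by simpa using hne, hB _ h1, hB _ h2⟩
    · rw [show a + 1 + J' = a + (J' + 1) by ring]
      exact hj

end RealRAM

section Events

variable {n d m : ℕ}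

open Classical in
/-- The sample points in the halfspace that the sample points with indices in `I` and `I'`
determine. -/
noncomputable def sampleCut (P : Fin n → Fin d → ℝ) (r : Fin m → Fin n) (I I' : Finset (Fin m)) :
    Finset (Fin m) :=
  {j | P (r j) ∈ sepHalfspace ((fun j => P (r j)) '' I) ((fun j => P (r j)) '' I')}

open Classical in
/-- The points in the halfspace that the sample points with indices in `I` and the points with
indices in `I'` determine. -/
noncomputable def pointCut (P : Fin n → Fin d → ℝ) (r : Fin m → Fin n) (I : Finset (Fin m))
    (I' : Finset (Fin n)) : Finset (Fin n) :=
  {a | P a ∈ sepHalfspace ((fun j => P (r j)) '' I) (P '' I')}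

/-- Either some halfspace with many sample points misses a color, or the bad points that start from
the sample points in some halfspace with few of them have survived all rounds. -/
theorem exists_event {k J x : ℕ} (P : Fin n → Fin d → ℝ) (χ : Fin n → Fin k) (r : Fin m → Fin n)
    (ω : Fin J → Fin m → Fin (d + 2) → Fin m) (q : Fin d → ℝ)
    (hq : ∀ G : Set (Fin d → ℝ), Convex ℝ G → ∀ B : Finset (Fin m),
      (∀ j, P (r j) ∉ G → j ∈ B) → q ∉ G → (badAfter J ω B).Nonempty)
    (hbad : ¬ IsTverbergPoint P χ q) :
    (∃ i : Fin k, ∃ I : Finset (Fin m), ∃ I' : Finset (Fin n), #I ≤ d + 1 ∧ #I' ≤ d + 1 ∧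
      (∀ a ∈ I', χ a = i) ∧ (∀ a ∈ pointCut P r I I', χ a ≠ i) ∧
      x ≤ #{j | r j ∈ pointCut P r I I'}) ∨
    ∃ I I' : Finset (Fin m), #I ≤ d + 1 ∧ #I' ≤ d + 1 ∧ #(sampleCut P r I I') ≤ x ∧
      (badAfter J ω (sampleCut P r I I')).Nonempty := by
  classical
  simp only [IsTverbergPoint, Set.mem_iInter, not_forall] at hbad
  obtain ⟨i, hi⟩ := hbad
  -- a halfspace around `q` that misses color `i`
  obtain ⟨h, hconv, hconv', hqh, hih⟩ : ∃ h : Set (Fin d → ℝ), Convex ℝ h ∧ Convex ℝ hᶜ ∧ q ∈ h ∧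
      ∀ a, χ a = i → P a ∉ h := by
    obtain ⟨A, B, -, -, -, -, h1, h2⟩ := exists_sepHalfspace (U := {q}) (V := colorClass P χ i)
      (Set.finite_singleton q) ((Set.toFinite _).image P) (by simpa using hi)
    exact ⟨_, convex_sepHalfspace _ _, convex_compl_sepHalfspace _ _, h1 q rfl,
      fun a ha => h2 _ ⟨a, ha, rfl⟩⟩
  have hdisj : ∀ U V : Set (Fin d → ℝ), U ⊆ h → V ⊆ hᶜ →
      Disjoint (convexHull ℝ U) (convexHull ℝ V) := fun U V hU hV =>
    disjoint_compl_right.mono (convexHull_min hU hconv) (convexHull_min hV hconv')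
  set S : Finset (Fin m) := {j | P (r j) ∈ h} with hS
  have hmem : ∀ j, j ∈ S ↔ P (r j) ∈ h := fun j => by simp [hS]
  rcases le_or_gt #S x with hx | hx
  · right
    obtain ⟨I, I', -, -, hI, hI', h1, h2⟩ := exists_sepHalfspace_image
      (p := fun j => P (r j)) (p' := fun j => P (r j)) (S := {j | P (r j) ∈ h})
      (S' := {j | P (r j) ∉ h}) (Set.toFinite _) (Set.toFinite _) (hdisj _ _
        (by rintro _ ⟨j, hj, rfl⟩; exact hj) (by rintro _ ⟨j, hj, rfl⟩; exact hj))
    have hcut : sampleCut P r I I' = S := by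
      ext j
      rw [hmem]
      simp only [sampleCut, mem_filter, mem_univ, true_and]
      exact ⟨fun hj => by_contra fun hc => h2 j hc hj, fun hj => h1 j hj⟩
    exact ⟨I, I', hI, hI', hcut ▸ hx, hcut ▸ hq hᶜ hconv' S
      (fun j hj => (hmem j).2 (not_not.1 hj)) (not_not.2 hqh)⟩
  · left
    obtain ⟨I, I', -, hIc, hI, hI', h1, h2⟩ := exists_sepHalfspace_image
      (p := fun j => P (r j)) (p' := P) (S := {j | P (r j) ∈ h})
      (S' := {a | χ a = i}) (Set.toFinite _) (Set.toFinite _) (hdisj _ _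
        (by rintro _ ⟨j, hj, rfl⟩; exact hj) (by rintro _ ⟨a, ha, rfl⟩; exact hih a ha))
    refine ⟨i, I, I', hI, hI', fun a ha => hIc ha, fun a ha hc => ?_, hx.le.trans ?_⟩
    · exact h2 a hc (by simpa [pointCut] using ha)
    · refine card_le_card fun j hj => ?_
      have := h1 j ((hmem j).1 hj)
      simpa [pointCut] using this

open Classical in
/-- The union bound over all colors, all halfspaces determined by few points, and all small sets of
sample points that halfspaces cut off. -/
theorem sum_bad_le {k J x X : ℕ} (P : Fin n → Fin d → ℝ) (hk : 0 < k) (hm : 0 < m)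
    (hX : (d + 2) ^ 2 * (8 * X) ≤ m) {δ : ℝ} (hδ : 0 ≤ δ)
    (hcase : ∀ (I : Finset (Fin m)) (K : Finset (Fin n)), #I ≤ d + 1 → (1 - 1 / k : ℝ) ^ #K ≤ δ ∨
      ((n : ℝ) + #K) ^ (m - #I) ≤ δ * n ^ (m - #I) * 2 ^ (x - #I))
    (q : (Fin m → Fin n) → (Fin J → Fin m → Fin (d + 2) → Fin m) → Fin d → ℝ)
    (hq : ∀ r ω, ∀ G : Set (Fin d → ℝ), Convex ℝ G → ∀ B : Finset (Fin m),
      (∀ j, P (r j) ∉ G → j ∈ B) → q r ω ∉ G → (badAfter J ω B).Nonempty) :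
    ∑ χ : Fin n → Fin k, ∑ r : Fin m → Fin n, ∑ ω : Fin J → Fin m → Fin (d + 2) → Fin m,
      (if IsTverbergPoint P χ (q r ω) then (0 : ℝ) else 1) ≤
      ((k : ℝ) ^ n * n ^ m * (((m : ℝ) ^ (d + 2)) ^ m) ^ J) *
        (k * ((1 + m) ^ (d + 1) * (1 + n * (1 / k)) ^ (d + 1) * δ) +
          (1 + m) ^ (d + 1) * (1 + m) ^ (d + 1) * (((1 / 2) ^ J + (1 / 2) ^ X) * 2 ^ x)) := by
  have hk0 : (0 : ℝ) ≤ 1 / k := by positivity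
  let E₁ : Fin k → Finset (Fin m) → Finset (Fin n) → (Fin n → Fin k) → (Fin m → Fin n) → ℝ :=
    fun i I I' χ r => if (∀ a ∈ I', χ a = i) ∧ (∀ a ∈ pointCut P r I I', χ a ≠ i) ∧
      x ≤ #{j | r j ∈ pointCut P r I I'} then 1 else 0
  let E₂ : Finset (Fin m) → Finset (Fin m) → (Fin m → Fin n) →
      (Fin J → Fin m → Fin (d + 2) → Fin m) → ℝ := fun I I' r ω =>
    if #(sampleCut P r I I') ≤ x then
      if (badAfter J ω (sampleCut P r I I')).Nonempty then 1 else 0 else 0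
  have hE₁ : ∀ i I I' χ r, 0 ≤ E₁ i I I' χ r := fun i I I' χ r => by
    simp only [E₁]; split_ifs <;> norm_num
  have hE₂ : ∀ I I' r ω, 0 ≤ E₂ I I' r ω := fun I I' r ω => by
    simp only [E₂]; split_ifs <;> norm_num
  have hpoint : ∀ χ r ω, (if IsTverbergPoint P χ (q r ω) then (0 : ℝ) else 1) ≤
      (∑ i, ∑ I : Finset (Fin m) with #I ≤ d + 1, ∑ I' : Finset (Fin n) with #I' ≤ d + 1,
        E₁ i I I' χ r) +
      ∑ I : Finset (Fin m) with #I ≤ d + 1, ∑ I' : Finset (Fin m) with #I' ≤ d + 1,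
        E₂ I I' r ω := by
    intro χ r ω
    have h1 : 0 ≤ ∑ i, ∑ I : Finset (Fin m) with #I ≤ d + 1, ∑ I' : Finset (Fin n) with #I' ≤ d + 1,
        E₁ i I I' χ r :=
      sum_nonneg fun _ _ => sum_nonneg fun _ _ => sum_nonneg fun _ _ => hE₁ _ _ _ _ _
    have h2 : 0 ≤ ∑ I : Finset (Fin m) with #I ≤ d + 1, ∑ I' : Finset (Fin m) with #I' ≤ d + 1,
        E₂ I I' r ω := sum_nonneg fun _ _ => sum_nonneg fun _ _ => hE₂ _ _ _ _
    split_ifs with hT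
    · exact add_nonneg h1 h2
    rcases exists_event (x := x) P χ r ω (q r ω) (hq r ω) hT with
      ⟨i, I, I', hI, hI', hev⟩ | ⟨I, I', hI, hI', hS, hne⟩
    · have : E₁ i I I' χ r = 1 := if_pos hev
      refine le_trans (this.symm.le.trans ?_) (le_add_of_nonneg_right h2)
      refine le_trans ?_ (single_le_sum (f := fun i => ∑ I : Finset (Fin m) with #I ≤ d + 1,
        ∑ I' : Finset (Fin n) with #I' ≤ d + 1, E₁ i I I' χ r) (fun _ _ =>
        sum_nonneg fun _ _ => sum_nonneg fun _ _ => hE₁ _ _ _ _ _) (mem_univ i))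
      refine le_trans ?_ (single_le_sum (f := fun I =>
        ∑ I' : Finset (Fin n) with #I' ≤ d + 1, E₁ i I I' χ r) (fun _ _ =>
        sum_nonneg fun _ _ => hE₁ _ _ _ _ _) (mem_filter.2 ⟨mem_univ I, hI⟩))
      exact single_le_sum (f := fun I' => E₁ i I I' χ r) (fun _ _ => hE₁ _ _ _ _ _)
        (mem_filter.2 ⟨mem_univ I', hI'⟩)
    · have : E₂ I I' r ω = 1 := by simp only [E₂]; rw [if_pos hS, if_pos hne]
      refine le_trans (this.symm.le.trans ?_) (le_add_of_nonneg_left h1)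
      refine le_trans ?_ (single_le_sum (f := fun I =>
        ∑ I' : Finset (Fin m) with #I' ≤ d + 1, E₂ I I' r ω) (fun _ _ =>
        sum_nonneg fun _ _ => hE₂ _ _ _ _) (mem_filter.2 ⟨mem_univ I, hI⟩))
      exact single_le_sum (f := fun I' => E₂ I I' r ω) (fun _ _ => hE₂ _ _ _ _)
        (mem_filter.2 ⟨mem_univ I', hI'⟩)
  have hsum₁ : ∀ i, ∀ I : Finset (Fin m), #I ≤ d + 1 → ∀ I' : Finset (Fin n),
      ∑ χ, ∑ r, E₁ i I I' χ r ≤ (n : ℝ) ^ m * k ^ n * δ * (1 / k : ℝ) ^ #I' := by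
    intro i I hI I'
    rw [sum_comm]
    refine (sum_event_le hk i I I' (fun r => pointCut P r I I') (fun r r' hr => ?_) hδ
      (fun K => hcase I K hI)).trans (le_of_eq (by ring))
    have : (fun j => P (r j)) '' (I : Set (Fin m)) = (fun j => P (r' j)) '' I :=
      Set.image_congr fun j hj => by rw [hr j hj]
    simp only [pointCut, this]
  have hsum₂ : ∀ I I' r, ∑ ω, E₂ I I' r ω ≤
      ((1 / 2) ^ J + (1 / 2) ^ X) * 2 ^ x * (((m : ℝ) ^ (d + 2)) ^ m) ^ J := by
    intro I I' r
    by_cases hS : #(sampleCut P r I I') ≤ x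
    · simp only [E₂, if_pos hS]
      refine le_trans ?_ ((card_badAfter_nonempty_le hm hX J (sampleCut P r I I')).trans ?_)
      · refine le_of_eq (sum_congr rfl fun ω _ => ?_)
        congr
      · gcongr
        norm_num
    · simp only [E₂, if_neg hS, sum_const_zero]
      positivity
  have hcount : ∀ (z : ℝ) (hz : 0 ≤ z), ∑ I : Finset (Fin m) with #I ≤ d + 1, z ≤
      (1 + (m : ℝ)) ^ (d + 1) * z := by
    intro z hz
    have := sum_pow_card_le (n := m) (t := d + 1) (z := 1) zero_le_one
    simp only [one_pow, sum_const, nsmul_eq_mul, mul_one] at this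
    rw [sum_const, nsmul_eq_mul]
    exact mul_le_mul_of_nonneg_right this hz
  set W := (((m : ℝ) ^ (d + 2)) ^ m) ^ J with hW
  have hW0 : 0 ≤ W := by positivity
  have hcW : ∑ _ω : Fin J → Fin m → Fin (d + 2) → Fin m, (1 : ℝ) = W := by simp [hW]
  calc _ ≤ ∑ χ : Fin n → Fin k, ∑ r : Fin m → Fin n, ∑ ω : Fin J → Fin m → Fin (d + 2) → Fin m,
        ((∑ i, ∑ I : Finset (Fin m) with #I ≤ d + 1, ∑ I' : Finset (Fin n) with #I' ≤ d + 1,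
          E₁ i I I' χ r) +
        ∑ I : Finset (Fin m) with #I ≤ d + 1, ∑ I' : Finset (Fin m) with #I' ≤ d + 1,
          E₂ I I' r ω) :=
        sum_le_sum fun χ _ => sum_le_sum fun r _ => sum_le_sum fun ω _ => hpoint χ r ω
    _ = W * (∑ i, ∑ I : Finset (Fin m) with #I ≤ d + 1, ∑ I' : Finset (Fin n) with #I' ≤ d + 1,
          ∑ χ, ∑ r, E₁ i I I' χ r) +
        ∑ _χ : Fin n → Fin k, ∑ r : Fin m → Fin n, ∑ I : Finset (Fin m) with #I ≤ d + 1,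
          ∑ I' : Finset (Fin m) with #I' ≤ d + 1, ∑ ω, E₂ I I' r ω := by
        simp only [sum_add_distrib]
        congr 1
        · have : ∀ y : ℝ, ∑ _ω : Fin J → Fin m → Fin (d + 2) → Fin m, y = W * y := fun y => by
            rw [← hcW, sum_mul]; simp
          simp only [this, ← mul_sum]
          congr 1
          rw [sum_congr rfl fun χ _ => sum_comm, sum_comm]
          refine sum_congr rfl fun i _ => ?_
          rw [sum_congr rfl fun χ _ => sum_comm, sum_comm]
          refine sum_congr rfl fun I _ => ?_
          rw [sum_congr rfl fun χ _ => sum_comm, sum_comm]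
        · refine sum_congr rfl fun χ _ => sum_congr rfl fun r _ => ?_
          rw [sum_comm]
          exact sum_congr rfl fun I _ => sum_comm
    _ ≤ W * (∑ _i : Fin k, (1 + (m : ℝ)) ^ (d + 1) *
          ((n : ℝ) ^ m * k ^ n * δ * (1 + n * (1 / k)) ^ (d + 1))) +
        ∑ _χ : Fin n → Fin k, ∑ _r : Fin m → Fin n, (1 + (m : ℝ)) ^ (d + 1) *
          ((1 + (m : ℝ)) ^ (d + 1) * (((1 / 2) ^ J + (1 / 2) ^ X) * 2 ^ x * W)) := by
        gcongr with i _ χ _ r _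
        · refine le_trans (sum_le_sum fun I hI => ?_) (hcount _ (by positivity))
          refine (sum_le_sum fun I' _ => hsum₁ i I (mem_filter.1 hI).2 I').trans ?_
          rw [← mul_sum]
          exact mul_le_mul_of_nonneg_left (sum_pow_card_le hk0) (by positivity)
        · refine le_trans (sum_le_sum fun I _ => ?_) (hcount _ (by positivity))
          exact (sum_le_sum fun I' _ => hsum₂ I I' r).trans (hcount _ (by positivity))
    _ = _ := by
        simp only [sum_const, card_univ, Fintype.card_fun, Fintype.card_fin, nsmul_eq_mul]
        push_cast
        ring

end Events

/-! ### Estimates of the parameters -/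

section Numbers

variable {d : ℕ}

theorem le_two_pow_clog (d : ℕ) : d ≤ 2 ^ Nat.clog 2 d := Nat.le_pow_clog (by norm_num) d

theorem pow_self_le_two_pow_expScale (d : ℕ) : d ^ d ≤ 2 ^ expScale d := by
  rw [expScale, mul_comm, pow_mul]
  exact Nat.pow_le_pow_left (le_two_pow_clog d) d

theorem succ_le_two_mul_expScale (hd : 2 ≤ d) : d + 1 ≤ 2 * expScale d := by
  have : d ≤ expScale d := Nat.le_mul_of_pos_right _ (Nat.clog_pos (by norm_num) hd)
  omega

/-- Sets of at most `d + 1` indices contribute a factor `2 ^ O(d * ℓ)` to the union bound. -/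
theorem one_add_two_mul_levelSize_pow_le (hd : 2 ≤ d) :
    (1 + 2 * levelSize d) ^ (d + 1) ≤ 2 ^ (46 * expScale d) := by
  set l := Nat.clog 2 d with hl
  have hl1 : 1 ≤ l := Nat.clog_pos (by norm_num) hd
  have h1 : levelSize d ≤ 2 ^ 17 * 2 ^ (4 * l) := by
    have h2 : d ≤ 2 ^ l := le_two_pow_clog d
    have h3 : l ≤ 2 ^ l := Nat.lt_two_pow_self.le
    calc levelSize d = 2 ^ 17 * (d * d * (d * l)) := by
          rw [levelSize, expScale, ← hl]; norm_num
      _ ≤ 2 ^ 17 * (2 ^ l * 2 ^ l * (2 ^ l * 2 ^ l)) := by gcongr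
      _ = 2 ^ 17 * 2 ^ (4 * l) := by ring
  have h2 : 1 + 2 * levelSize d ≤ 2 ^ (23 * l) := by
    have h3 : 1 ≤ 2 ^ (4 * l) := Nat.one_le_two_pow
    calc 1 + 2 * levelSize d ≤ 2 ^ 19 * 2 ^ (4 * l) := by norm_num at h1 ⊢; omega
      _ = 2 ^ (19 + 4 * l) := by rw [pow_add]
      _ ≤ 2 ^ (23 * l) := Nat.pow_le_pow_right (by norm_num) (by omega)
  calc (1 + 2 * levelSize d) ^ (d + 1) ≤ (2 ^ (23 * l)) ^ (d + 1) := Nat.pow_le_pow_left h2 _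
    _ = 2 ^ (23 * l * (d + 1)) := by rw [← pow_mul]
    _ ≤ _ := Nat.pow_le_pow_right (by norm_num) (by
        have : l ≤ d * l := Nat.le_mul_of_pos_left _ (by omega)
        rw [expScale, ← hl]
        nlinarith)

theorem clog_le_three_mul_log (hd : 2 ≤ d) : (Nat.clog 2 d : ℝ) ≤ 3 * Real.log d := by
  have hd' : (2 : ℝ) ≤ d := by exact_mod_cast hd
  have hl1 : 1 ≤ Nat.clog 2 d := Nat.clog_pos (by norm_num) hd
  have h1 : 2 ^ (Nat.clog 2 d - 1) < d :=
    (Nat.lt_clog_iff_pow_lt (by norm_num)).1 (by omega)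
  have h2 : (2 : ℝ) ^ Nat.clog 2 d ≤ 2 * d := by
    have : 2 ^ Nat.clog 2 d ≤ 2 * d := by
      obtain ⟨l, hl⟩ := Nat.exists_eq_add_of_le hl1
      rw [hl] at h1 ⊢
      rw [Nat.add_sub_cancel_left] at h1
      rw [pow_add]; omega
    exact_mod_cast this
  have h3 := Real.log_le_log (by positivity) h2
  rw [Real.log_pow, Real.log_mul (by norm_num) (by linarith)] at h3
  have h4 : Real.log 2 ≤ Real.log d := Real.log_le_log (by norm_num) hd'
  have h5 := Real.log_two_gt_d9
  have h6 : (0 : ℝ) ≤ Nat.clog 2 d := Nat.cast_nonneg _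
  nlinarith

theorem levelSize_le (hd : 2 ≤ d) :
    (levelSize d : ℝ) ≤ 393216 * ((d : ℝ) ^ 3 * Real.log d) := by
  have h1 := clog_le_three_mul_log hd
  have h2 : (levelSize d : ℝ) = 131072 * ((d : ℝ) ^ 3 * Nat.clog 2 d) := by
    rw [levelSize, expScale]; push_cast; ring
  rw [h2]
  have : (d : ℝ) ^ 3 * Nat.clog 2 d ≤ (d : ℝ) ^ 3 * (3 * Real.log d) := by gcongr
  linarith

theorem timeBound_le (hd : 2 ≤ d) :
    (timeBound d : ℝ) ≤ 10 ^ 14 * ((d : ℝ) ^ 7 * Real.log d ^ 6) := by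
  have hd' : (2 : ℝ) ≤ d := by exact_mod_cast hd
  have h1 := clog_le_three_mul_log hd
  have h2 : (timeBound d : ℝ) = 450 * 4096 * 131072 *
      ((d : ℝ) ^ 4 * (Nat.clog 2 d : ℝ) ^ 2 * (d + 2) ^ 3) := by
    rw [timeBound, roundCount, levelSize, expScale]; push_cast; ring
  have h3 : (0.6931471803 : ℝ) ≤ Real.log d :=
    Real.log_two_gt_d9.le.trans (Real.log_le_log (by norm_num) hd')
  set y := Real.log d
  have h4 : (1 : ℝ) ≤ 5 * y ^ 4 := by
    have : (0.69 : ℝ) ^ 4 ≤ y ^ 4 := by gcongr; linarith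
    norm_num at this; linarith
  have h5 : (Nat.clog 2 d : ℝ) ^ 2 ≤ 45 * y ^ 6 := by
    calc (Nat.clog 2 d : ℝ) ^ 2 ≤ (3 * y) ^ 2 := by gcongr
      _ ≤ (3 * y) ^ 2 * (5 * y ^ 4) := le_mul_of_one_le_right (by positivity) h4
      _ = _ := by ring
  have h6 : ((d : ℝ) + 2) ^ 3 ≤ 8 * (d : ℝ) ^ 3 := by
    calc ((d : ℝ) + 2) ^ 3 ≤ (2 * d) ^ 3 := by gcongr; linarith
      _ = _ := by ring
  rw [h2]
  calc _ ≤ 450 * 4096 * 131072 * ((d : ℝ) ^ 4 * (45 * y ^ 6) * (8 * (d : ℝ) ^ 3)) := by gcongr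
    _ = 450 * 4096 * 131072 * 360 * ((d : ℝ) ^ 7 * y ^ 6) := by ring
    _ ≤ _ := by
        have : (0 : ℝ) ≤ (d : ℝ) ^ 7 * y ^ 6 := by positivity
        nlinarith

theorem exp_neg_le_half_pow (t : ℕ) : Real.exp (-t) ≤ (1 / 2 : ℝ) ^ t := by
  have h : Real.exp (-1) ≤ 1 / 2 := by
    rw [Real.exp_neg, one_div]
    refine inv_anti₀ (by norm_num) ?_
    linarith [Real.add_one_le_exp (1 : ℝ)]
  calc Real.exp (-t) = Real.exp (-1) ^ t := by rw [← Real.exp_nat_mul]; ring_nf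
    _ ≤ _ := pow_le_pow_left₀ (Real.exp_pos _).le h t

theorem exp_le_four_pow (t : ℕ) : Real.exp t ≤ (4 : ℝ) ^ t := by
  calc Real.exp t = Real.exp 1 ^ t := by rw [← Real.exp_nat_mul]; ring_nf
    _ ≤ _ := pow_le_pow_left₀ (Real.exp_pos _).le (by linarith [Real.exp_one_lt_d9]) t

/-- A halfspace with at least `n / (512 * d ^ 2)` of the `n` points is unlikely to miss a color, and
one with fewer of them is unlikely to contain many sample points. -/
theorem large_or_small (hd : 2 ≤ d) {n k i c : ℕ} (hk : 0 < k) (hkn : k * levelSize d ≤ n)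
    (hi : i ≤ d + 1) :
    (1 - 1 / k : ℝ) ^ c ≤ (1 / 2) ^ (256 * expScale d) ∨
      ((n : ℝ) + c) ^ (levelSize d - i) ≤
        (1 / 2) ^ (256 * expScale d) * n ^ (levelSize d - i) * 2 ^ (2048 * expScale d - i) := by
  have hk' : (1 : ℝ) ≤ k := by exact_mod_cast hk
  have hd0 : (0 : ℝ) < d := by exact_mod_cast (by omega : 0 < d)
  have hn0 : 0 < n := lt_of_lt_of_le (Nat.mul_pos hk (levelSize_pos hd)) hkn
  have hn0' : (0 : ℝ) < n := by exact_mod_cast hn0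
  set L := expScale d
  set m := levelSize d with hm
  have hmL : (m : ℝ) = 512 * d ^ 2 * (256 * L) := by rw [hm, levelSize]; push_cast; ring
  have hkn' : (k : ℝ) * m ≤ n := by exact_mod_cast hkn
  rcases le_or_gt ((n : ℝ)) (512 * d ^ 2 * c) with h | h
  · left
    have hq0 : (0 : ℝ) ≤ 1 - 1 / k := by
      rw [sub_nonneg, div_le_one (by linarith)]; exact hk'
    have h1 : (256 * L : ℝ) ≤ c * (1 / k) := by
      rw [mul_one_div, le_div_iff₀ (by linarith)]
      have h2 : 512 * (d : ℝ) ^ 2 * (256 * L * k) ≤ 512 * d ^ 2 * c := by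
        calc _ = (k : ℝ) * m := by rw [hmL]; ring
          _ ≤ _ := hkn'.trans h
      exact le_of_mul_le_mul_left h2 (by positivity)
    calc (1 - 1 / k : ℝ) ^ c ≤ Real.exp (-(1 / k)) ^ c := by
          refine pow_le_pow_left₀ hq0 ?_ c
          linarith [Real.add_one_le_exp (-(1 / k : ℝ))]
      _ = Real.exp (-(c * (1 / k))) := by rw [← Real.exp_nat_mul]; ring_nf
      _ ≤ Real.exp (-((256 * L : ℕ) : ℝ)) := by
          rw [Real.exp_le_exp]; push_cast; linarith
      _ ≤ _ := exp_neg_le_half_pow _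
  · right
    have hi' : i ≤ 2 * L := hi.trans (succ_le_two_mul_expScale hd)
    have h1 : ((m - i : ℕ) : ℝ) * (c / n) ≤ (256 * L : ℕ) := by
      have h2 : ((m - i : ℕ) : ℝ) ≤ m := by exact_mod_cast Nat.sub_le m i
      calc ((m - i : ℕ) : ℝ) * (c / n) ≤ m * (c / n) := by gcongr
        _ ≤ _ := by
            rw [mul_div_assoc', div_le_iff₀ hn0', hmL]
            push_cast
            have : (0 : ℝ) ≤ 256 * L := by positivity
            nlinarith
    have h3 : (1 + c / n : ℝ) ^ (m - i) ≤ 4 ^ (256 * L) := by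
      calc (1 + c / n : ℝ) ^ (m - i) ≤ Real.exp (c / n) ^ (m - i) := by
            gcongr
            linarith [Real.add_one_le_exp (c / n : ℝ)]
        _ = Real.exp (((m - i : ℕ) : ℝ) * (c / n)) := by rw [← Real.exp_nat_mul]
        _ ≤ Real.exp (256 * L : ℕ) := Real.exp_le_exp.2 h1
        _ ≤ _ := exp_le_four_pow _
    have h4 : (4 : ℝ) ^ (256 * L) ≤ (1 / 2) ^ (256 * L) * 2 ^ (2048 * L - i) := by
      rw [one_div, inv_pow, ← div_eq_inv_mul, le_div_iff₀ (by positivity),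
        show (4 : ℝ) = 2 ^ 2 by norm_num, ← pow_mul, ← pow_add]
      exact pow_le_pow_right₀ (by norm_num) (by omega)
    calc ((n : ℝ) + c) ^ (m - i) = n ^ (m - i) * (1 + c / n) ^ (m - i) := by
          rw [← mul_pow, mul_add, mul_one, mul_div_cancel₀ _ hn0'.ne']
      _ ≤ n ^ (m - i) * ((1 / 2) ^ (256 * L) * 2 ^ (2048 * L - i)) := by
          gcongr
          exact h3.trans h4
      _ = _ := by ring

/-- The total failure probability. -/
theorem failure_le (hd : 2 ≤ d) {n k : ℕ} (hk : 0 < k) (hnk : n < (k + 1) * levelSize d) :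
    (k : ℝ) * ((1 + levelSize d) ^ (d + 1) * (1 + n * (1 / k)) ^ (d + 1) *
        (1 / 2) ^ (256 * expScale d)) +
      (1 + levelSize d) ^ (d + 1) * (1 + levelSize d) ^ (d + 1) *
        (((1 / 2) ^ roundCount d + (1 / 2) ^ (4096 * expScale d)) * 2 ^ (2048 * expScale d)) ≤
      k / (d : ℝ) ^ d := by
  have hk' : (1 : ℝ) ≤ k := by exact_mod_cast hk
  have hL := expScale_pos hd
  set L := expScale d
  set m := levelSize d
  have hA : (1 + 2 * (m : ℝ)) ^ (d + 1) ≤ 2 ^ (46 * L) := by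
    exact_mod_cast one_add_two_mul_levelSize_pow_le hd
  have hB : (1 + (m : ℝ)) ^ (d + 1) ≤ 2 ^ (46 * L) := by
    refine le_trans ?_ hA
    gcongr
    have : (0 : ℝ) ≤ m := Nat.cast_nonneg m
    linarith
  have hC : (1 + n * (1 / k) : ℝ) ^ (d + 1) ≤ 2 ^ (46 * L) := by
    refine le_trans (pow_le_pow_left₀ (by positivity) ?_ _) hA
    have h1 : (n : ℝ) < (k + 1) * m := by exact_mod_cast hnk
    have h2 : (0 : ℝ) ≤ m := Nat.cast_nonneg m
    have h3 : (n : ℝ) * (1 / k) ≤ 2 * m := by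
      rw [mul_one_div, div_le_iff₀ (by linarith)]; nlinarith
    linarith
  have hhalf : ∀ s t : ℕ, s + 2 * L ≤ t → (2 : ℝ) ^ s * (1 / 2) ^ t ≤ (1 / 2) ^ (2 * L) := by
    intro s t hst
    calc (2 : ℝ) ^ s * (1 / 2) ^ t ≤ 2 ^ s * (1 / 2) ^ (s + 2 * L) := by
          refine mul_le_mul_of_nonneg_left ?_ (by positivity)
          exact pow_le_pow_of_le_one (by norm_num) (by norm_num) hst
      _ = (2 * (1 / 2)) ^ s * (1 / 2 : ℝ) ^ (2 * L) := by rw [pow_add, mul_pow]; ring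
      _ = _ := by norm_num
  have h1 : (1 + (m : ℝ)) ^ (d + 1) * (1 + n * (1 / k)) ^ (d + 1) * (1 / 2) ^ (256 * L) ≤
      (1 / 2) ^ (2 * L) := by
    calc _ ≤ (2 : ℝ) ^ (46 * L) * 2 ^ (46 * L) * (1 / 2) ^ (256 * L) := by gcongr
      _ = 2 ^ (46 * L + 46 * L) * (1 / 2) ^ (256 * L) := by rw [pow_add]
      _ ≤ _ := hhalf _ _ (by omega)
  have h2 : (1 + (m : ℝ)) ^ (d + 1) * (1 + m) ^ (d + 1) *
      (((1 / 2) ^ roundCount d + (1 / 2) ^ (4096 * L)) * 2 ^ (2048 * L)) ≤ (1 / 2) ^ (2 * L) := by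
    change _ * (((1 / 2) ^ (4096 * L) + _) * _) ≤ _
    calc _ ≤ (2 : ℝ) ^ (46 * L) * 2 ^ (46 * L) *
          (((1 / 2) ^ (4096 * L) + (1 / 2) ^ (4096 * L)) * 2 ^ (2048 * L)) := by gcongr
      _ = 2 ^ (46 * L + 46 * L + 2048 * L + 1) * (1 / 2) ^ (4096 * L) := by
          rw [pow_add, pow_add, pow_add, pow_one]; ring
      _ ≤ _ := hhalf _ _ (by omega)
  have h3 : (2 : ℝ) * (1 / 2) ^ (2 * L) ≤ (1 / 2) ^ L := by
    calc (2 : ℝ) * (1 / 2) ^ (2 * L) ≤ 2 * (1 / 2) ^ (L + 1) := by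
          refine mul_le_mul_of_nonneg_left ?_ (by norm_num)
          exact pow_le_pow_of_le_one (by norm_num) (by norm_num) (by omega)
      _ = _ := by rw [pow_succ]; ring
  have h4 : (1 / 2 : ℝ) ^ L ≤ 1 / (d : ℝ) ^ d := by
    have h5 : (d : ℝ) ^ d ≤ 2 ^ L := by exact_mod_cast pow_self_le_two_pow_expScale d
    have h6 : (0 : ℝ) < (d : ℝ) ^ d := by
      have : (0 : ℝ) < d := by exact_mod_cast (by omega : 0 < d)
      positivity
    rw [one_div, inv_pow, ← one_div]
    exact one_div_le_one_div_of_le h6 h5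
  have h7 : (0 : ℝ) ≤ (1 / 2) ^ (2 * L) := by positivity
  calc _ ≤ (k : ℝ) * (1 / 2) ^ (2 * L) + (1 / 2) ^ (2 * L) :=
        add_le_add (mul_le_mul_of_nonneg_left h1 (by linarith)) h2
    _ ≤ k * (2 * (1 / 2) ^ (2 * L)) := by nlinarith
    _ ≤ k * (1 / (d : ℝ) ^ d) := mul_le_mul_of_nonneg_left (h3.trans h4) (by linarith)
    _ = _ := by ring

end Numbers

/-! ### The success probability -/

namespace RealRAM

variable {n d : ℕ}

/-- A sequence of `J * m * e` values, read as `J` rounds of `m` rows of `e` values. -/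
def roundsEquiv (J m e : ℕ) {α β : Type*} (h : α ≃ β) :
    (Fin (J * m * e) → α) ≃ (Fin J → Fin m → Fin e → β) :=
  (Equiv.arrowCongr (finProdFinEquiv.symm.trans
    (finProdFinEquiv.symm.prodCongr (Equiv.refl _))) h).trans
    ((Equiv.curry _ _ _).trans (Equiv.curry _ _ _))

theorem roundsEquiv_apply {J m e : ℕ} {α β : Type*} (h : α ≃ β) (f : Fin (J * m * e) → α)
    (t : Fin J) (j : Fin m) (s : Fin e) :
    roundsEquiv J m e h f t j s = h (f (finProdFinEquiv (finProdFinEquiv (t, j), s))) := rfl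

theorem haltsWithin_centerPoint (P : Fin (n + 1) → Fin d → ℝ) (hd : 2 ≤ d) :
    Program.HaltsWithin .centerPoint P (timeBound d) := by
  obtain ⟨out, hout, -⟩ := centerPoint_run P hd (k := levelSize d - 1)
    (Nat.sub_add_cancel (levelSize_pos hd)).symm rfl
  intro c hc
  rw [hout] at hc
  obtain ⟨r, -, hr⟩ := (PMF.mem_support_bind_iff _ _ _).1 hc
  obtain ⟨f, -, rfl⟩ := (PMF.mem_support_map_iff _ _ _).1 hr
  rfl

/-- The output is a function `q` of a random sample `r` and of random rounds `ω`, and it lies in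
every convex set with the property that the sample points outside of it die out. -/
theorem exists_output_eq (P : Fin (n + 1) → Fin d → ℝ) (hd : 2 ≤ d)
    [Nonempty (Fin (roundCount d) → Fin (levelSize d) → Fin (d + 2) → Fin (levelSize d))] :
    ∃ q : (Fin (levelSize d) → Fin (n + 1)) →
        (Fin (roundCount d) → Fin (levelSize d) → Fin (d + 2) → Fin (levelSize d)) → Fin d → ℝ,
      Program.output .centerPoint P (timeBound d) =
        (PMF.uniformOfFintype (_ × _)).map (fun x => q x.1 x.2) ∧
      ∀ r ω, ∀ G : Set (Fin d → ℝ), Convex ℝ G → ∀ B : Finset (Fin (levelSize d)),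
        (∀ j, P (r j) ∉ G → j ∈ B) → q r ω ∉ G → (badAfter (roundCount d) ω B).Nonempty := by
  have hm := levelSize_pos hd
  have hk : levelSize d = levelSize d - 1 + 1 := (Nat.sub_add_cancel hm).symm
  obtain ⟨out, hout, hspec⟩ := centerPoint_run P hd hk rfl
  let e := roundsEquiv (roundCount d) (levelSize d) (d + 2) (finCongr hk.symm)
  refine ⟨fun r ω => Config.outputPoint d ⟨[], out r (e.symm ω)⟩, ?_, ?_⟩
  · refine Eq.trans ?_ (uniformOfFintype_bind_map fun r ω =>
      Config.outputPoint d ⟨[], out r (e.symm ω)⟩)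
    rw [Program.output, hout, PMF.map_bind]
    congr 1
    funext r
    rw [PMF.map_comp, ← uniformOfFintype_map_equiv e.symm, PMF.map_comp]
    rfl
  · intro r ω G hG B hB hq
    obtain ⟨R, idx, hR, hidx, pts, hpts, hlast⟩ := hspec r (e.symm ω)
    refine ⟨⟨levelSize d - 1, by omega⟩, hpts.mem_badAfter (fun i hi => ?_) hG (roundCount d) 0
      (by omega) ω (fun t j s => ?_) B (fun j hj => hB j fun hj' => hj ?_)
      ⟨levelSize d - 1, by omega⟩ fun h => hq ?_⟩
    · rw [hidx ⟨i, hi⟩]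
      have := (e.symm ω ⟨i, hi⟩).2
      omega
    · have h1 : ω t j s = finCongr hk.symm
          (e.symm ω (finProdFinEquiv (finProdFinEquiv (t, j), s))) := by
        rw [← roundsEquiv_apply (finCongr hk.symm)]
        exact (congrFun (congrFun (congrFun (e.apply_symm_apply ω) t) j) s).symm
      rw [h1, finCongr_apply, Fin.val_cast, ← hidx]
      congr 1
      simp only [finProdFinEquiv_apply_val]
      ring
    · convert hj' using 1
      funext c
      rw [zero_mul, zero_add, (hpts.first j j.2).1 c c.2, hR, inputEntry,
        dif_pos ⟨(r j).2, c.2⟩]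
    · convert h using 1
      funext c
      refine (hlast c c.2).trans (congrArg (pts · c) ?_)
      simp only [zero_add]
      omega

end RealRAM

section Success

variable {n d : ℕ}

open Classical in
/-- The uniform distribution gives small mass to the complement of a set if few elements lie in the
complement. -/
theorem ofReal_le_uniformOfFintype {α : Type*} [Fintype α] [Nonempty α] (S : Set α) {p : ℝ}
    (h : ∑ a, (if a ∈ S then (0 : ℝ) else 1) ≤ Fintype.card α * p) :
    ENNReal.ofReal (1 - p) ≤ (PMF.uniformOfFintype α).toOuterMeasure S := by
  have hα : (0 : ℝ) < Fintype.card α := by exact_mod_cast Fintype.card_pos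
  have h1 : ∑ a, (if a ∈ S then (0 : ℝ) else 1) + Fintype.card S = Fintype.card α := by
    have h2 : (Fintype.card S : ℝ) = ∑ a, (if a ∈ S then (1 : ℝ) else 0) := by
      rw [sum_boole, Fintype.card_subtype]
    rw [h2, ← sum_add_distrib, ← card_univ, card_eq_sum_ones, Nat.cast_sum]
    refine sum_congr rfl fun a _ => ?_
    split_ifs <;> simp
  rw [PMF.toOuterMeasure_uniformOfFintype_apply, ← ENNReal.ofReal_natCast,
    ← ENNReal.ofReal_natCast, ← ENNReal.ofReal_div_of_pos hα]
  refine ENNReal.ofReal_le_ofReal ?_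
  rw [le_div_iff₀ hα]
  linarith

theorem sq_mul_le_levelSize (hd : 2 ≤ d) :
    (d + 2) ^ 2 * (8 * (4096 * expScale d)) ≤ levelSize d := by
  calc (d + 2) ^ 2 * (8 * (4096 * expScale d)) ≤ (2 * d) ^ 2 * (8 * (4096 * expScale d)) := by
        gcongr; omega
    _ = levelSize d := by rw [levelSize]; ring

theorem le_successProbability (hd : 2 ≤ d) (P : Fin (n + 1) → Fin d → ℝ) (k : ℕ) [NeZero k]
    (hkn : k * levelSize d ≤ n + 1) (hnk : n + 1 < (k + 1) * levelSize d) :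
    ENNReal.ofReal (1 - k / (d : ℝ) ^ d) ≤
      successProbability .centerPoint P k (timeBound d) := by
  classical
  have hk : 0 < k := Nat.pos_of_ne_zero (NeZero.ne k)
  have hm := levelSize_pos hd
  have : Nonempty (Fin (levelSize d)) := ⟨⟨0, hm⟩⟩
  obtain ⟨q, hout, hq⟩ := RealRAM.exists_output_eq P hd
  have hprob : ((randomColoring (n + 1) k).bind fun χ =>
      (RealRAM.Program.output .centerPoint P (timeBound d)).map fun q => (χ, q)) =
      (PMF.uniformOfFintype (_ × (_ × _))).map fun x => (x.1, q x.2.1 x.2.2) := by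
    refine Eq.trans ?_ (RealRAM.uniformOfFintype_bind_map fun (χ : Fin (n + 1) → Fin k)
      (x : (Fin (levelSize d) → Fin (n + 1)) ×
        (Fin (roundCount d) → Fin (levelSize d) → Fin (d + 2) → Fin (levelSize d))) =>
        (χ, q x.1 x.2))
    rw [randomColoring, hout]
    congr 1
    funext χ
    rw [PMF.map_comp]
    rfl
  rw [successProbability, hprob, PMF.toOuterMeasure_map_apply]
  refine ofReal_le_uniformOfFintype _ ?_
  rw [Fintype.sum_prod_type]
  simp only [Fintype.sum_prod_type]
  refine (sum_bad_le (x := 2048 * expScale d) (X := 4096 * expScale d)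
    (δ := (1 / 2) ^ (256 * expScale d)) P hk hm (sq_mul_le_levelSize hd) (by positivity)
    (fun I K hI => large_or_small hd hk hkn hI) q hq).trans ?_
  have hcard : (Fintype.card ((Fin (n + 1) → Fin k) × (Fin (levelSize d) → Fin (n + 1)) ×
      (Fin (roundCount d) → Fin (levelSize d) → Fin (d + 2) → Fin (levelSize d))) : ℝ) =
      (k : ℝ) ^ (n + 1) * ((n + 1 : ℕ) : ℝ) ^ levelSize d *
        (((levelSize d : ℝ) ^ (d + 2)) ^ levelSize d) ^ roundCount d := by
    simp only [Fintype.card_prod, Fintype.card_fun, Fintype.card_fin]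
    push_cast
    ring
  rw [hcard]
  exact mul_le_mul_of_nonneg_left (failure_le hd hk hnk) (by positivity)

end Success

theorem mainTheorem4 :
    ∃ (A : RealRAM.Program) (N T : ℕ → ℕ) (C c : ℝ), 0 < C ∧ 0 < c ∧
      (∀ d : ℕ, 2 ≤ d →
        0 < N d ∧ (N d : ℝ) ≤ C * ((d : ℝ) ^ 3 * Real.log d) ∧
        (T d : ℝ) ≤ C * ((d : ℝ) ^ 7 * Real.log d ^ 6)) ∧
      ∀ (d n : ℕ) (P : Fin n → Fin d → ℝ) (k : ℕ) [NeZero k],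
        2 ≤ d → Function.Injective P → k = n / N d →
          c * ((n : ℝ) / ((d : ℝ) ^ 3 * Real.log d)) ≤ (k : ℝ) ∧
          A.HaltsWithin P (T d) ∧
          ENNReal.ofReal (1 - (k : ℝ) / (d : ℝ) ^ (c * (d : ℝ))) ≤
            successProbability A P k (T d) := by
  have hlog : ∀ d : ℕ, 2 ≤ d → (0 : ℝ) < (d : ℝ) ^ 3 * Real.log d := fun d hd => by
    have hd' : (1 : ℝ) < d := by exact_mod_cast hd
    exact mul_pos (by positivity) (Real.log_pos hd')
  -- `c = 1 / (2 * 393216)`, where the `2` makes up for the rounding in `k = n / levelSize d`; any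
  -- `c ≤ 1` is small enough for the failure probability
  refine ⟨.centerPoint, levelSize, timeBound, 10 ^ 14, 1 / 786432, by norm_num, by norm_num,
    fun d hd => ⟨levelSize_pos hd, (levelSize_le hd).trans ?_, timeBound_le hd⟩, ?_⟩
  · have := hlog d hd
    linarith
  intro d n P k _ hd _ hkdef
  have hm := levelSize_pos hd
  have hk : 0 < k := Nat.pos_of_ne_zero (NeZero.ne k)
  have hkn : k * levelSize d ≤ n := hkdef ▸ Nat.div_mul_le_self n _
  have hnk : n < (k + 1) * levelSize d := by
    rw [hkdef, mul_comm]; exact Nat.lt_mul_div_succ n hm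
  obtain ⟨n, rfl⟩ : ∃ n', n = n' + 1 :=
    Nat.exists_eq_succ_of_ne_zero (lt_of_lt_of_le (Nat.mul_pos hk hm) hkn).ne'
  refine ⟨?_, RealRAM.haltsWithin_centerPoint P hd,
    le_trans (ENNReal.ofReal_le_ofReal ?_) (le_successProbability hd P k hkn hnk)⟩
  · have h1 : ((n + 1 : ℕ) : ℝ) ≤ (k + 1) * levelSize d := by exact_mod_cast hnk.le
    have h2 : (1 : ℝ) ≤ k := by exact_mod_cast hk
    have h3 := levelSize_le hd
    rw [mul_div_assoc', div_le_iff₀ (hlog d hd)]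
    have h4 : (k : ℝ) * levelSize d ≤ k * (393216 * ((d : ℝ) ^ 3 * Real.log d)) := by gcongr
    have h5 : (levelSize d : ℝ) ≤ k * levelSize d :=
      le_mul_of_one_le_left (Nat.cast_nonneg _) h2
    linarith
  · have hd' : (1 : ℝ) ≤ d := by exact_mod_cast (by omega : 1 ≤ d)
    have h1 : (d : ℝ) ^ (1 / 786432 * (d : ℝ)) ≤ (d : ℝ) ^ d := by
      rw [← Real.rpow_natCast]
      exact Real.rpow_le_rpow_of_exponent_le hd' (by linarith)
    have h2 : (0 : ℝ) < (d : ℝ) ^ (1 / 786432 * (d : ℝ)) := Real.rpow_pos_of_pos (by linarith) _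
    have h3 : (k : ℝ) / (d : ℝ) ^ d ≤ k / (d : ℝ) ^ (1 / 786432 * (d : ℝ)) := by gcongr
    linarith
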